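/- **Setting.** Let $r>4$ be an integer and let $V_1,V_2:\mathbb R\to\mathbb R$ be $C^{r+1}$ potentials with finitely many critical points, all nondegenerate, bounded below and with $V_i(x)\to\infty$ as $|x|\to\infty$; let $V_r:\mathbb R^2\to\mathbb R$ be $C^{r+1}$. Consider the motion of a particle with Hamiltonian $$H=\tfrac12(p_1^2+p_2^2)+V_1(q_1)+V_2(q_2)+\epsilon_rV_r(q_1,q_2)$$ in the half plane $q_1\ge\epsilon_wq_2$, with elastic reflection at the wall $q_1=\epsilon_wq_2$. Call $x$ a saddle of $V_i$ if $V_i'(x)=0>V_i''(x)$. Assume that the wall position is regular: $V_1'(0)\ne0$ and $V_1(0)\neq V_1(s)$ for every saddle $s$ of $V_1$. For a leaf of $H_i=\frac12p_i^2+V_i(q_i)$ (a connected component of a level set) let $\frac1{2\pi}\oint p_i\,dq_i$ be its action, denoted $J$ for $i=1$ and $I$ for $i=2$, and let $\omega_i$ be the derivative of $H_i$ with respect to the action along the branch (the family of regular leaves) containing it. For $\delta>0$ let $\mathbb H_i^{R,\delta}(H)$ be the set of $e\in[\min V_i,\,H-\min V_{\bar i}]$ at distance at least $\delta$ from $V_i(s)$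 for all saddles $s$ of $V_i$ and from $H-V_{\bar i}(s)$ for all saddles $s$ of $V_{\bar i}$, where $\bar i\ne i$. Let $I_{tan}$ be the action of the leaf of $H_2$ with energy $H-V_1(0)$ on the branch considered (if there is one). Put $\tilde T_1(J)=2\pi/\omega_1(J)-\Delta t$, where $\Delta t=2\int dq_1/\sqrt{2(H_1-V_1(q_1))}$ over the part of the leaf in $q_1\le0$. Let $\alpha=\arctan\epsilon_w$, $\tilde q=Rq$, $\tilde p=Rp$ with $R=\begin{pmatrix}\cos\alpha&-\sin\alpha\\ \sin\alpha&\cos\alpha\end{pmatrix}$. Write $\tilde I$ for the action of $H_2$ at $(\tilde q_2,\tilde p_2)$. Let $\mathcal F_\epsilon$ be the first return map of the perturbed impact system, on its energy surface $H$, to the section $\{\tilde p_1=0,\ d\tilde p_1/dt<0\}$. **Statement.** 1. For all $\epsilon_w,\epsilon_r$ the (orthogonal, hence symplectic) rotation turns the impact motions of the system with wall $q_1=\epsilon_wq_2$ exactly into the impact motions with the perpendicular wall $\tilde q_1=0$ and the potential $$V_1(\tilde q_1)+V_2(\tilde q_2)+\epsilon_wV_{rem}(\tilde q;\epsilon_w)+\epsilon_rV_r(R^{-1}\tilde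 q),$$ where $V_{rem}$ is $C^r$ in $(\tilde q,\epsilon_w)$ and $V_{rem}=\tilde q_2V_1'(\tilde q_1)-\tilde q_1V_2'(\tilde q_2)+O(\epsilon_w)$, uniformly on compact sets. 2. Let $\delta,\rho>0$ and let $H$ be $\delta$-regular, i.e. $V_1(0)\in\mathbb H_1^{R,\delta}(H)$. Consider initial conditions on the section whose second energy lies in $\mathbb H_2^{R,\delta}(H)$ and with $|\tilde I-I_{tan}|\ge\rho$, where $\tilde q_1(0)>0$ (on leaves that do not reach the wall assume also $\tilde J\ge\kappa$, with an arbitrary fixed $\kappa>0$). Then, for $\epsilon_r=0$ and all sufficiently small $|\epsilon_w|$, $\mathcal F_\epsilon$ is well defined and changes $\tilde I$ to $\tilde I+\epsilon_wf$ with $$f=\frac1{\omega_2(\tilde I)}\int_0^{\tilde T_1(\tilde J)}\Big(\big[-V_1'(\tilde q_1)+\tilde q_1V_2''(\tilde q_2)\big]\,\tilde p_2\Big)_{\tilde z_0^{im}(t)}dt+O(\epsilon_w).$$ Here $\tilde z_0^{im}$ is the motion of the unperturbed system ($\epsilon_w=\epsilon_r=0$, wall $\tilde q_1=0$) on the energy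 surface $H$ which starts on the section with the same $(\tilde q_2,\tilde p_2)$; its first return time is $\tilde T_1(\tilde J)$, and $\tilde J$ is its first action. 3. If $\epsilon_w=c_w\epsilon$ and $\epsilon_r=c_r\epsilon$ with constants $c_w,c_r\in\mathbb R$, then under the same conditions, for all sufficiently small $|\epsilon|$, $\tilde I$ changes to $\tilde I+\epsilon f$ with $$f=\frac1{\omega_2(\tilde I)}\int_0^{\tilde T_1(\tilde J)}\Big(\Big[c_w\big[-V_1'(\tilde q_1)+\tilde q_1V_2''(\tilde q_2)\big]-c_r\frac{\partial V_r}{\partial q_2}(\tilde q)\Big]\tilde p_2\Big)_{\tilde z_0^{im}(t)}dt+O(\epsilon).$$ The smallness thresholds and the $O$-constants in 2 and 3 are uniform in the initial condition: they depend only on the system, $H,\delta,\rho$ (and $\kappa,c_w,c_r$). -/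

import Mathlib

noncomputable section

namespace ImpactSystem

open Set Filter Topology MeasureTheory

/-! ### One degree of freedom: potentials, leaves, action and frequency -/

/-- A smooth, simple potential of one variable with bounded level sets: `C^{r+1}`, finitely many
critical points, all of them nondegenerate, bounded from below, and `V → ∞` at `±∞`. -/
structure IsS3B (r : ℕ) (V : ℝ → ℝ) : Prop where
  smooth : ContDiff ℝ (r + 1) V
  finite_critical : {x | deriv V x = 0}.Finite
  simple : ∀ x, deriv V x = 0 → deriv (deriv V) x ≠ 0
  bddBelow : BddBelow (range V)
  coercive : Tendsto V (cocompact ℝ) atTop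

/-- `(x, 0)` is a saddle point of `y ^ 2 / 2 + V x`. -/
def IsSaddle (V : ℝ → ℝ) (x : ℝ) : Prop := deriv V x = 0 ∧ deriv (deriv V) x < 0

/-- Projection to the position axis of the leaf of energy `h` over `x`: the connected component
of `{V ≤ h}` containing `x`. -/
def well (V : ℝ → ℝ) (x h : ℝ) : Set ℝ := connectedComponentIn {y | V y ≤ h} x

/-- The action `(1 / 2π) ∮ p dq` of the leaf of energy `h` over `x`. -/
def action (V : ℝ → ℝ) (x h : ℝ) : ℝ :=
  (1 / Real.pi) * ∫ y in well V x h, Real.sqrt (2 * (h - V y))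

/-- The frequency `dh / d(action)` on the leaf of energy `h` over `x`. The derivative of the action
with respect to the energy is taken from the right, since `x` need not belong to the leaves of
lower energy (it may be a turning point or a center). On regular leaves the action is continuously
differentiable in the energy along the branch, so this is the usual derivative. -/
def freq (V : ℝ → ℝ) (x h : ℝ) : ℝ := (derivWithin (fun e => action V x e) (Ici h) h)⁻¹

/-- The time spent in `{y ≤ 0}` by the motion (without wall) along the leaf of energy `h` over `x`;
it vanishes if the leaf lies in `{y > 0}`. -/
def travelTime (V : ℝ → ℝ) (x h : ℝ) : ℝ :=
  2 * ∫ y in well V x h ∩ Iic 0, 1 / Real.sqrt (2 * (h - V y))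

/-- The period of the first degree of freedom with a perpendicular wall at `0`: the smooth period
minus the travel time beyond the wall. -/
def impactPeriod (V : ℝ → ℝ) (x h : ℝ) : ℝ := 2 * Real.pi / freq V x h - travelTime V x h

/-- The leaves of energies `h` over `x` and `h'` over `x'` belong to the same branch: one of them
encloses the other and there is no singular point between them. -/
def SameBranch (V : ℝ → ℝ) (x h x' h' : ℝ) : Prop :=
  (well V x h ⊆ well V x' h' ∧ ∀ y ∈ well V x' h' \ well V x h, deriv V y ≠ 0) ∨
  (well V x' h' ⊆ well V x h ∧ ∀ y ∈ well V x h \ well V x' h', deriv V y ≠ 0)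

/-- The values of the energy of the degree of freedom with potential `V` that are allowed at total
energy `H` and `δ`-away from all singular values; `W` is the potential of the other degree of
freedom. -/
def regularEnergies (V W : ℝ → ℝ) (H δ : ℝ) : Set ℝ :=
  {e | (⨅ x, V x) ≤ e ∧ e ≤ H - (⨅ x, W x) ∧
    (∀ s, IsSaddle V s → δ ≤ |e - V s|) ∧ ∀ s, IsSaddle W s → δ ≤ |e - (H - W s)|}

/-- Regularity of the wall position `0` for the first potential. -/
def RegularWall (V₁ : ℝ → ℝ) : Prop := deriv V₁ 0 ≠ 0 ∧ ∀ s, IsSaddle V₁ s → V₁ 0 ≠ V₁ s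

/-- The tangency values of the second action at total energy `H`, on the branch of the leaf of
energy `h` over `x`. -/
def tangentActions (V₁ V₂ : ℝ → ℝ) (H x h : ℝ) : Set ℝ :=
  {I | ∃ x', V₂ x' ≤ H - V₁ 0 ∧ SameBranch V₂ x h x' (H - V₁ 0) ∧ I = action V₂ x' (H - V₁ 0)}

/-! ### Impact motion in the plane -/

def dot (v w : ℝ × ℝ) : ℝ := v.1 * w.1 + v.2 * w.2

def grad (U : ℝ × ℝ → ℝ) (q : ℝ × ℝ) : ℝ × ℝ := (fderiv ℝ U q (1, 0), fderiv ℝ U q (0, 1))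

/-- Elastic reflection from a line with normal vector `n`. -/
def reflect (n p : ℝ × ℝ) : ℝ × ℝ := p - (2 * dot n p / dot n n) • n

/-- The energy `‖p‖ ^ 2 / 2 + U q`. -/
def energy (U : ℝ × ℝ → ℝ) (q p : ℝ × ℝ) : ℝ := dot p p / 2 + U q

/-- `(q, p)` is, on the time interval `[0, T]`, a motion in the potential `U` in the half plane
`{q | 0 ≤ dot n q}` with elastic reflection at its boundary line. The momentum is continuous from
the right and has a limit from the left; away from the wall it is continuous, and on the wall the
incoming momentum is reflected. -/
structure IsImpactMotion (U : ℝ × ℝ → ℝ) (n : ℝ × ℝ) (T : ℝ) (q p : ℝ → ℝ × ℝ) : Prop where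
  continuousOn : ContinuousOn q (Icc 0 T)
  inside : ∀ t ∈ Icc 0 T, 0 ≤ dot n (q t)
  velocity : ∀ t ∈ Ico 0 T, HasDerivWithinAt q (p t) (Ici t) t
  force : ∀ t ∈ Ico 0 T, HasDerivWithinAt p (-grad U (q t)) (Ici t) t
  free : ∀ t ∈ Ioc 0 T, 0 < dot n (q t) → Tendsto p (𝓝[<] t) (𝓝 (p t))
  impact : ∀ t ∈ Ioc 0 T, dot n (q t) = 0 →
    ∃ p' : ℝ × ℝ, Tendsto p (𝓝[<] t) (𝓝 p') ∧ p t = reflect n p'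

/-- The motion `(q, p)` starts on the cross-section `S` and returns to it for the first time at
time `T`. -/
def IsFirstReturn (U : ℝ × ℝ → ℝ) (n : ℝ × ℝ) (S : ℝ × ℝ → ℝ × ℝ → Prop) (T : ℝ)
    (q p : ℝ → ℝ × ℝ) : Prop :=
  0 < T ∧ IsImpactMotion U n T q p ∧ S (q 0) (p 0) ∧ S (q T) (p T) ∧
    ∀ t ∈ Ioo 0 T, ¬ S (q t) (p t)

/-- The cross-section `p₁ = 0`, `dp₁/dt < 0`. -/
def turningSection (U : ℝ × ℝ → ℝ) (q p : ℝ × ℝ) : Prop := p.1 = 0 ∧ -(grad U q).1 < 0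

/-- `V₁(q₁) + V₂(q₂) + ε_r V_r(q₁, q₂)`. -/
def potential (V₁ V₂ : ℝ → ℝ) (Vr : ℝ × ℝ → ℝ) (εr : ℝ) (q : ℝ × ℝ) : ℝ :=
  V₁ q.1 + V₂ q.2 + εr * Vr q

/-! ### Tilted walls and rotated coordinates -/

def rot (α : ℝ) (v : ℝ × ℝ) : ℝ × ℝ :=
  (Real.cos α * v.1 - Real.sin α * v.2, Real.sin α * v.1 + Real.cos α * v.2)

/-- Normal vector of the wall `q₁ = ε_w q₂`, pointing into the domain `q₁ > ε_w q₂`. -/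
def wallNormal (εw : ℝ) : ℝ × ℝ := (1, -εw)

/-- The rotation that turns the wall `q₁ = ε_w q₂` into the vertical axis. -/
def straighten (εw : ℝ) (v : ℝ × ℝ) : ℝ × ℝ := rot (Real.arctan εw) v

/-- The potential `U` as a function of the rotated position. -/
def rotatedPotential (εw : ℝ) (U : ℝ × ℝ → ℝ) (v : ℝ × ℝ) : ℝ := U (rot (-Real.arctan εw) v)

/-- The return map, in rotated coordinates, of the system with potential `U` and wall
`q₁ = ε_w q₂`: the set of rotated states at the first return to the cross-section `dp₁/dt < 0 = p₁`
(rotated momentum) of the motions with rotated initial state `(x, y)`. -/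
def returnStates (U : ℝ × ℝ → ℝ) (εw : ℝ) (x y : ℝ × ℝ) : Set ((ℝ × ℝ) × (ℝ × ℝ)) :=
  {z | ∃ (T : ℝ) (q p : ℝ → ℝ × ℝ),
    IsFirstReturn U (wallNormal εw)
      (fun a b => turningSection (rotatedPotential εw U) (straighten εw a) (straighten εw b)) T q p ∧
    straighten εw (q 0) = x ∧ straighten εw (p 0) = y ∧
    z = (straighten εw (q T), straighten εw (p T))}

/-- The first-order formula for the change of the second action under the return map (in rotated
coordinates, on the energy surface `H`) of the family of systems with walls `q₁ = εw(ε) q₂` and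
potentials `U ε`, which at `ε = 0` is the system with potential `V₁ + V₂` and a perpendicular wall:
the action changes from `I` to `I + ε f` with
`f = (1 / ω₂) ∫ g p₂ dt + O(ε)`,
the integral being taken along the unperturbed impact motion over its return time.

The formula is uniform over all initial conditions on the cross-section whose second energy is
`δ`-regular and whose second action is `ρ`-away from tangency. On leaves that do not reach the wall
the first action is moreover required to be at least `κ`, for an arbitrary `κ > 0`, as the
cross-section degenerates at the centers of the first degree of freedom. -/
def ActionChangeFormula (V₁ V₂ : ℝ → ℝ) (H δ ρ : ℝ) (εw : ℝ → ℝ) (U : ℝ → ℝ × ℝ → ℝ)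
    (g : ℝ × ℝ → ℝ) : Prop :=
  ∀ κ > 0, ∃ ε₀ > 0, ∃ η > 0, ∃ C : ℝ, ∀ a x y h : ℝ,
    -- the unperturbed initial state `q = (a, x)`, `p = (0, y)`, with `h` its second energy
    h = y ^ 2 / 2 + V₂ x → V₁ a + h = H → 0 < a → 0 < deriv V₁ a →
    h ∈ regularEnergies V₂ V₁ H δ →
    (∀ I ∈ tangentActions V₁ V₂ H x h, ρ ≤ |action V₂ x h - I|) →
    (0 ∈ well V₁ a (V₁ a) ∨ κ ≤ action V₁ a (V₁ a)) →
    ∃ q p : ℝ → ℝ × ℝ,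
      -- the unperturbed impact motion
      IsFirstReturn (U 0) (1, 0) (turningSection (U 0)) (impactPeriod V₁ a (V₁ a)) q p ∧
      q 0 = (a, x) ∧ p 0 = (0, y) ∧
      ∀ ε : ℝ, |ε| < ε₀ →
        -- the state on the perturbed energy surface with the same second coordinates
        ∃ a' : ℝ, (|a' - a| < η ∧ energy (rotatedPotential (εw ε) (U ε)) (a', x) (0, y) = H) ∧
          (∀ b : ℝ, |b - a| < η →
            energy (rotatedPotential (εw ε) (U ε)) (b, x) (0, y) = H → b = a') ∧
          ∃ z : (ℝ × ℝ) × (ℝ × ℝ), returnStates (U ε) (εw ε) (a', x) (0, y) = {z} ∧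
            ∃ f : ℝ,
              action V₂ z.1.2 (z.2.2 ^ 2 / 2 + V₂ z.1.2) = action V₂ x h + ε * f ∧
              |f - 1 / freq V₂ x h *
                ∫ t in (0 : ℝ)..impactPeriod V₁ a (V₁ a), g (q t) * (p t).2| ≤ C * |ε|

end ImpactSystem

end

/-! ### Straightening the wall by an orthogonal conjugacy -/

noncomputable section

namespace ImpactSystem

open Set Filter Topology MeasureTheory

/-! ### Rotations -/

/-! The rotation by `arctan εw` is orthogonal, turns the wall into the vertical axis and commutes
with elastic reflection. What remains is a perpendicular wall and a smooth family of potentials W(ε,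
q) with W(0, q) = V₁(q₁) + V₂(q₂). Hadamard's lemma (`divided`) gives W = V₁ + V₂ + ε D, where D is
smooth and D(0, ·) is the ε-derivative of W at 0; for the rotated separable potential this is
`exists_remainder`.

A reflection at a perpendicular wall changes only p₁. Hence the second energy h = p₂²/2 + V₂(q₂)
does not jump at impacts, and dh/dt = ε K(ε, q) p₂ with K = -∂D/∂q₂. Over one return h changes by
exactly ε S, where S is the integral of K p₂. Two facts turn this identity into the formula for the
action.

S differs from its unperturbed value by O(ε). The parameter ε and the running integral are adjoined
to the state, which gives a C¹ field `extField`. A return consists of two legs: from the outer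
turning point to the wall or to the inner turning point, then, after p₁ is reversed (trivially so at
a turning point), back to an outer turning point. Each leg ends at a transversal first zero of a
linear functional, so its end state is Lipschitz in the starting state
(`IsReferenceLeg.exists_legs`, `IsRegularStart.exists_returnMap`). Transversality holds because the
motion is not tangent to the wall and its first leaf is neither singular nor a center.

The action is a function of h with derivative 1/ω₂ = period/2π and an error quadratic in the phase
space distance (`IsLeaf.exists_action_expansion`). On a leaf over [a, b] one has V - e = (x - a)(x -
b) Q with Q > 0, and an angle θ with dθ/dt = √(2Q) makes the period locally Lipschitz in (a, b),
even at a = b. Near a center of V₂ of energy h₀ the end points are Lipschitz only in √(h - h₀), but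
this square root is a Lipschitz function on the phase plane, and the end state moves by O(ε) there.

Uniformity is compactness: the estimates are local in the initial condition, the closure of the set
of admissible initial conditions is compact, and each of its points is still a regular start
(`isRegularStart_of_mem_closure_admissible`). -/

lemma dot_smul_left (c : ℝ) (v w : ℝ × ℝ) : dot (c • v) w = c * dot v w := by
  simp only [dot, Prod.smul_fst, Prod.smul_snd, smul_eq_mul]; ring

lemma dot_smul_right (c : ℝ) (v w : ℝ × ℝ) : dot v (c • w) = c * dot v w := by
  simp only [dot, Prod.smul_fst, Prod.smul_snd, smul_eq_mul]; ring

lemma dot_grad (U : ℝ × ℝ → ℝ) (x w : ℝ × ℝ) : dot (grad U x) w = fderiv ℝ U x w := by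
  have : w = w.1 • ((1, 0) : ℝ × ℝ) + w.2 • ((0, 1) : ℝ × ℝ) := by ext <;> simp
  conv_rhs => rw [this, map_add, map_smul, map_smul]
  simp only [dot, grad, smul_eq_mul]; ring

lemma rot_dot (α : ℝ) (v w : ℝ × ℝ) : dot (rot α v) (rot α w) = dot v w := by
  simp only [dot, rot]
  linear_combination (v.1 * w.1 + v.2 * w.2) * Real.sin_sq_add_cos_sq α

lemma rot_neg_rot (α : ℝ) (v : ℝ × ℝ) : rot (-α) (rot α v) = v := by
  have h := Real.sin_sq_add_cos_sq α
  ext <;> simp only [rot, Real.cos_neg, Real.sin_neg]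
  · linear_combination v.1 * h
  · linear_combination v.2 * h

lemma rot_rot_neg (α : ℝ) (v : ℝ × ℝ) : rot α (rot (-α) v) = v := by
  simpa using rot_neg_rot (-α) v

/-- The rotation by `α` as a linear map. -/
def rotLin (α : ℝ) : (ℝ × ℝ) →L[ℝ] (ℝ × ℝ) :=
  (Real.cos α • ContinuousLinearMap.fst ℝ ℝ ℝ - Real.sin α • ContinuousLinearMap.snd ℝ ℝ ℝ).prod
    (Real.sin α • ContinuousLinearMap.fst ℝ ℝ ℝ + Real.cos α • ContinuousLinearMap.snd ℝ ℝ ℝ)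

lemma rotLin_apply (α : ℝ) (v : ℝ × ℝ) : rotLin α v = rot α v := by
  simp [rotLin, rot]

/-- The rotation by `α` as a linear isomorphism. -/
def rotEquiv (α : ℝ) : (ℝ × ℝ) ≃L[ℝ] (ℝ × ℝ) :=
  ContinuousLinearEquiv.equivOfInverse (rotLin α) (rotLin (-α))
    (fun v => by simp only [rotLin_apply, rot_neg_rot])
    (fun v => by simp only [rotLin_apply, rot_rot_neg])

lemma rotEquiv_apply (α : ℝ) (v : ℝ × ℝ) : rotEquiv α v = rot α v := rotLin_apply α v

lemma rotEquiv_symm_apply (α : ℝ) (v : ℝ × ℝ) : (rotEquiv α).symm v = rot (-α) v :=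
  rotLin_apply (-α) v

/-- An orthogonal map is its own inverse transpose, so gradients are transported like vectors. -/
lemma grad_comp_symm {L : (ℝ × ℝ) ≃L[ℝ] (ℝ × ℝ)} (hL : ∀ v w, dot (L v) (L w) = dot v w)
    (U : ℝ × ℝ → ℝ) (x : ℝ × ℝ) : grad (fun v => U (L.symm v)) (L x) = L (grad U x) := by
  have h1 : fderiv ℝ (fun v => U (L.symm v)) (L x) =
      (fderiv ℝ U x).comp (L.symm : (ℝ × ℝ) →L[ℝ] (ℝ × ℝ)) := by
    have := L.symm.comp_right_fderiv (f := U) (x := L x)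
    rw [L.symm_apply_apply] at this
    exact this
  have h2 (w : ℝ × ℝ) : dot (L (grad U x)) w = fderiv ℝ (fun v => U (L.symm v)) (L x) w := by
    rw [h1]
    conv_lhs => rw [← L.apply_symm_apply w]
    rw [hL, dot_grad]; rfl
  ext
  · rw [show (grad (fun v => U (L.symm v)) (L x)).1 =
      fderiv ℝ (fun v => U (L.symm v)) (L x) (1, 0) from rfl, ← h2]; simp [dot]
  · rw [show (grad (fun v => U (L.symm v)) (L x)).2 =
      fderiv ℝ (fun v => U (L.symm v)) (L x) (0, 1) from rfl, ← h2]; simp [dot]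

/-- Only the direction of the normal matters: `reflect` is invariant under rescaling it, and a
positive factor keeps the half plane. The factor `c` is needed because the tilted wall has a normal
that is not a unit vector. -/
lemma IsImpactMotion.map {L : (ℝ × ℝ) ≃L[ℝ] (ℝ × ℝ)} (hL : ∀ v w, dot (L v) (L w) = dot v w)
    {c : ℝ} (hc : 0 < c) {n m : ℝ × ℝ} (hn : L n = c • m) {U : ℝ × ℝ → ℝ} {T : ℝ}
    {q p : ℝ → ℝ × ℝ} (h : IsImpactMotion U n T q p) :
    IsImpactMotion (fun v => U (L.symm v)) m T (fun t => L (q t)) (fun t => L (p t)) := by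
  have hd (v : ℝ × ℝ) : dot n v = c * dot m (L v) := by rw [← hL, hn, dot_smul_left]
  have hm : dot n n = c * c * dot m m := by rw [hd, hn, dot_smul_right]; ring
  have hr (v : ℝ × ℝ) : L (reflect n v) = reflect m (L v) := by
    simp only [reflect, map_sub, map_smul, hn, smul_smul]
    rw [hd, hm]
    congr 2
    -- The normal may be zero, in which case both quotients are `x / 0 = 0`.
    rcases eq_or_ne (dot m m) 0 with h0 | h0
    · simp [h0]
    · field_simp
  have hL' (v : ℝ × ℝ) : HasFDerivAt (fun v => L v) (L : (ℝ × ℝ) →L[ℝ] (ℝ × ℝ)) v :=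
    L.hasFDerivAt
  refine ⟨L.continuous.comp_continuousOn h.continuousOn, fun t ht => ?_, fun t ht => ?_,
    fun t ht => ?_, fun t ht h0 => ?_, fun t ht h0 => ?_⟩
  · have := h.inside t ht
    rw [hd] at this
    exact nonneg_of_mul_nonneg_right this hc
  · exact (hL' _).comp_hasDerivWithinAt t (h.velocity t ht)
  · have := (hL' _).comp_hasDerivWithinAt t (h.force t ht)
    rw [grad_comp_symm hL, ← map_neg]
    exact this
  · exact (L.continuous.tendsto _).comp (h.free t ht (by rw [hd]; positivity))
  · obtain ⟨p', h1, h2⟩ := h.impact t ht (by rw [hd, h0, mul_zero])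
    exact ⟨L p', (L.continuous.tendsto _).comp h1, by rw [h2, hr]⟩

lemma straighten_wallNormal (εw : ℝ) :
    straighten εw (wallNormal εw) = Real.sqrt (1 + εw ^ 2) • ((1, 0) : ℝ × ℝ) := by
  have h : 0 < Real.sqrt (1 + εw ^ 2) := by positivity
  have h2 : Real.sqrt (1 + εw ^ 2) ^ 2 = 1 + εw ^ 2 := Real.sq_sqrt (by positivity)
  ext
  · simp only [straighten, rot, wallNormal, Real.cos_arctan, Real.sin_arctan, Prod.smul_mk,
      smul_eq_mul]
    field_simp
    linarith
  · simp only [straighten, rot, wallNormal, Real.cos_arctan, Real.sin_arctan, Prod.smul_mk,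
      smul_eq_mul]
    field_simp
    ring

lemma straighten_dot (εw : ℝ) (v w : ℝ × ℝ) :
    dot (straighten εw v) (straighten εw w) = dot v w := rot_dot _ v w

theorem isImpactMotion_straighten (U : ℝ × ℝ → ℝ) (εw T : ℝ) (q p : ℝ → ℝ × ℝ) :
    IsImpactMotion U (wallNormal εw) T q p ↔
      IsImpactMotion (rotatedPotential εw U) (1, 0) T (fun t => straighten εw (q t))
        (fun t => straighten εw (p t)) := by
  set L := rotEquiv (Real.arctan εw) with hLdef
  have hL : ∀ v w, dot (L v) (L w) = dot v w := fun v w => by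
    simp only [hLdef, rotEquiv_apply, rot_dot]
  have hL' : ∀ v w, dot (L.symm v) (L.symm w) = dot v w := fun v w => by
    simp only [hLdef, rotEquiv_symm_apply, rot_dot]
  have hs (v : ℝ × ℝ) : straighten εw v = L v := by rw [hLdef, rotEquiv_apply]; rfl
  have hU : rotatedPotential εw U = fun v => U (L.symm v) := by
    ext v; rw [hLdef, rotEquiv_symm_apply]; rfl
  have hc : 0 < Real.sqrt (1 + εw ^ 2) := by positivity
  have hn : L (wallNormal εw) = Real.sqrt (1 + εw ^ 2) • ((1, 0) : ℝ × ℝ) := by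
    rw [← hs, straighten_wallNormal]
  simp only [hs, hU]
  refine ⟨IsImpactMotion.map hL hc hn, fun h => ?_⟩
  -- The converse is the same transport along the inverse rotation, with the reciprocal factor.
  have hn' : L.symm (1, 0) = (Real.sqrt (1 + εw ^ 2))⁻¹ • wallNormal εw := by
    rw [L.symm_apply_eq, map_smul, hn, smul_smul, inv_mul_cancel₀ hc.ne', one_smul]
  simpa using IsImpactMotion.map hL' (inv_pos.2 hc) hn' h

/-- Removes the tilted wall from the problem: return states can be computed entirely in rotated
coordinates. -/
theorem returnStates_eq (U : ℝ × ℝ → ℝ) (εw : ℝ) (x y : ℝ × ℝ) :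
    returnStates U εw x y = {z | ∃ (T : ℝ) (q p : ℝ → ℝ × ℝ),
      IsFirstReturn (rotatedPotential εw U) (1, 0) (turningSection (rotatedPotential εw U)) T q p ∧
      q 0 = x ∧ p 0 = y ∧ z = (q T, p T)} := by
  have hs (v : ℝ × ℝ) : straighten εw (rot (-Real.arctan εw) v) = v := rot_rot_neg _ v
  ext z
  constructor
  · rintro ⟨T, q, p, ⟨h1, h2, h3⟩, hx, hy, hz⟩
    exact ⟨T, fun t => straighten εw (q t), fun t => straighten εw (p t),
      ⟨h1, (isImpactMotion_straighten U εw T q p).1 h2, h3⟩, hx, hy, hz⟩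
  · rintro ⟨T, q, p, ⟨h1, h2, h3⟩, hx, hy, hz⟩
    refine ⟨T, fun t => rot (-Real.arctan εw) (q t), fun t => rot (-Real.arctan εw) (p t),
      ⟨h1, (isImpactMotion_straighten U εw T _ _).2 ?_, ?_⟩, ?_⟩
    · simpa only [hs] using h2
    · simpa only [hs] using h3
    · simpa only [hs] using ⟨hx, hy, hz⟩

end ImpactSystem

end

/-! ### Smooth division by the perturbation parameter -/

noncomputable section

namespace ImpactSystem

open Set Filter Topology MeasureTheory

/-! ### Hadamard's lemma -/

open scoped Convolution in
-- The integral is a convolution evaluated at 0: the indicator of (0, 1] against the kernel s ↦ χ(s)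
-- F(x, -s). The bump χ equals 1 where the indicator lives and gives the kernel a compact support
-- independent of x, so differentiability of convolutions with parameters applies.
lemma contDiff_integral_param {P : Type*} [NormedAddCommGroup P] [NormedSpace ℝ P] {n : ℕ}
    {F : P × ℝ → ℝ} (hF : ContDiff ℝ n F) :
    ContDiff ℝ n (fun x => ∫ s in (0 : ℝ)..1, F (x, s)) := by
  let χ : ContDiffBump (0 : ℝ) := ⟨1, 2, by norm_num, by norm_num⟩
  let g : P → ℝ → ℝ := fun x s => χ s * F (x, -s)
  let f : ℝ → ℝ := indicator (Ioc 0 1) 1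
  have hg : ContDiff ℝ n (Function.uncurry g) := by
    have h1 : ContDiff ℝ n (fun x : P × ℝ => χ x.2) := χ.contDiff.comp contDiff_snd
    have h2 : ContDiff ℝ n (fun x : P × ℝ => F (x.1, -x.2)) := by fun_prop
    exact h1.mul h2
  have hf : LocallyIntegrable f volume := by
    have h0 : IntegrableOn (1 : ℝ → ℝ) (Ioc 0 1) volume := by
      have : IntegrableOn (fun _ : ℝ => (1 : ℝ)) (Ioc 0 1) volume := by simp
      exact this
    exact ((integrable_indicator_iff measurableSet_Ioc).2 h0).locallyIntegrable
  have hk : IsCompact (Metric.closedBall (0 : ℝ) 2) := isCompact_closedBall 0 2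
  have hgs : ∀ x : P, ∀ s : ℝ, x ∈ (univ : Set P) → s ∉ Metric.closedBall (0 : ℝ) 2 → g x s = 0 := by
    intro x s _ hs
    have : χ s = 0 := by
      refine χ.zero_of_le_dist ?_
      rw [Metric.mem_closedBall, not_le] at hs
      exact hs.le
    simp [g, this]
  have key := contDiffOn_convolution_right_with_param_comp (n := n) (ContinuousLinearMap.mul ℝ ℝ)
    (v := fun _ : P => (0 : ℝ)) (μ := volume) (f := f) (g := g)
    contDiffOn_const isOpen_univ hk hgs hf (hg.contDiffOn)
  rw [contDiffOn_univ] at key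
  have key' : ContDiff ℝ n (fun x => convolution f (g x) (ContinuousLinearMap.mul ℝ ℝ) volume 0) := key
  suffices h : (fun x => ∫ s in (0 : ℝ)..1, F (x, s)) =
      fun x => convolution f (g x) (ContinuousLinearMap.mul ℝ ℝ) volume 0 by rw [h]; exact key'
  funext x
  rw [convolution_def, intervalIntegral.integral_of_le zero_le_one, ← integral_indicator
    measurableSet_Ioc]
  congr 1
  ext s
  by_cases hs : s ∈ Ioc (0 : ℝ) 1
  · have : χ (-s) = 1 := by
      refine χ.one_of_mem_closedBall ?_
      simp only [Metric.mem_closedBall, dist_zero_right, norm_neg, Real.norm_eq_abs]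
      exact abs_le.2 ⟨by linarith [hs.1], hs.2⟩
    simp [f, g, hs, this]
  · simp [f, hs]

/-- The quotient `(F (t, y) - F (0, y)) / t`, extended to `t = 0`. -/
def divided {E : Type*} [NormedAddCommGroup E] [NormedSpace ℝ E] (F : ℝ × E → ℝ) (x : ℝ × E) : ℝ :=
  ∫ s in (0 : ℝ)..1, fderiv ℝ F (s * x.1, x.2) (1, 0)

section

variable {E : Type*} [NormedAddCommGroup E] [NormedSpace ℝ E] {F : ℝ × E → ℝ} {n : ℕ}

lemma contDiff_divided (hF : ContDiff ℝ (n + 1) F) : ContDiff ℝ n (divided F) := by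
  refine contDiff_integral_param (F := fun x : (ℝ × E) × ℝ =>
    fderiv ℝ F (x.2 * x.1.1, x.1.2) (1, 0)) ?_
  have h1 : ContDiff ℝ n (fderiv ℝ F) := hF.fderiv_right le_rfl
  have h2 : ContDiff ℝ n (fun x : (ℝ × E) × ℝ => fderiv ℝ F (x.2 * x.1.1, x.1.2)) :=
    h1.comp (by fun_prop)
  exact h2.clm_apply contDiff_const

lemma divided_zero (y : E) : divided F (0, y) = fderiv ℝ F (0, y) (1, 0) := by
  simp [divided]

lemma eq_add_mul_divided (hF : ContDiff ℝ 1 F) (t : ℝ) (y : E) :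
    F (t, y) = F (0, y) + t * divided F (t, y) := by
  have h1 : ∀ s : ℝ, HasDerivAt (fun s : ℝ => F (s * t, y)) (t * fderiv ℝ F (s * t, y) (1, 0)) s := by
    intro s
    have ha : HasFDerivAt F (fderiv ℝ F (s * t, y)) (s * t, y) :=
      (hF.differentiable one_ne_zero _).hasFDerivAt
    have hb : HasDerivAt (fun s : ℝ => ((s * t, y) : ℝ × E)) (t, 0) s := by
      have : HasDerivAt (fun s : ℝ => s * t) t s := by simpa using (hasDerivAt_id s).mul_const t
      exact this.prodMk (hasDerivAt_const s y)
    have hc := ha.comp_hasDerivAt s hb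
    have hd : ((t, 0) : ℝ × E) = t • ((1, 0) : ℝ × E) := by simp
    rw [hd, map_smul, smul_eq_mul] at hc
    exact hc
  have hcont : Continuous (fun s : ℝ => t * fderiv ℝ F (s * t, y) (1, 0)) := by
    have := hF.continuous_fderiv one_ne_zero
    have h2 : Continuous (fun s : ℝ => fderiv ℝ F (s * t, y)) := this.comp (by fun_prop)
    exact continuous_const.mul (h2.clm_apply continuous_const)
  have h2 := intervalIntegral.integral_eq_sub_of_hasDerivAt (a := 0) (b := 1) (fun s _ => h1 s)
    (hcont.intervalIntegrable 0 1)
  rw [intervalIntegral.integral_const_mul] at h2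
  simp only [one_mul, zero_mul] at h2
  simp only [divided]
  linarith

end

/-! ### The potential in rotated coordinates -/

lemma contDiff_rotatedPotential {U : ℝ × (ℝ × ℝ) → ℝ} {n : WithTop ℕ∞} (hU : ContDiff ℝ n U) {c : ℝ} :
    ContDiff ℝ n (fun x : ℝ × (ℝ × ℝ) => rotatedPotential (c * x.1) (fun v => U (x.1, v)) x.2) := by
  have h1 : ContDiff ℝ n (fun x : ℝ × (ℝ × ℝ) => Real.arctan (c * x.1)) :=
    Real.contDiff_arctan.comp (by fun_prop)
  simp only [rotatedPotential, rot, Real.cos_neg, Real.sin_neg]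
  refine hU.comp (contDiff_fst.prodMk (ContDiff.prodMk ?_ ?_))
  · exact ((Real.contDiff_cos.comp h1).mul (by fun_prop)).sub
      ((Real.contDiff_sin.comp h1).neg.mul (by fun_prop))
  · exact ((Real.contDiff_sin.comp h1).neg.mul (by fun_prop)).add
      ((Real.contDiff_cos.comp h1).mul (by fun_prop))

lemma contDiff_separable {V₁ V₂ : ℝ → ℝ} {n : WithTop ℕ∞} (h₁ : ContDiff ℝ n V₁)
    (h₂ : ContDiff ℝ n V₂) : ContDiff ℝ n (fun q : ℝ × ℝ => V₁ q.1 + V₂ q.2) :=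
  (h₁.comp contDiff_fst).add (h₂.comp contDiff_snd)

lemma rotatedPotential_zero (U : ℝ × ℝ → ℝ) : rotatedPotential 0 U = U := by
  ext q; simp [rotatedPotential, rot]

lemma hasDerivAt_rotated_separable {V₁ V₂ : ℝ → ℝ} (h₁ : Differentiable ℝ V₁)
    (h₂ : Differentiable ℝ V₂) (q : ℝ × ℝ) :
    HasDerivAt (fun ε => rotatedPotential ε (fun v => V₁ v.1 + V₂ v.2) q)
      (q.2 * deriv V₁ q.1 - q.1 * deriv V₂ q.2) 0 := by
  have ha : HasDerivAt Real.arctan 1 0 := by simpa using Real.hasDerivAt_arctan 0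
  have hc : HasDerivAt (fun ε => Real.cos (Real.arctan ε)) 0 0 := by simpa using ha.cos
  have hs : HasDerivAt (fun ε => Real.sin (Real.arctan ε)) 1 0 := by simpa using ha.sin
  simp only [rotatedPotential, rot, Real.cos_neg, Real.sin_neg]
  have e1 : HasDerivAt (fun ε => Real.cos (Real.arctan ε) * q.1 - -Real.sin (Real.arctan ε) * q.2)
      q.2 0 := by
    simpa using (hc.mul_const q.1).fun_sub (hs.fun_neg.mul_const q.2)
  have e2 : HasDerivAt (fun ε => -Real.sin (Real.arctan ε) * q.1 + Real.cos (Real.arctan ε) * q.2)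
      (-q.1) 0 := by
    simpa using (hs.fun_neg.mul_const q.1).fun_add (hc.mul_const q.2)
  have d1 : HasDerivAt V₁ (deriv V₁ q.1)
      (Real.cos (Real.arctan 0) * q.1 - -Real.sin (Real.arctan 0) * q.2) := by
    simpa using (h₁ q.1).hasDerivAt
  have d2 : HasDerivAt V₂ (deriv V₂ q.2)
      (-Real.sin (Real.arctan 0) * q.1 + Real.cos (Real.arctan 0) * q.2) := by
    simpa using (h₂ q.2).hasDerivAt
  have h := (d1.comp 0 e1).fun_add (d2.comp 0 e2)
  rw [show q.2 * deriv V₁ q.1 - q.1 * deriv V₂ q.2 =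
    deriv V₁ q.1 * q.2 + deriv V₂ q.2 * -q.1 by ring]
  exact h

/-- The remainder is the Hadamard quotient in `εw` of the rotated separable potential, at the cost
of one derivative. Its value at `εw = 0` is the derivative along the rotation. A second Hadamard
quotient, bounded on [-1, 1] × K, controls the deviation from that value. -/
theorem exists_remainder {r : ℕ} (hr : 4 < r) {V₁ V₂ : ℝ → ℝ} (Vr : ℝ × ℝ → ℝ)
    (h₁ : ContDiff ℝ (r + 1) V₁) (h₂ : ContDiff ℝ (r + 1) V₂) :
    ∃ Vrem : ℝ × (ℝ × ℝ) → ℝ, ContDiff ℝ r Vrem ∧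
      (∀ (εw εr : ℝ) (q : ℝ × ℝ), rotatedPotential εw (potential V₁ V₂ Vr εr) q =
          V₁ q.1 + V₂ q.2 + εw * Vrem (εw, q) + εr * rotatedPotential εw Vr q) ∧
      ∀ K : Set (ℝ × ℝ), IsCompact K → ∃ C : ℝ, ∀ q ∈ K, ∀ εw : ℝ, |εw| ≤ 1 →
        |Vrem (εw, q) - (q.2 * deriv V₁ q.1 - q.1 * deriv V₂ q.2)| ≤ C * |εw| := by
  set F : ℝ × (ℝ × ℝ) → ℝ := fun x => rotatedPotential x.1 (fun v => V₁ v.1 + V₂ v.2) x.2 with hFd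
  have hF : ContDiff ℝ (r + 1) F := by
    have := contDiff_rotatedPotential (U := fun x : ℝ × (ℝ × ℝ) => V₁ x.2.1 + V₂ x.2.2)
      ((contDiff_separable h₁ h₂).comp contDiff_snd) (c := 1)
    simpa only [one_mul] using this
  have hD : ContDiff ℝ r (divided F) := contDiff_divided hF
  have h1r : (1 : WithTop ℕ∞) ≤ r := by exact_mod_cast (by omega : 1 ≤ r)
  have hF1 : ContDiff ℝ 1 F := hF.of_le (h1r.trans le_self_add)
  have hV1 : Differentiable ℝ V₁ := (h₁.of_le (h1r.trans le_self_add)).differentiable one_ne_zero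
  have hV2 : Differentiable ℝ V₂ := (h₂.of_le (h1r.trans le_self_add)).differentiable one_ne_zero
  have h0 (q : ℝ × ℝ) : divided F (0, q) = q.2 * deriv V₁ q.1 - q.1 * deriv V₂ q.2 := by
    rw [divided_zero]
    have ha : HasFDerivAt F (fderiv ℝ F (0, q)) (0, q) :=
      (hF1.differentiable one_ne_zero _).hasFDerivAt
    have hb : HasDerivAt (fun s : ℝ => ((s, q) : ℝ × (ℝ × ℝ))) (1, 0) 0 :=
      (hasDerivAt_id (0 : ℝ)).prodMk (hasDerivAt_const 0 q)
    have hc := ha.comp_hasDerivAt 0 hb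
    exact hc.unique (hasDerivAt_rotated_separable hV1 hV2 q)
  refine ⟨divided F, hD, fun εw εr q => ?_, fun K hK => ?_⟩
  · have := eq_add_mul_divided hF1 εw q
    have e1 : F (0, q) = V₁ q.1 + V₂ q.2 := by simp only [hFd, rotatedPotential_zero]
    rw [← e1, ← this]
    simp only [hFd, rotatedPotential, potential]
  · set D2 := divided (divided F)
    have hD2 : Continuous D2 :=
      (contDiff_divided (n := 0) (by simpa using hD.of_le h1r)).continuous
    obtain ⟨C, hC⟩ := ((isCompact_Icc (a := (-1 : ℝ)) (b := 1)).prod hK).exists_bound_of_continuousOn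
      hD2.continuousOn
    refine ⟨C, fun q hq ε hε => ?_⟩
    rw [← h0, eq_add_mul_divided (hD.of_le h1r) ε q, add_sub_cancel_left, abs_mul, mul_comm]
    gcongr
    exact hC (ε, q) ⟨abs_le.1 hε, hq⟩

end ImpactSystem

end

/-! ### Factorization of the potential at a leaf and the angle coordinate -/

noncomputable section

namespace ImpactSystem

open Set Filter Topology MeasureTheory

/-! ### Divided differences -/

/-- The first divided difference of `V`, as a function of `(x - a, a)`. -/
def firstDiff (V : ℝ → ℝ) : ℝ × ℝ → ℝ := divided fun y : ℝ × ℝ => V (y.2 + y.1)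

/-- The second divided difference `V[a, b, x]`. -/
def secondDiff (V : ℝ → ℝ) (a b x : ℝ) : ℝ :=
  divided (fun y : ℝ × (ℝ × ℝ) => firstDiff V (y.2.2 - y.2.1 + y.1, y.2.1)) (x - b, (a, b))

section

variable {V : ℝ → ℝ} {a b e x : ℝ} {n : ℕ}

lemma contDiff_firstDiff (hV : ContDiff ℝ (n + 1) V) : ContDiff ℝ n (firstDiff V) :=
  contDiff_divided (hV.comp (by fun_prop))

/-- Smoothness holds jointly in the nodes and at coinciding nodes. This lets the period be compared
between neighbouring leaves, including those shrinking to a center. -/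
lemma contDiff_secondDiff (hV : ContDiff ℝ (n + 2 : ℕ) V) :
    ContDiff ℝ n (fun y : ℝ × ℝ × ℝ => secondDiff V y.1 y.2.1 y.2.2) := by
  have h1 : ContDiff ℝ (n + 1) (firstDiff V) :=
    contDiff_firstDiff (n := n + 1) (by exact_mod_cast hV)
  have h2 := contDiff_divided (F := fun y : ℝ × (ℝ × ℝ) =>
    firstDiff V (y.2.2 - y.2.1 + y.1, y.2.1)) (n := n) (h1.comp (by fun_prop))
  exact h2.comp (f := fun y : ℝ × ℝ × ℝ => (y.2.2 - y.2.1, (y.1, y.2.1))) (by fun_prop)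

lemma eq_add_mul_firstDiff (hV : ContDiff ℝ 1 V) (a t : ℝ) :
    V (a + t) = V a + t * firstDiff V (t, a) := by
  have := eq_add_mul_divided (F := fun y : ℝ × ℝ => V (y.2 + y.1)) (hV.comp (by fun_prop)) t a
  simp only [add_zero] at this
  exact this

lemma firstDiff_zero (hV : ContDiff ℝ 1 V) (a : ℝ) : firstDiff V (0, a) = deriv V a := by
  have hc : Continuous fun t => firstDiff V (t, a) :=
    (contDiff_firstDiff (n := 0) (by simpa using hV)).continuous.comp (by fun_prop)
  have h1 : HasDerivAt V (firstDiff V (0, a)) a := by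
    rw [hasDerivAt_iff_tendsto_slope_zero]
    refine ((hc.tendsto 0).mono_left nhdsWithin_le_nhds).congr' ?_
    filter_upwards [self_mem_nhdsWithin] with t ht
    rw [eq_add_mul_firstDiff hV a t, add_sub_cancel_left, smul_eq_mul, inv_mul_cancel_left₀ ht]
  exact h1.deriv.symm

lemma eq_add_mul_secondDiff (hV : ContDiff ℝ 2 V) (a b x : ℝ) :
    V x = V a + (x - a) * (firstDiff V (b - a, a) + (x - b) * secondDiff V a b x) := by
  have h1 : ContDiff ℝ 1 (firstDiff V) := contDiff_firstDiff (n := 1) hV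
  have h2 := eq_add_mul_divided (F := fun y : ℝ × (ℝ × ℝ) =>
    firstDiff V (y.2.2 - y.2.1 + y.1, y.2.1)) (h1.comp (by fun_prop)) (x - b) (a, b)
  have h3 := eq_add_mul_firstDiff (hV.of_le (by norm_num)) a (x - a)
  simp only [add_sub_cancel, add_zero] at h2 h3
  rw [h3, secondDiff, ← h2]
  congr 3
  ring_nf

/-! ### Leaves -/

/-- The level set component of energy `e` over the interval `[a, b]` is a regular leaf or a
center. -/
structure IsLeaf (V : ℝ → ℝ) (a b e : ℝ) : Prop where
  le : a ≤ b
  left : V a = e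
  right : V b = e
  lt : ∀ x ∈ Ioo a b, V x < e
  nondegenerate : (a < b ∧ deriv V a < 0 ∧ 0 < deriv V b) ∨
    (a = b ∧ deriv V a = 0 ∧ 0 < deriv (deriv V) a)

/-- In Newton's interpolation formula the linear coefficient is the chord slope between two equal
values, or `deriv V a = 0` when `a = b`; it vanishes in both cases. -/
lemma IsLeaf.sub_eq (h : IsLeaf V a b e) (hV : ContDiff ℝ 2 V) (x : ℝ) :
    V x - e = (x - a) * (x - b) * secondDiff V a b x := by
  have h0 : firstDiff V (b - a, a) = 0 := by
    rcases h.nondegenerate with h1 | h1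
    · have := eq_add_mul_firstDiff (hV.of_le (by norm_num)) a (b - a)
      rw [add_sub_cancel, h.left, h.right] at this
      have h2 : (b - a) * firstDiff V (b - a, a) = 0 := by linarith
      exact (mul_eq_zero.1 h2).resolve_left (by linarith [h1.1])
    · rw [← h1.1, sub_self, firstDiff_zero (hV.of_le (by norm_num)), h1.2.1]
  have := eq_add_mul_secondDiff hV a b x
  rw [h0, h.left] at this
  rw [this]; ring

lemma contDiff_secondDiff_right (hV : ContDiff ℝ (n + 2 : ℕ) V) (a b : ℝ) :
    ContDiff ℝ n (secondDiff V a b) :=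
  (contDiff_secondDiff hV).comp (f := fun x : ℝ => (a, b, x)) (by fun_prop)

lemma IsLeaf.deriv_eq (h : IsLeaf V a b e) (hV : ContDiff ℝ 3 V) (x : ℝ) :
    HasDerivAt V ((x - a + (x - b)) * secondDiff V a b x +
      (x - a) * (x - b) * deriv (secondDiff V a b) x) x := by
  have hQ : ContDiff ℝ 1 (secondDiff V a b) := contDiff_secondDiff_right (n := 1) hV a b
  have h1 : HasDerivAt (secondDiff V a b) (deriv (secondDiff V a b) x) x :=
    (hQ.differentiable one_ne_zero x).hasDerivAt
  have h2 : V = fun x => (x - a) * (x - b) * secondDiff V a b x + e := by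
    funext x
    have := h.sub_eq (hV.of_le (by norm_num)) x
    linarith
  have h3 := ((((hasDerivAt_id x).sub_const a).fun_mul ((hasDerivAt_id x).sub_const b)).fun_mul
    h1).add_const e
  have h4 := h3.congr_of_eventuallyEq (f₁ := V) (Eventually.of_forall fun y => congrFun h2 y)
  exact h4.congr_deriv (by simp only [id]; ring)

/-- Writing Q for the quotient: inside, its sign is read off from V < e; at the ends V'(a) = (a - b)
Q(a) and V'(b) = (b - a) Q(b); at a center V'' = 2Q. Nondegeneracy of the leaf is exactly positivity
of Q. -/
lemma IsLeaf.secondDiff_pos (h : IsLeaf V a b e) (hV : ContDiff ℝ 3 V) (hx : x ∈ Icc a b) :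
    0 < secondDiff V a b x := by
  have hd := fun y => (h.deriv_eq hV y).deriv
  have key := h.sub_eq (hV.of_le (by norm_num)) x
  rcases h.nondegenerate with ⟨h1, h2, h3⟩ | ⟨h1, h2, h3⟩
  · rcases eq_or_lt_of_le hx.1 with rfl | hxa
    · rw [hd] at h2
      simp only [sub_self, zero_add, zero_mul, add_zero] at h2
      nlinarith
    rcases eq_or_lt_of_le hx.2 with rfl | hxb
    · rw [hd] at h3
      simp only [sub_self, mul_zero, zero_mul, add_zero] at h3
      nlinarith
    · have := h.lt x ⟨hxa, hxb⟩
      have h4 : (x - a) * (b - x) > 0 := mul_pos (by linarith) (by linarith)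
      by_contra h5
      push Not at h5
      nlinarith [mul_nonneg h4.le (neg_nonneg.2 h5)]
  · subst h1
    have hxa : x = a := le_antisymm hx.2 hx.1
    subst hxa
    have hQ : ContDiff ℝ 1 (secondDiff V x x) := contDiff_secondDiff_right (n := 1) hV x x
    have e1 : deriv V = fun y => (y - x) * (2 * secondDiff V x x y +
        (y - x) * deriv (secondDiff V x x) y) := by
      funext y; rw [hd]; ring
    have hc : Continuous fun y => 2 * secondDiff V x x y + (y - x) * deriv (secondDiff V x x) y :=
      (continuous_const.mul hQ.continuous).add ((continuous_id.sub continuous_const).mul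
        (hQ.continuous_deriv le_rfl))
    -- The derivative of the quotient is only known to be continuous, so the product rule is
    -- unavailable; `deriv V` is `y - x` times a continuous function, and its difference quotient at
    -- `x` is that function.
    have h4 : HasDerivAt (deriv V) (2 * secondDiff V x x x) x := by
      rw [hasDerivAt_iff_tendsto_slope_zero]
      have h5 := ((hc.comp (continuous_const_add x)).tendsto 0).mono_left
        (nhdsWithin_le_nhds (s := {0}ᶜ))
      simp only [Function.comp_def, add_zero, sub_self, zero_mul] at h5
      refine h5.congr' ?_
      filter_upwards [self_mem_nhdsWithin] with t ht
      rw [e1]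
      simp only [add_sub_cancel_left, sub_self, zero_mul, sub_zero, smul_eq_mul]
      rw [inv_mul_cancel_left₀ ht]
    rw [h4.deriv] at h3
    linarith

end

/-! ### Motion on a leaf -/

section

variable (V : ℝ → ℝ) (a b : ℝ)

/-- The position on the leaf over `[a, b]` with angle `θ`. -/
def leafPos (θ : ℝ) : ℝ := (a + b) / 2 + (b - a) / 2 * Real.sin θ

/-- The angular velocity on the leaf over `[a, b]`. -/
def leafSpeed (θ : ℝ) : ℝ := Real.sqrt (2 * secondDiff V a b (leafPos a b θ))

/-- The time needed to reach the angle `θ` from the right turning point. -/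
def leafClock (θ : ℝ) : ℝ := ∫ s in (Real.pi / 2)..θ, (leafSpeed V a b s)⁻¹

/-- The angle at time `t` of the motion that starts at the right turning point. -/
def leafAngle : ℝ → ℝ := Function.invFun (leafClock V a b)

/-- The position at time `t` of the motion that starts at the right turning point. -/
def leafQ (t : ℝ) : ℝ := leafPos a b (leafAngle V a b t)

/-- The momentum at time `t` of the motion that starts at the right turning point. -/
def leafP (t : ℝ) : ℝ :=
  (b - a) / 2 * Real.cos (leafAngle V a b t) * leafSpeed V a b (leafAngle V a b t)

variable {V a b} {e : ℝ}

lemma leafPos_mem (hab : a ≤ b) (θ : ℝ) : leafPos a b θ ∈ Icc a b := by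
  have h1 := Real.neg_one_le_sin θ
  have h2 := Real.sin_le_one θ
  constructor <;> simp only [leafPos] <;> nlinarith

lemma contDiff_leafPos {n : WithTop ℕ∞} : ContDiff ℝ n (leafPos a b) := by
  unfold leafPos
  exact contDiff_const.add (contDiff_const.mul Real.contDiff_sin)

variable (h : IsLeaf V a b e) (hV : ContDiff ℝ 3 V)
include h hV

/-- Since e - V = ((b - a)/2)² cos²θ · Q, energy conservation with p = ((b - a)/2) cos θ · dθ/dt
becomes dθ/dt = √(2Q). The angle thus moves with positive speed through the turning points, and also
when `a = b`. -/
lemma IsLeaf.leafSpeed_pos (θ : ℝ) : 0 < leafSpeed V a b θ :=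
  Real.sqrt_pos.2 (mul_pos two_pos (h.secondDiff_pos hV (leafPos_mem h.le θ)))

omit h in
lemma continuous_leafSpeed : Continuous (leafSpeed V a b) := by
  have hQ : Continuous (secondDiff V a b) := (contDiff_secondDiff_right (n := 1) hV a b).continuous
  have : Continuous (leafPos a b) := (contDiff_leafPos (n := 0)).continuous
  unfold leafSpeed
  exact (continuous_const.mul (hQ.comp this)).sqrt

lemma IsLeaf.continuous_inv_leafSpeed : Continuous fun θ => (leafSpeed V a b θ)⁻¹ :=
  (continuous_leafSpeed hV).inv₀ fun θ => (h.leafSpeed_pos hV θ).ne'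

lemma IsLeaf.hasDerivAt_leafClock (θ : ℝ) :
    HasDerivAt (leafClock V a b) (leafSpeed V a b θ)⁻¹ θ :=
  ((h.continuous_inv_leafSpeed hV).integral_hasStrictDerivAt _ _).hasDerivAt

lemma IsLeaf.strictMono_leafClock : StrictMono (leafClock V a b) :=
  strictMono_of_deriv_pos fun θ => by
    rw [(h.hasDerivAt_leafClock hV θ).deriv]
    exact inv_pos.2 (h.leafSpeed_pos hV θ)

lemma IsLeaf.exists_le_deriv_leafClock : ∃ c > 0, ∀ θ, c ≤ (leafSpeed V a b θ)⁻¹ := by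
  have hQ : Continuous (secondDiff V a b) := (contDiff_secondDiff_right (n := 1) hV a b).continuous
  obtain ⟨M, hM⟩ := isCompact_Icc.exists_bound_of_continuousOn (hQ.continuousOn (s := Icc a b))
  have hM0 : 0 < M := by
    have h1 := hM a ⟨le_rfl, h.le⟩
    have h2 := h.secondDiff_pos hV (x := a) ⟨le_rfl, h.le⟩
    rw [Real.norm_eq_abs, abs_of_pos h2] at h1
    linarith
  refine ⟨(Real.sqrt (2 * M))⁻¹, by positivity, fun θ => ?_⟩
  apply inv_anti₀ (h.leafSpeed_pos hV θ)
  apply Real.sqrt_le_sqrt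
  have := (le_abs_self _).trans (hM _ (leafPos_mem h.le θ))
  linarith

/-- The clock grows at least linearly, because Q is bounded on [a, b]. Together with strict
monotonicity this makes `leafAngle`, defined by `invFun`, a true inverse. -/
lemma IsLeaf.surjective_leafClock : Function.Surjective (leafClock V a b) := by
  obtain ⟨c, hc, hc'⟩ := h.exists_le_deriv_leafClock hV
  have hmono : Monotone fun θ => leafClock V a b θ - c * θ := by
    refine monotone_of_deriv_nonneg ?_ ?_
    · exact fun θ => (((h.hasDerivAt_leafClock hV θ)).fun_sub
        ((hasDerivAt_id θ).const_mul c)).differentiableAt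
    · intro θ
      have := ((h.hasDerivAt_leafClock hV θ)).fun_sub ((hasDerivAt_id θ).const_mul c)
      simp only [id, mul_one] at this
      rw [this.deriv]
      linarith [hc' θ]
  have hcont : Continuous (leafClock V a b) :=
    continuous_iff_continuousAt.2 fun θ => (h.hasDerivAt_leafClock hV θ).continuousAt
  refine hcont.surjective ?_ ?_
  · refine tendsto_atTop_mono' atTop (f₁ := fun θ => leafClock V a b 0 + c * θ) ?_ ?_
    · filter_upwards [eventually_ge_atTop 0] with θ hθ
      have := hmono hθ
      simp only [mul_zero, sub_zero] at this
      linarith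
    · exact tendsto_atTop_add_const_left _ _ (tendsto_id.const_mul_atTop hc)
  · refine tendsto_atBot_mono' atBot (f₁ := fun θ => leafClock V a b 0 + c * θ) ?_ ?_
    · filter_upwards [eventually_le_atBot 0] with θ hθ
      have := hmono hθ
      simp only [mul_zero, sub_zero] at this
      linarith
    · exact tendsto_atBot_add_const_left _ _ (tendsto_id.const_mul_atBot hc)

lemma IsLeaf.leafClock_leafAngle (t : ℝ) : leafClock V a b (leafAngle V a b t) = t :=
  Function.rightInverse_invFun (h.surjective_leafClock hV) t

lemma IsLeaf.leafAngle_leafClock (θ : ℝ) : leafAngle V a b (leafClock V a b θ) = θ :=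
  Function.leftInverse_invFun (h.strictMono_leafClock hV).injective θ

lemma IsLeaf.strictMono_leafAngle : StrictMono (leafAngle V a b) := fun s t hst => by
  rw [← (h.strictMono_leafClock hV).lt_iff_lt, h.leafClock_leafAngle hV, h.leafClock_leafAngle hV]
  exact hst

lemma IsLeaf.hasDerivAt_leafAngle (t : ℝ) :
    HasDerivAt (leafAngle V a b) (leafSpeed V a b (leafAngle V a b t)) t := by
  have hs : Function.Surjective (leafAngle V a b) := fun θ => ⟨_, h.leafAngle_leafClock hV θ⟩
  have hc : Continuous (leafAngle V a b) := (h.strictMono_leafAngle hV).monotone.continuous_of_surjective hs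
  have := HasDerivAt.of_local_left_inverse (f := leafClock V a b) (g := leafAngle V a b) (a := t)
    hc.continuousAt (h.hasDerivAt_leafClock hV _) (inv_pos.2 (h.leafSpeed_pos hV _)).ne'
    (Eventually.of_forall (h.leafClock_leafAngle hV))
  simpa using this

omit hV h in
lemma hasDerivAt_leafPos (θ : ℝ) :
    HasDerivAt (leafPos a b) ((b - a) / 2 * Real.cos θ) θ :=
  ((Real.hasDerivAt_sin θ).const_mul ((b - a) / 2)).const_add ((a + b) / 2)

lemma IsLeaf.hasDerivAt_leafQ (t : ℝ) : HasDerivAt (leafQ V a b) (leafP V a b t) t :=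
  (hasDerivAt_leafPos _).comp t (h.hasDerivAt_leafAngle hV t)

lemma IsLeaf.hasDerivAt_leafP (t : ℝ) :
    HasDerivAt (leafP V a b) (-deriv V (leafQ V a b t)) t := by
  set θ := leafAngle V a b t with hθ
  have hQ : ContDiff ℝ 1 (secondDiff V a b) := contDiff_secondDiff_right (n := 1) hV a b
  have h1 : HasDerivAt (secondDiff V a b) (deriv (secondDiff V a b) (leafPos a b θ))
      (leafPos a b θ) := (hQ.differentiable one_ne_zero _).hasDerivAt
  have hpos := h.leafSpeed_pos hV θ
  have h2 := ((h1.comp θ (hasDerivAt_leafPos θ)).const_mul 2).sqrt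
    (mul_pos two_pos (h.secondDiff_pos hV (leafPos_mem h.le θ))).ne'
  have h3 := ((((Real.hasDerivAt_cos θ).const_mul ((b - a) / 2)).fun_mul h2).comp t
    (h.hasDerivAt_leafAngle hV t))
  have hS : leafSpeed V a b θ ^ 2 = 2 * secondDiff V a b (leafPos a b θ) :=
    Real.sq_sqrt (mul_pos two_pos (h.secondDiff_pos hV (leafPos_mem h.le θ))).le
  rw [(h.deriv_eq hV (leafQ V a b t)).deriv]
  refine h3.congr_deriv ?_
  rw [← hθ]
  symm
  change _ = ((b - a) / 2 * -Real.sin θ * leafSpeed V a b θ + (b - a) / 2 * Real.cos θ *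
    (2 * (deriv (secondDiff V a b) (leafPos a b θ) * ((b - a) / 2 * Real.cos θ)) /
      (2 * leafSpeed V a b θ))) * leafSpeed V a b θ
  have e1 : leafQ V a b t = leafPos a b θ := rfl
  rw [e1]
  set D := deriv (secondDiff V a b) (leafPos a b θ)
  set S := leafSpeed V a b θ
  set Q := secondDiff V a b (leafPos a b θ)
  have e2 : leafPos a b θ - a = (b - a) / 2 * (1 + Real.sin θ) := by simp only [leafPos]; ring
  have e3 : leafPos a b θ - b = (b - a) / 2 * (Real.sin θ - 1) := by simp only [leafPos]; ring
  rw [e2, e3]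
  field_simp
  have := Real.sin_sq_add_cos_sq θ
  linear_combination ((b - a) * Real.sin θ * 2) * hS - (b - a) ^ 2 * D * this

lemma IsLeaf.energy_eq (t : ℝ) : leafP V a b t ^ 2 / 2 + V (leafQ V a b t) = e := by
  set θ := leafAngle V a b t with hθ
  have hS : leafSpeed V a b θ ^ 2 = 2 * secondDiff V a b (leafPos a b θ) :=
    Real.sq_sqrt (mul_pos two_pos (h.secondDiff_pos hV (leafPos_mem h.le θ))).le
  have h1 := h.sub_eq (hV.of_le (by norm_num)) (leafPos a b θ)
  have e2 : leafPos a b θ - a = (b - a) / 2 * (1 + Real.sin θ) := by simp only [leafPos]; ring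
  have e3 : leafPos a b θ - b = (b - a) / 2 * (Real.sin θ - 1) := by simp only [leafPos]; ring
  rw [e2, e3] at h1
  change ((b - a) / 2 * Real.cos θ * leafSpeed V a b θ) ^ 2 / 2 + V (leafPos a b θ) = e
  have := Real.sin_sq_add_cos_sq θ
  linear_combination ((b - a) / 2 * Real.cos θ) ^ 2 / 2 * hS + h1 + ((b-a)/2)^2 * secondDiff V a b (leafPos a b θ) * this

end

end ImpactSystem

end

/-! ### Quadratures for travel times and for differences of actions -/

noncomputable section

namespace ImpactSystem

open Set Filter Topology MeasureTheory

/-! ### Travel times on a leaf -/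

section

variable {V : ℝ → ℝ} {a b e : ℝ}

/-- The period of the motion on the leaf over `[a, b]`. -/
def leafPeriod (V : ℝ → ℝ) (a b : ℝ) : ℝ :=
  2 * ∫ θ in (-(Real.pi / 2))..(Real.pi / 2), (leafSpeed V a b θ)⁻¹

lemma leafPeriod_eq_leafClock : leafPeriod V a b = -(2 * leafClock V a b (-(Real.pi / 2))) := by
  rw [leafPeriod, leafClock, intervalIntegral.integral_symm]; ring

lemma leafClock_pi_div_two : leafClock V a b (Real.pi / 2) = 0 := by
  simp [leafClock]

/-- Time reversal about the right turning point: θ ↦ π - θ fixes the position and hence the speed.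
-/
lemma leafClock_pi_sub (θ : ℝ) : leafClock V a b (Real.pi - θ) = -leafClock V a b θ := by
  have h1 : ∀ s, (leafSpeed V a b (Real.pi - s))⁻¹ = (leafSpeed V a b s)⁻¹ := fun s => by
    simp only [leafSpeed, leafPos, Real.sin_pi_sub]
  have h2 := intervalIntegral.integral_comp_sub_left (a := θ) (b := Real.pi / 2)
    (fun s => (leafSpeed V a b s)⁻¹) Real.pi
  simp only [h1] at h2
  rw [show Real.pi - Real.pi / 2 = Real.pi / 2 by ring] at h2
  rw [leafClock, leafClock, ← h2, intervalIntegral.integral_symm]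

lemma injOn_leafPos (hab : a < b) : InjOn (leafPos a b) (Icc (-(Real.pi / 2)) (Real.pi / 2)) := by
  intro x hx y hy hxy
  have : (b - a) / 2 * Real.sin x = (b - a) / 2 * Real.sin y := by
    simp only [leafPos] at hxy; linarith
  exact Real.injOn_sin hx hy (mul_left_cancel₀ (by linarith [sub_pos.2 hab] : (b - a) / 2 ≠ 0) this)

lemma strictMonoOn_leafPos (hab : a < b) :
    StrictMonoOn (leafPos a b) (Icc (-(Real.pi / 2)) (Real.pi / 2)) := by
  intro x hx y hy hxy
  have := Real.strictMonoOn_sin hx hy hxy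
  have h2 : 0 < (b - a) / 2 := by linarith
  simp only [leafPos]
  nlinarith

lemma leafPos_pi_div_two : leafPos a b (Real.pi / 2) = b := by
  simp only [leafPos, Real.sin_pi_div_two]; ring

lemma leafPos_neg_pi_div_two : leafPos a b (-(Real.pi / 2)) = a := by
  simp only [leafPos, Real.sin_neg, Real.sin_pi_div_two]; ring

lemma image_leafPos (hab : a < b) {θ : ℝ} (hθ : θ ∈ Icc (-(Real.pi / 2)) (Real.pi / 2)) :
    leafPos a b '' Ioo θ (Real.pi / 2) = Ioo (leafPos a b θ) b := by
  have hm := strictMonoOn_leafPos hab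
  have hsub : Icc θ (Real.pi / 2) ⊆ Icc (-(Real.pi / 2)) (Real.pi / 2) :=
    Icc_subset_Icc_left hθ.1
  have hr : Real.pi / 2 ∈ Icc (-(Real.pi / 2)) (Real.pi / 2) := ⟨by linarith [Real.pi_pos], le_rfl⟩
  have hc : ContinuousOn (leafPos a b) (Icc θ (Real.pi / 2)) :=
    (contDiff_leafPos (n := 0)).continuous.continuousOn
  apply Subset.antisymm
  · rintro _ ⟨x, hx, rfl⟩
    have hx' := hsub (Ioo_subset_Icc_self hx)
    exact ⟨hm hθ hx' hx.1, by simpa only [leafPos_pi_div_two] using hm hx' hr hx.2⟩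
  · have := intermediate_value_Ioo hθ.2 hc
    rwa [leafPos_pi_div_two] at this

/-- The Jacobian of x = `leafPos a b θ` cancels the square root singularities of the integrand at
the turning points. All improper integrals below become integrals of a continuous function of the
angle. -/
lemma IsLeaf.leafPos_integrand (h : IsLeaf V a b e) (hV : ContDiff ℝ 3 V) (hab : a < b) {θ : ℝ}
    (hθ : θ ∈ Ioo (-(Real.pi / 2)) (Real.pi / 2)) :
    |(b - a) / 2 * Real.cos θ| • (1 / Real.sqrt (2 * (e - V (leafPos a b θ)))) =
      (leafSpeed V a b θ)⁻¹ := by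
  have hcos : 0 < Real.cos θ := Real.cos_pos_of_mem_Ioo hθ
  have hd : 0 < (b - a) / 2 * Real.cos θ := mul_pos (by linarith) hcos
  have h1 := h.sub_eq (hV.of_le (by norm_num)) (leafPos a b θ)
  have e2 : leafPos a b θ - a = (b - a) / 2 * (1 + Real.sin θ) := by simp only [leafPos]; ring
  have e3 : leafPos a b θ - b = (b - a) / 2 * (Real.sin θ - 1) := by simp only [leafPos]; ring
  rw [e2, e3] at h1
  have h2 : 2 * (e - V (leafPos a b θ)) =
      ((b - a) / 2 * Real.cos θ) ^ 2 * (2 * secondDiff V a b (leafPos a b θ)) := by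
    have := Real.sin_sq_add_cos_sq θ
    linear_combination -2 * h1 -
      ((b - a) / 2) ^ 2 * (2 * secondDiff V a b (leafPos a b θ)) * this
  have hS := h.leafSpeed_pos hV θ
  rw [h2, Real.sqrt_mul (sq_nonneg _), Real.sqrt_sq hd.le, abs_of_pos hd, smul_eq_mul]
  change _ * (1 / (_ * leafSpeed V a b θ)) = _
  rw [mul_one_div, ← div_div, div_self hd.ne', one_div]

lemma IsLeaf.integral_eq_leafClock (h : IsLeaf V a b e) (hV : ContDiff ℝ 3 V) (hab : a < b) {θ : ℝ}
    (hθ : θ ∈ Icc (-(Real.pi / 2)) (Real.pi / 2)) :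
    ∫ x in Ioo (leafPos a b θ) b, 1 / Real.sqrt (2 * (e - V x)) = -leafClock V a b θ := by
  have hsub : Ioo θ (Real.pi / 2) ⊆ Ioo (-(Real.pi / 2)) (Real.pi / 2) := Ioo_subset_Ioo_left hθ.1
  rw [← image_leafPos hab hθ, integral_image_eq_integral_abs_deriv_smul measurableSet_Ioo
    (fun x _ => (hasDerivAt_leafPos x).hasDerivWithinAt)
    ((injOn_leafPos hab).mono (hsub.trans Ioo_subset_Icc_self)),
    setIntegral_congr_fun measurableSet_Ioo fun x hx => h.leafPos_integrand hV hab (hsub hx),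
    leafClock, intervalIntegral.integral_symm, neg_neg, intervalIntegral.integral_of_le hθ.2,
    integral_Ioc_eq_integral_Ioo]

lemma IsLeaf.integrableOn (h : IsLeaf V a b e) (hV : ContDiff ℝ 3 V) (hab : a < b) :
    IntegrableOn (fun x => 1 / Real.sqrt (2 * (e - V x))) (Icc a b) := by
  have hθ : -(Real.pi / 2) ∈ Icc (-(Real.pi / 2)) (Real.pi / 2) := ⟨le_rfl, by linarith [Real.pi_pos]⟩
  rw [integrableOn_Icc_iff_integrableOn_Ioo]
  have h1 := image_leafPos hab hθ
  rw [leafPos_neg_pi_div_two] at h1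
  rw [← h1, integrableOn_image_iff_integrableOn_abs_deriv_smul measurableSet_Ioo
    (fun x _ => (hasDerivAt_leafPos x).hasDerivWithinAt)
    ((injOn_leafPos hab).mono Ioo_subset_Icc_self),
    integrableOn_congr_fun (fun x hx => h.leafPos_integrand hV hab hx) measurableSet_Ioo]
  exact (((h.continuous_inv_leafSpeed hV).continuousOn).integrableOn_Icc).mono_set
    Ioo_subset_Icc_self

lemma IsLeaf.integral_eq_leafPeriod (h : IsLeaf V a b e) (hV : ContDiff ℝ 3 V) (hab : a < b) :
    ∫ x in Icc a b, 1 / Real.sqrt (2 * (e - V x)) = leafPeriod V a b / 2 := by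
  have hθ : -(Real.pi / 2) ∈ Icc (-(Real.pi / 2)) (Real.pi / 2) := ⟨le_rfl, by linarith [Real.pi_pos]⟩
  have := h.integral_eq_leafClock hV hab hθ
  rw [leafPos_neg_pi_div_two] at this
  rw [integral_Icc_eq_integral_Ioo, this, leafPeriod_eq_leafClock]
  ring

/-! ### The time to reach a point from the right turning point -/

lemma IsLeaf.leafQ_zero (h : IsLeaf V a b e) (hV : ContDiff ℝ 3 V) : leafQ V a b 0 = b := by
  have := h.leafAngle_leafClock hV (Real.pi / 2)
  rw [leafClock_pi_div_two] at this
  rw [leafQ, this, leafPos_pi_div_two]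

lemma IsLeaf.leafP_zero (h : IsLeaf V a b e) (hV : ContDiff ℝ 3 V) : leafP V a b 0 = 0 := by
  have := h.leafAngle_leafClock hV (Real.pi / 2)
  rw [leafClock_pi_div_two] at this
  rw [leafP, this, Real.cos_pi_div_two]; ring

lemma IsLeaf.leafAngle_neg (h : IsLeaf V a b e) (hV : ContDiff ℝ 3 V) (t : ℝ) :
    leafAngle V a b (-t) = Real.pi - leafAngle V a b t := by
  apply (h.strictMono_leafClock hV).injective
  rw [leafClock_pi_sub, h.leafClock_leafAngle hV, h.leafClock_leafAngle hV]

lemma IsLeaf.leafQ_neg (h : IsLeaf V a b e) (hV : ContDiff ℝ 3 V) (t : ℝ) :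
    leafQ V a b (-t) = leafQ V a b t := by
  simp only [leafQ, h.leafAngle_neg hV, leafPos, Real.sin_pi_sub]

lemma IsLeaf.leafP_neg (h : IsLeaf V a b e) (hV : ContDiff ℝ 3 V) (t : ℝ) :
    leafP V a b (-t) = -leafP V a b t := by
  simp only [leafP, h.leafAngle_neg hV, leafSpeed, leafPos, Real.sin_pi_sub, Real.cos_pi_sub]
  ring

/-- The motion started at the right turning point moves to the left down to the point `c`, which it
reaches at the time given by the quadrature. -/
lemma IsLeaf.exists_time (h : IsLeaf V a b e) (hV : ContDiff ℝ 3 V) (hab : a < b) {c : ℝ}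
    (hc : c ∈ Ico a b) :
    ∃ τ > 0, τ = ∫ x in Ioo c b, 1 / Real.sqrt (2 * (e - V x)) ∧ leafQ V a b τ = c ∧
      (c = a → leafP V a b τ = 0) ∧ (a < c → leafP V a b τ < 0) ∧
      ∀ t ∈ Ioo 0 τ, leafP V a b t < 0 ∧ c < leafQ V a b t := by
  have hcont : ContinuousOn (leafPos a b) (Icc (-(Real.pi / 2)) (Real.pi / 2)) :=
    (contDiff_leafPos (n := 0)).continuous.continuousOn
  have hivt := intermediate_value_Ico (by linarith [Real.pi_pos]) hcont
  rw [leafPos_pi_div_two, leafPos_neg_pi_div_two] at hivt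
  obtain ⟨θ, hθ, rfl⟩ := hivt hc
  have hθ' := Ico_subset_Icc_self hθ
  have hmono := h.strictMono_leafClock hV
  -- The motion starts at angle π/2 with increasing angle, so on its way left it meets the point of
  -- angle θ < π/2 at the mirrored angle π - θ.
  have hτ : leafClock V a b (Real.pi - θ) = -leafClock V a b θ := leafClock_pi_sub θ
  have hpos : 0 < -leafClock V a b θ := by
    have := hmono hθ.2
    rw [leafClock_pi_div_two] at this
    linarith
  have hang : leafAngle V a b (-leafClock V a b θ) = Real.pi - θ := by
    rw [← hτ, h.leafAngle_leafClock hV]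
  refine ⟨-leafClock V a b θ, hpos, (h.integral_eq_leafClock hV hab hθ').symm, ?_, ?_, ?_, ?_⟩
  · rw [leafQ, hang]; simp only [leafPos, Real.sin_pi_sub]
  · intro hca
    have : θ = -(Real.pi / 2) := by
      exact injOn_leafPos hab hθ' ⟨le_rfl, by linarith [Real.pi_pos]⟩
        (hca.trans leafPos_neg_pi_div_two.symm)
    rw [leafP, hang, this, sub_neg_eq_add, add_comm, Real.cos_add_pi, Real.cos_pi_div_two]
    ring
  · intro hac
    have : -(Real.pi / 2) < θ := by
      rcases eq_or_lt_of_le hθ.1 with h0 | h0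
      · rw [← h0, leafPos_neg_pi_div_two] at hac
        exact absurd hac (lt_irrefl _)
      · exact h0
    rw [leafP, hang, Real.cos_pi_sub]
    have h1 := Real.cos_pos_of_mem_Ioo ⟨this, hθ.2⟩
    have h2 := h.leafSpeed_pos hV (Real.pi - θ)
    have h3 : 0 < (b - a) / 2 := by linarith
    have := mul_pos (mul_pos h3 h1) h2
    linarith
  · intro t ht
    have h1 : Real.pi / 2 < leafAngle V a b t := by
      have := h.strictMono_leafAngle hV ht.1
      rwa [← leafClock_pi_div_two (V := V) (a := a) (b := b), h.leafAngle_leafClock hV] at this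
    have h2 : leafAngle V a b t < Real.pi - θ := by
      have := h.strictMono_leafAngle hV ht.2
      rwa [hang] at this
    set φ := Real.pi - leafAngle V a b t with hφ
    have h3 : leafAngle V a b t = Real.pi - φ := by rw [hφ]; ring
    have hφ1 : θ < φ := by linarith
    have hφ2 : φ < Real.pi / 2 := by linarith
    constructor
    · rw [leafP, h3, Real.cos_pi_sub]
      have h1 := Real.cos_pos_of_mem_Ioo ⟨hθ.1.trans_lt hφ1, hφ2⟩
      have h2 := h.leafSpeed_pos hV (Real.pi - φ)
      have h3 : 0 < (b - a) / 2 := by linarith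
      have := mul_pos (mul_pos h3 h1) h2
      linarith
    · have := strictMonoOn_leafPos hab hθ' ⟨hθ.1.trans hφ1.le, hφ2.le⟩ hφ1
      rw [leafQ, h3]
      simpa only [leafPos, Real.sin_pi_sub] using this

/-- Every state of energy `e` over the leaf lies on the motion. -/
lemma IsLeaf.exists_leafQ_eq (h : IsLeaf V a b e) (hV : ContDiff ℝ 3 V) {x y : ℝ}
    (hx : x ∈ Icc a b) (hy : y ^ 2 / 2 + V x = e) : ∃ t, leafQ V a b t = x ∧ leafP V a b t = y := by
  have hcont : ContinuousOn (leafPos a b) (Icc (-(Real.pi / 2)) (Real.pi / 2)) :=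
    (contDiff_leafPos (n := 0)).continuous.continuousOn
  have hivt := intermediate_value_Icc (by linarith [Real.pi_pos]) hcont
  rw [leafPos_pi_div_two, leafPos_neg_pi_div_two] at hivt
  obtain ⟨θ, hθ, hθx⟩ := hivt hx
  set t := leafClock V a b θ
  have h1 : leafQ V a b t = x := by rw [leafQ, h.leafAngle_leafClock hV, hθx]
  have h2 := h.energy_eq hV t
  rw [h1, ← hy] at h2
  have h3 : leafP V a b t ^ 2 = y ^ 2 := by linarith
  -- The energy fixes the momentum up to sign; the other sign is reached at the reversed time.
  rcases sq_eq_sq_iff_eq_or_eq_neg.1 h3 with h4 | h4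
  · exact ⟨t, h1, h4⟩
  · exact ⟨-t, by rw [h.leafQ_neg hV, h1], by rw [h.leafP_neg hV, h4, neg_neg]⟩

end

/-! ### The dependence of the action on the energy -/

lemma hasDerivAt_sqrt_two_mul_sub {v E : ℝ} (h : v < E) :
    HasDerivAt (fun E => Real.sqrt (2 * (E - v))) (1 / Real.sqrt (2 * (E - v))) E := by
  have h1 := (((hasDerivAt_id E).sub_const v).const_mul 2).sqrt (by simp only [id]; linarith)
  refine h1.congr_deriv ?_
  have h2 : 0 < Real.sqrt (2 * (E - v)) := Real.sqrt_pos.2 (by linarith)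
  simp only [id]
  field_simp

lemma continuous_sqrt_two_mul_sub (v : ℝ) : Continuous fun E => Real.sqrt (2 * (E - v)) := by
  fun_prop

lemma sqrt_sub_sqrt_eq_integral_of_le {v h h' : ℝ} (hh : h ≤ h') (hv : v ≤ h) :
    IntervalIntegrable (fun E => 1 / Real.sqrt (2 * (E - v))) volume h h' ∧
    ∫ E in h..h', 1 / Real.sqrt (2 * (E - v)) =
      Real.sqrt (2 * (h' - v)) - Real.sqrt (2 * (h - v)) := by
  have hd : ∀ E ∈ Ioo h h', HasDerivAt (fun E => Real.sqrt (2 * (E - v)))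
    (1 / Real.sqrt (2 * (E - v))) E := fun E hE => hasDerivAt_sqrt_two_mul_sub (hv.trans_lt hE.1)
  have hi : IntervalIntegrable (fun E => 1 / Real.sqrt (2 * (E - v))) volume h h' := by
    refine intervalIntegral.intervalIntegrable_deriv_of_nonneg
      (g := fun E => Real.sqrt (2 * (E - v))) (continuous_sqrt_two_mul_sub v).continuousOn ?_ ?_
    · rw [min_eq_left hh, max_eq_right hh]; exact hd
    · intro E _; positivity
  exact ⟨hi, intervalIntegral.integral_eq_sub_of_hasDerivAt_of_le hh
    (continuous_sqrt_two_mul_sub v).continuousOn hd hi⟩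

lemma sqrt_sub_sqrt_eq_integral_of_ge {v h h' : ℝ} (hh : h ≤ h') (hv : h' ≤ v) :
    IntervalIntegrable (fun E => 1 / Real.sqrt (2 * (E - v))) volume h h' ∧
    ∫ E in h..h', 1 / Real.sqrt (2 * (E - v)) =
      Real.sqrt (2 * (h' - v)) - Real.sqrt (2 * (h - v)) := by
  have h0 : ∀ E ≤ v, Real.sqrt (2 * (E - v)) = 0 := fun E hE =>
    Real.sqrt_eq_zero_of_nonpos (by linarith)
  have h1 : EqOn (fun E => 1 / Real.sqrt (2 * (E - v))) (fun _ => 0) (uIcc h h') := by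
    intro E hE
    rw [uIcc_of_le hh] at hE
    simp only [h0 E (hE.2.trans hv), div_zero]
  refine ⟨?_, ?_⟩
  · exact (intervalIntegrable_const (c := (0 : ℝ))).congr
      (fun E hE => (h1 (uIoc_subset_uIcc hE)).symm)
  · rw [intervalIntegral.integral_congr h1, h0 _ hv, h0 _ (hh.trans hv)]
    simp

/-- No position of `v` has to be excluded: for E ≤ v the square root is 0 and its reciprocal is `1 /
0 = 0`. When v lies between h and h' the interval is split at v. -/
lemma sqrt_sub_sqrt_eq_integral {h h' : ℝ} (hh : h ≤ h') (v : ℝ) :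
    IntervalIntegrable (fun E => 1 / Real.sqrt (2 * (E - v))) volume h h' ∧
    ∫ E in h..h', 1 / Real.sqrt (2 * (E - v)) =
      Real.sqrt (2 * (h' - v)) - Real.sqrt (2 * (h - v)) := by
  rcases le_total v h with hv | hv
  · exact sqrt_sub_sqrt_eq_integral_of_le hh hv
  rcases le_total h' v with hv' | hv'
  · exact sqrt_sub_sqrt_eq_integral_of_ge hh hv'
  obtain ⟨i1, e1⟩ := sqrt_sub_sqrt_eq_integral_of_ge hv le_rfl
  obtain ⟨i2, e2⟩ := sqrt_sub_sqrt_eq_integral_of_le hv' le_rfl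
  refine ⟨i1.trans i2, ?_⟩
  rw [← intervalIntegral.integral_add_adjacent_intervals i1 i2, e1, e2]
  ring

/-- Fubini over energy and position. The integrand is nonnegative and its energy integrals are
differences of square roots, integrable over [A, B], so it is integrable on the product despite its
singularities. -/
lemma integral_sqrt_sub_integral_sqrt {V : ℝ → ℝ} (hV : Continuous V) (A B : ℝ) {h h' : ℝ}
    (hh : h ≤ h') :
    (∫ x in Icc A B, Real.sqrt (2 * (h' - V x))) - ∫ x in Icc A B, Real.sqrt (2 * (h - V x)) =
      ∫ E in h..h', ∫ x in Icc A B, 1 / Real.sqrt (2 * (E - V x)) := by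
  have hint (e : ℝ) : IntegrableOn (fun x => Real.sqrt (2 * (e - V x))) (Icc A B) :=
    ContinuousOn.integrableOn_Icc (by fun_prop)
  have hm : Measurable (Function.uncurry fun E x => 1 / Real.sqrt (2 * (E - V x))) := by
    have h1 : Continuous fun y : ℝ × ℝ => Real.sqrt (2 * (y.1 - V y.2)) := by fun_prop
    exact measurable_const.div h1.measurable
  have key : Integrable (Function.uncurry fun E x => 1 / Real.sqrt (2 * (E - V x)))
      ((volume.restrict (Ioc h h')).prod (volume.restrict (Icc A B))) := by
    rw [integrable_prod_iff' hm.aestronglyMeasurable]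
    constructor
    · refine Eventually.of_forall fun x => ?_
      have := (sqrt_sub_sqrt_eq_integral hh (V x)).1
      rwa [intervalIntegrable_iff_integrableOn_Ioc_of_le hh] at this
    · refine ((hint h').sub (hint h)).congr (Eventually.of_forall fun x => ?_)
      have := (sqrt_sub_sqrt_eq_integral hh (V x)).2
      rw [intervalIntegral.integral_of_le hh] at this
      simp only [Pi.sub_apply, Function.uncurry_apply_pair]
      rw [← this]
      refine integral_congr_ae (Eventually.of_forall fun E => ?_)
      simp only
      rw [Real.norm_of_nonneg (by positivity)]
  rw [intervalIntegral.integral_of_le hh, integral_integral_swap key, ← integral_sub (hint h')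
    (hint h)]
  refine integral_congr_ae (Eventually.of_forall fun x => ?_)
  simp only
  rw [← (sqrt_sub_sqrt_eq_integral hh (V x)).2, intervalIntegral.integral_of_le hh]

end ImpactSystem

end

/-! ### The action along a branch and its derivative -/

noncomputable section

namespace ImpactSystem

open Set Filter Topology MeasureTheory

/-! ### Wells -/

section

variable {V : ℝ → ℝ} {a b e : ℝ}

lemma IsLeaf.frequently_gt_right (h : IsLeaf V a b e) (hV : ContDiff ℝ 3 V) :
    ∀ᶠ x in 𝓝[>] b, e < V x := by
  have hQ : Continuous (secondDiff V a b) := (contDiff_secondDiff_right (n := 1) hV a b).continuous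
  have h1 := (hQ.tendsto b).eventually (lt_mem_nhds (h.secondDiff_pos hV ⟨h.le, le_rfl⟩))
  filter_upwards [nhdsWithin_le_nhds h1, self_mem_nhdsWithin] with x hx hxb
  have h2 := h.sub_eq (hV.of_le (by norm_num)) x
  have h3 : 0 < x - b := sub_pos.2 hxb
  have h4 : 0 < x - a := by linarith [h.le]
  have := mul_pos (mul_pos h4 h3) hx
  linarith

lemma IsLeaf.frequently_gt_left (h : IsLeaf V a b e) (hV : ContDiff ℝ 3 V) :
    ∀ᶠ x in 𝓝[<] a, e < V x := by
  have hQ : Continuous (secondDiff V a b) := (contDiff_secondDiff_right (n := 1) hV a b).continuous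
  have h1 := (hQ.tendsto a).eventually (lt_mem_nhds (h.secondDiff_pos hV ⟨le_rfl, h.le⟩))
  filter_upwards [nhdsWithin_le_nhds h1, self_mem_nhdsWithin] with x hx hxb
  have h2 := h.sub_eq (hV.of_le (by norm_num)) x
  have h3 : 0 < a - x := sub_pos.2 hxb
  have h4 : 0 < b - x := by linarith [h.le]
  have := mul_pos (mul_pos h4 h3) hx
  linarith

lemma IsLeaf.le_energy (h : IsLeaf V a b e) {x : ℝ} (hx : x ∈ Icc a b) : V x ≤ e := by
  rcases eq_or_lt_of_le hx.1 with rfl | h1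
  · exact h.left.le
  rcases eq_or_lt_of_le hx.2 with rfl | h2
  · exact h.right.le
  · exact (h.lt x ⟨h1, h2⟩).le

/-- Just outside [a, b] the factorization makes V exceed e, so the component cannot extend past
either end. -/
lemma IsLeaf.well_eq (h : IsLeaf V a b e) (hV : ContDiff ℝ 3 V) {x : ℝ} (hx : x ∈ Icc a b) :
    well V x e = Icc a b := by
  have hsub : Icc a b ⊆ {y | V y ≤ e} := fun y hy => h.le_energy hy
  apply Subset.antisymm
  · intro y hy
    have hconn : IsPreconnected (well V x e) := isPreconnected_connectedComponentIn
    have hxw : x ∈ well V x e := mem_connectedComponentIn (hsub hx)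
    have hw : well V x e ⊆ {y | V y ≤ e} := connectedComponentIn_subset _ _
    have hord := hconn.ordConnected
    constructor
    · by_contra hlt
      push Not at hlt
      have h1 : ∀ᶠ z in 𝓝[<] a, z ∈ Ioo y a := Ioo_mem_nhdsLT hlt
      obtain ⟨z, hz, hz'⟩ := ((h.frequently_gt_left hV).and h1).exists
      have := hw (hord.out hy hxw ⟨hz'.1.le, hz'.2.le.trans hx.1⟩)
      exact absurd this (not_le.2 hz)
    · by_contra hlt
      push Not at hlt
      have h1 : ∀ᶠ z in 𝓝[>] b, z ∈ Ioo b y := Ioo_mem_nhdsGT hlt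
      obtain ⟨z, hz, hz'⟩ := ((h.frequently_gt_right hV).and h1).exists
      have := hw (hord.out hxw hy ⟨hx.2.trans hz'.1.le, hz'.2.le⟩)
      exact absurd this (not_le.2 hz)
  · exact isPreconnected_Icc.subset_connectedComponentIn hx hsub

/-- The action of a leaf in terms of its projection `[a, b]`. -/
def leafAction (V : ℝ → ℝ) (a b e : ℝ) : ℝ :=
  (1 / Real.pi) * ∫ x in Icc a b, Real.sqrt (2 * (e - V x))

lemma IsLeaf.action_eq (h : IsLeaf V a b e) (hV : ContDiff ℝ 3 V) {x : ℝ} (hx : x ∈ Icc a b) :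
    action V x e = leafAction V a b e := by
  rw [action, h.well_eq hV hx, leafAction]

/-! ### Dependence of the period on the leaf -/

/-- In the angle coordinate the period is an integral over a fixed interval of a function that is C¹
in the end points as long as the quotient stays positive. The pairs (a₁, b₁) need not bound leaves,
and `a = b` is allowed. -/
lemma IsLeaf.exists_lipschitz_leafPeriod (h : IsLeaf V a b e) (hV : ContDiff ℝ 3 V) :
    ∃ s > 0, ∃ L ≥ 0, ∀ a₁ ∈ Icc (a - s) (a + s), ∀ b₁ ∈ Icc (b - s) (b + s),
      ∀ a₂ ∈ Icc (a - s) (a + s), ∀ b₂ ∈ Icc (b - s) (b + s),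
      |leafPeriod V a₁ b₁ - leafPeriod V a₂ b₂| ≤ L * (|a₁ - a₂| + |b₁ - b₂|) := by
  set G : ℝ × ℝ × ℝ → ℝ := fun y => secondDiff V y.1 y.2.1 (leafPos y.1 y.2.1 y.2.2) with hG
  have hGc : ContDiff ℝ 1 G := by
    refine (contDiff_secondDiff (n := 1) hV).comp (f := fun y : ℝ × ℝ × ℝ =>
      (y.1, y.2.1, leafPos y.1 y.2.1 y.2.2)) ?_
    refine contDiff_fst.prodMk ((contDiff_fst.comp contDiff_snd).prodMk ?_)
    unfold leafPos
    have : ContDiff ℝ 1 fun y : ℝ × ℝ × ℝ => Real.sin y.2.2 :=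
      Real.contDiff_sin.comp (contDiff_snd.comp contDiff_snd)
    fun_prop
  set I := Icc (-(Real.pi / 2)) (Real.pi / 2) with hI
  have hIc : IsCompact I := isCompact_Icc
  have hopen : IsOpen {y | 0 < G y} := isOpen_lt continuous_const hGc.continuous
  -- Tube lemma over the compact interval of angles.
  have htube : ∃ s > 0, ∀ a₁ ∈ Icc (a - s) (a + s), ∀ b₁ ∈ Icc (b - s) (b + s), ∀ θ ∈ I,
      0 < G (a₁, b₁, θ) := by
    have h1 : ∀ θ ∈ I, ∀ᶠ z in 𝓝 θ ×ˢ 𝓝 (a, b), 0 < G (z.2.1, z.2.2, z.1) := by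
      intro θ _
      have hc : Continuous fun z : ℝ × (ℝ × ℝ) => G (z.2.1, z.2.2, z.1) :=
        hGc.continuous.comp (by fun_prop)
      have := (hc.tendsto (θ, (a, b))).eventually
        (lt_mem_nhds (a := 0) (h.secondDiff_pos hV (leafPos_mem h.le θ)))
      rwa [nhds_prod_eq] at this
    have h2 := hIc.eventually_forall_of_forall_eventually (P := fun (x : ℝ × ℝ) (θ : ℝ) => 0 < G (x.1, x.2, θ))
      (x₀ := (a, b)) (fun θ hθ => by
        have := h1 θ hθ
        rw [← nhds_prod_eq] at this
        exact (continuous_swap.tendsto ((a, b), θ)).eventually this)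
    obtain ⟨s, hs, hs'⟩ := Metric.eventually_nhds_iff.1 h2
    refine ⟨s / 2, by positivity, fun a₁ ha₁ b₁ hb₁ θ hθ => hs' (y := (a₁, b₁)) ?_ θ hθ⟩
    rw [Prod.dist_eq, max_lt_iff, Real.dist_eq, Real.dist_eq, abs_lt, abs_lt]
    exact ⟨⟨by linarith [ha₁.1], by linarith [ha₁.2]⟩, ⟨by linarith [hb₁.1], by linarith [hb₁.2]⟩⟩
  obtain ⟨s, hs, hpos⟩ := htube
  set S := Icc (a - s) (a + s) ×ˢ Icc (b - s) (b + s) ×ˢ I with hS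
  have hSc : IsCompact S := isCompact_Icc.prod (isCompact_Icc.prod hIc)
  set F : ℝ × ℝ × ℝ → ℝ := fun y => (Real.sqrt (2 * G y))⁻¹ with hF
  have hFd : ∀ y ∈ S, ContDiffAt ℝ 1 F y := by
    rintro ⟨a₁, b₁, θ⟩ ⟨h1, h2, h3⟩
    have hp : 0 < 2 * G (a₁, b₁, θ) := mul_pos two_pos (hpos a₁ h1 b₁ h2 θ h3)
    exact ((contDiffAt_const.mul hGc.contDiffAt).sqrt hp.ne').inv (Real.sqrt_pos.2 hp).ne'
  have hFl : LocallyLipschitzOn S F := by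
    intro y hy
    obtain ⟨K, t, ht, hK⟩ := (hFd y hy).exists_lipschitzOnWith
    exact ⟨K, t, nhdsWithin_le_nhds ht, hK⟩
  obtain ⟨K, hK⟩ := hFl.exists_lipschitzOnWith_of_compact hSc
  have hint : ∀ a₁ ∈ Icc (a - s) (a + s), ∀ b₁ ∈ Icc (b - s) (b + s),
      IntervalIntegrable (fun θ => (leafSpeed V a₁ b₁ θ)⁻¹) volume (-(Real.pi / 2))
        (Real.pi / 2) := by
    intro a₁ h1 b₁ h2
    refine ContinuousOn.intervalIntegrable ?_
    rw [uIcc_of_le (by linarith [Real.pi_pos])]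
    exact (continuous_leafSpeed hV).continuousOn.inv₀ fun θ hθ =>
      (Real.sqrt_pos.2 (mul_pos two_pos (hpos a₁ h1 b₁ h2 θ hθ))).ne'
  refine ⟨s, hs, 2 * Real.pi * K, by positivity, fun a₁ h1 b₁ h2 a₂ h3 b₂ h4 => ?_⟩
  rw [leafPeriod, leafPeriod, ← mul_sub, ← intervalIntegral.integral_sub (hint a₁ h1 b₁ h2)
    (hint a₂ h3 b₂ h4)]
  have hb : ∀ θ ∈ uIoc (-(Real.pi / 2)) (Real.pi / 2),
      ‖(leafSpeed V a₁ b₁ θ)⁻¹ - (leafSpeed V a₂ b₂ θ)⁻¹‖ ≤ K * (|a₁ - a₂| + |b₁ - b₂|) := by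
    intro θ hθ
    rw [uIoc_of_le (by linarith [Real.pi_pos])] at hθ
    have hθ' : θ ∈ I := Ioc_subset_Icc_self hθ
    have := hK.dist_le_mul (a₁, b₁, θ) ⟨h1, h2, hθ'⟩ (a₂, b₂, θ) ⟨h3, h4, hθ'⟩
    rw [dist_eq_norm] at this
    refine this.trans ?_
    gcongr
    rw [Prod.dist_eq, Prod.dist_eq, dist_self]
    simp only [Real.dist_eq]
    refine max_le (by linarith [abs_nonneg (b₁ - b₂)]) (max_le (by linarith [abs_nonneg (a₁ - a₂)])
      (by positivity))
  have := intervalIntegral.norm_integral_le_of_norm_le_const hb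
  rw [show Real.pi / 2 - -(Real.pi / 2) = Real.pi by ring, abs_of_pos Real.pi_pos] at this
  rw [abs_mul, abs_two]
  calc 2 * _ ≤ 2 * (K * (|a₁ - a₂| + |b₁ - b₂|) * Real.pi) := by gcongr; exact this
    _ = _ := by ring

end

/-! ### Families of leaves -/

/-- A family of leaves over `[a h, b h]` parametrized by the energy `h ∈ J`, and Lipschitz with
respect to the parameter `ν h`. -/
structure LeafFamily (V : ℝ → ℝ) (J : Set ℝ) (a b ν : ℝ → ℝ) (L : ℝ) : Prop where
  leaf : ∀ h ∈ J, IsLeaf V (a h) (b h) h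
  ordConnected : J.OrdConnected
  nested : ∀ h ∈ J, ∀ h' ∈ J, h ≤ h' → Icc (a h) (b h) ⊆ Icc (a h') (b h')
  mem_of_le : ∀ h ∈ J, ∀ h' ∈ J, h ≤ h' → ∀ x ∈ Icc (a h') (b h'), V x ≤ h → x ∈ Icc (a h) (b h)
  deriv_ne : ∀ h ∈ J, ∀ h' ∈ J, h ≤ h' → ∀ x ∈ Icc (a h') (b h') \ Icc (a h) (b h), deriv V x ≠ 0
  monotoneOn : MonotoneOn ν J
  continuousOn : ContinuousOn ν J
  nonneg : 0 ≤ L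
  lipschitz : ∀ h ∈ J, ∀ h' ∈ J,
    |leafPeriod V (a h) (b h) - leafPeriod V (a h') (b h')| ≤ L * |ν h - ν h'|

namespace LeafFamily

variable {V a b ν : ℝ → ℝ} {J : Set ℝ} {L h h' : ℝ}

lemma continuousOn_leafPeriod (hF : LeafFamily V J a b ν L) :
    ContinuousOn (fun h => leafPeriod V (a h) (b h)) J := by
  intro h hh
  have h1 : Tendsto (fun h' => L * |ν h' - ν h|) (𝓝[J] h) (𝓝 0) := by
    have h0 : Tendsto ν (𝓝[J] h) (𝓝 (ν h)) := hF.continuousOn h hh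
    simpa using ((h0.sub_const (ν h)).abs).const_mul L
  refine tendsto_iff_dist_tendsto_zero.2 (squeeze_zero' (Eventually.of_forall fun _ => dist_nonneg) ?_ h1)
  filter_upwards [self_mem_nhdsWithin] with h' hh'
  exact hF.lipschitz h' hh' h hh

/-- All integrals can be taken over the largest interval, because on the part of it outside a
smaller leaf V exceeds that leaf's energy and the square root is 0 by convention. There is therefore
no boundary term when the end points move. -/
lemma action_sub_of_le (hF : LeafFamily V J a b ν L) (hV : ContDiff ℝ 3 V) (hh : h ∈ J)
    (hh' : h' ∈ J) (hle : h ≤ h') :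
    leafAction V (a h') (b h') h' - leafAction V (a h) (b h) h =
      1 / (2 * Real.pi) * ∫ E in h..h', leafPeriod V (a E) (b E) := by
  have e1 : ∫ x in Icc (a h) (b h), Real.sqrt (2 * (h - V x)) =
      ∫ x in Icc (a h') (b h'), Real.sqrt (2 * (h - V x)) := by
    symm
    refine setIntegral_eq_of_subset_of_forall_sdiff_eq_zero measurableSet_Icc
      (hF.nested h hh h' hh' hle) fun x hx => ?_
    refine Real.sqrt_eq_zero_of_nonpos ?_
    by_contra hlt
    exact hx.2 (hF.mem_of_le h hh h' hh' hle x hx.1 (by linarith))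
  have e2 := integral_sqrt_sub_integral_sqrt hV.continuous (a h') (b h') hle
  rw [leafAction, leafAction, e1, ← mul_sub, e2]
  have e3 : ∫ E in h..h', ∫ x in Icc (a h') (b h'), 1 / Real.sqrt (2 * (E - V x)) =
      ∫ E in h..h', leafPeriod V (a E) (b E) / 2 := by
    refine intervalIntegral.integral_congr_ae (Eventually.of_forall fun E hE => ?_)
    rw [uIoc_of_le hle] at hE
    have hEJ : E ∈ J := hF.ordConnected.out hh hh' (Ioc_subset_Icc_self hE)
    have hleaf := hF.leaf E hEJ
    -- By nesting, a one-point interval at E > h would be the point `a h`, where V equals h and not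
    -- E.
    have hlt : a E < b E := by
      refine lt_of_le_of_ne hleaf.le fun heq => ?_
      have h1 := hF.nested h hh E hEJ hE.1.le ⟨le_rfl, (hF.leaf h hh).le⟩
      rw [← heq, Icc_self] at h1
      have h2 := hleaf.left
      rw [← mem_singleton_iff.1 h1, (hF.leaf h hh).left] at h2
      exact hE.1.ne h2
    rw [← hleaf.integral_eq_leafPeriod hV hlt]
    refine setIntegral_eq_of_subset_of_forall_sdiff_eq_zero measurableSet_Icc
      (hF.nested E hEJ h' hh' hE.2) fun x hx => ?_
    rw [Real.sqrt_eq_zero_of_nonpos, div_zero]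
    by_contra hlt
    exact hx.2 (hF.mem_of_le E hEJ h' hh' hE.2 x hx.1 (by linarith))
  rw [e3, intervalIntegral.integral_div]
  field_simp

lemma action_sub (hF : LeafFamily V J a b ν L) (hV : ContDiff ℝ 3 V) (hh : h ∈ J) (hh' : h' ∈ J) :
    leafAction V (a h') (b h') h' - leafAction V (a h) (b h) h =
      1 / (2 * Real.pi) * ∫ E in h..h', leafPeriod V (a E) (b E) := by
  rcases le_total h h' with hle | hle
  · exact hF.action_sub_of_le hV hh hh' hle
  · rw [← neg_sub, hF.action_sub_of_le hV hh' hh hle, intervalIntegral.integral_symm]; ring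

/-- Between h and h' the period deviates from its value at h by at most L |ν h' - ν h|, since ν is
monotone. The error is a mixed product because ν may be a square root of the energy; it becomes
quadratic only in phase space. -/
lemma action_taylor (hF : LeafFamily V J a b ν L) (hV : ContDiff ℝ 3 V) (hh : h ∈ J)
    (hh' : h' ∈ J) :
    |leafAction V (a h') (b h') h' - leafAction V (a h) (b h) h -
      leafPeriod V (a h) (b h) / (2 * Real.pi) * (h' - h)| ≤ L * (|h' - h| * |ν h' - ν h|) := by
  have hsub : uIcc h h' ⊆ J := hF.ordConnected.uIcc_subset hh hh'
  have hi : IntervalIntegrable (fun E => leafPeriod V (a E) (b E)) volume h h' :=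
    (hF.continuousOn_leafPeriod.mono hsub).intervalIntegrable
  have e1 : leafPeriod V (a h) (b h) / (2 * Real.pi) * (h' - h) =
      1 / (2 * Real.pi) * ∫ _ in h..h', leafPeriod V (a h) (b h) := by
    rw [intervalIntegral.integral_const, smul_eq_mul]; ring
  rw [hF.action_sub hV hh hh', e1, ← mul_sub, ← intervalIntegral.integral_sub hi (by simp)]
  have hb : ∀ E ∈ uIoc h h', ‖leafPeriod V (a E) (b E) - leafPeriod V (a h) (b h)‖ ≤
      L * |ν h' - ν h| := by
    intro E hE
    have hE' := uIoc_subset_uIcc hE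
    refine (hF.lipschitz E (hsub hE') h hh).trans ?_
    refine mul_le_mul_of_nonneg_left ?_ hF.nonneg
    rcases le_total h h' with hle | hle
    · rw [uIcc_of_le hle] at hE'
      have h1 := hF.monotoneOn hh (hsub (by rw [uIcc_of_le hle]; exact hE')) hE'.1
      have h2 := hF.monotoneOn (hsub (by rw [uIcc_of_le hle]; exact hE')) hh' hE'.2
      rw [abs_of_nonneg (by linarith), abs_of_nonneg (by linarith)]
      linarith
    · rw [uIcc_of_ge hle] at hE'
      have h1 := hF.monotoneOn hh' (hsub (by rw [uIcc_of_ge hle]; exact hE')) hE'.1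
      have h2 := hF.monotoneOn (hsub (by rw [uIcc_of_ge hle]; exact hE')) hh hE'.2
      rw [abs_of_nonpos (by linarith), abs_of_nonpos (by linarith)]
      linarith
  have h1 := intervalIntegral.norm_integral_le_of_norm_le_const hb
  rw [abs_mul, abs_of_pos (by positivity : 0 < 1 / (2 * Real.pi))]
  have h2 : 1 / (2 * Real.pi) ≤ 1 := by
    rw [div_le_one (by positivity)]
    nlinarith [Real.pi_gt_three]
  calc _ ≤ 1 * (L * |ν h' - ν h| * |h' - h|) := by
        gcongr
        exact h1
    _ = _ := by ring

lemma hasDerivWithinAt_action (hF : LeafFamily V J a b ν L) (hV : ContDiff ℝ 3 V) (hh : h ∈ J) :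
    HasDerivWithinAt (fun e => leafAction V (a e) (b e) e)
      (leafPeriod V (a h) (b h) / (2 * Real.pi)) J h := by
  rw [hasDerivWithinAt_iff_isLittleO]
  have h1 : (fun e => L * (|e - h| * |ν e - ν h|)) =o[𝓝[J] h] fun e => e - h := by
    have h2 : Tendsto (fun e => L * |ν e - ν h|) (𝓝[J] h) (𝓝 0) := by
      have h0 : Tendsto ν (𝓝[J] h) (𝓝 (ν h)) := hF.continuousOn h hh
      simpa using ((h0.sub_const (ν h)).abs).const_mul L
    have h3 : (fun e => (L * |ν e - ν h|) * |e - h|) =o[𝓝[J] h] fun e => (1 : ℝ) * (e - h) := by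
      refine Asymptotics.IsLittleO.mul_isBigO ?_ ?_
      · exact (Asymptotics.isLittleO_one_iff ℝ).2 h2
      · exact (Asymptotics.isBigO_refl _ _).abs_left
    simp only [one_mul] at h3
    refine h3.congr_left fun e => by ring
  refine Asymptotics.IsBigO.trans_isLittleO ?_ h1
  refine Asymptotics.IsBigO.of_bound 1 ?_
  filter_upwards [self_mem_nhdsWithin] with e he
  rw [one_mul, Real.norm_eq_abs, Real.norm_of_nonneg (by have := hF.nonneg; positivity), smul_eq_mul, mul_comm (e - h)]
  exact hF.action_taylor hV hh he

/-- Leaves grow with the energy, so `x` stays on the leaves of slightly larger energy, and a right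
neighbourhood suffices for the one-sided derivative in `freq`. -/
lemma inv_freq (hF : LeafFamily V J a b ν L) (hV : ContDiff ℝ 3 V) (hh : h ∈ J)
    (hJ : J ∈ 𝓝[≥] h) {x : ℝ} (hx : x ∈ Icc (a h) (b h)) :
    1 / freq V x h = leafPeriod V (a h) (b h) / (2 * Real.pi) := by
  have h1 : HasDerivWithinAt (fun e => leafAction V (a e) (b e) e)
      (leafPeriod V (a h) (b h) / (2 * Real.pi)) (Ici h) h :=
    (hF.hasDerivWithinAt_action hV hh).mono_of_mem_nhdsWithin hJ
  have h2 : (fun e => action V x e) =ᶠ[𝓝[≥] h] fun e => leafAction V (a e) (b e) e := by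
    filter_upwards [hJ, self_mem_nhdsWithin] with e he hle
    exact (hF.leaf e he).action_eq hV (hF.nested h hh e he hle hx)
  have h3 := h1.congr_of_eventuallyEq h2 ((hF.leaf h hh).action_eq hV hx)
  rw [freq, one_div, inv_inv, h3.derivWithin (uniqueDiffWithinAt_Ici h)]

lemma sameBranch (hF : LeafFamily V J a b ν L) (hV : ContDiff ℝ 3 V) (hh : h ∈ J) (hh' : h' ∈ J)
    {x x' : ℝ} (hx : x ∈ Icc (a h) (b h)) (hx' : x' ∈ Icc (a h') (b h')) :
    SameBranch V x h x' h' := by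
  rw [SameBranch, (hF.leaf h hh).well_eq hV hx, (hF.leaf h' hh').well_eq hV hx']
  rcases le_total h h' with hle | hle
  · exact Or.inl ⟨hF.nested h hh h' hh' hle, hF.deriv_ne h hh h' hh' hle⟩
  · exact Or.inr ⟨hF.nested h' hh' h hh hle, hF.deriv_ne h' hh' h hh hle⟩

end LeafFamily

end ImpactSystem

end

/-! ### Continuation of a leaf to nearby energies -/

noncomputable section

namespace ImpactSystem

open Set Filter Topology MeasureTheory

/-! ### Local inverses -/

/-- A quantitative inverse function theorem on the line. The expansion constant is half the
derivative at m and does not depend on the radius s, which can therefore be reduced afterwards to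
meet other constraints. -/
lemma exists_expanding {f : ℝ → ℝ} {m : ℝ} (hf : ContDiffAt ℝ 1 f m) (h : 0 < deriv f m) :
    ∃ s₀ > 0, ∃ c > 0, ∀ s ∈ Ioc 0 s₀, ContinuousOn f (Icc (m - s) (m + s)) ∧
      (∀ x ∈ Icc (m - s) (m + s), c ≤ deriv f x) ∧
      (∀ x ∈ Icc (m - s) (m + s), ∀ y ∈ Icc (m - s) (m + s), x ≤ y → c * (y - x) ≤ f y - f x) ∧
      ∀ v, |v - f m| ≤ c * s → ∃ x ∈ Icc (m - s) (m + s), f x = v := by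
  have h1 : ∀ᶠ x in 𝓝 m, ContDiffAt ℝ 1 f x := hf.eventually (by simp)
  have h2 : ContinuousAt (deriv f) m := by
    have := (hf.fderiv_right (m := 0) (by simp)).continuousAt
    exact this.clm_apply continuousAt_const
  have h3 : ∀ᶠ x in 𝓝 m, deriv f m / 2 < deriv f x :=
    h2.eventually (lt_mem_nhds (by linarith))
  obtain ⟨s, hs, hs'⟩ := Metric.eventually_nhds_iff.1 (h1.and h3)
  refine ⟨s / 2, by positivity, deriv f m / 2, by positivity, fun s' hs1 => ?_⟩
  have hd : ∀ x ∈ Icc (m - s') (m + s'), ContDiffAt ℝ 1 f x ∧ deriv f m / 2 < deriv f x := by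
    intro x hx
    apply hs'
    rw [Real.dist_eq, abs_lt]
    constructor <;> linarith [hx.1, hx.2, hs1.2]
  have hcont : ContinuousOn f (Icc (m - s') (m + s')) :=
    fun x hx => (hd x hx).1.continuousAt.continuousWithinAt
  have hexp : ∀ x ∈ Icc (m - s') (m + s'), ∀ y ∈ Icc (m - s') (m + s'), x ≤ y →
      deriv f m / 2 * (y - x) ≤ f y - f x := by
    refine (convex_Icc _ _).mul_sub_le_image_sub_of_le_deriv hcont ?_ ?_
    · intro x hx
      exact ((hd x (interior_subset hx)).1.differentiableAt one_ne_zero).differentiableWithinAt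
    · exact fun x hx => (hd x (interior_subset hx)).2.le
  have hs0 := hs1.1
  refine ⟨hcont, fun x hx => (hd x hx).2.le, hexp, fun v hv => ?_⟩
  have e1 := hexp (m - s') ⟨le_rfl, by linarith⟩ m ⟨by linarith, by linarith⟩ (by linarith)
  have e2 := hexp m ⟨by linarith, by linarith⟩ (m + s') ⟨by linarith, le_rfl⟩ (by linarith)
  rw [abs_le] at hv
  exact intermediate_value_Icc (by linarith) hcont ⟨by linarith, by linarith⟩

/-! ### Existence of families of leaves -/

section

variable {V : ℝ → ℝ} {a₀ b₀ h₀ : ℝ}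

/-- The conclusion of the local existence theorem for families of leaves. -/
def HasLeafFamily (V : ℝ → ℝ) (a₀ b₀ h₀ : ℝ) : Prop :=
  ∃ σ > 0, ∃ s > 0, ∃ (J : Set ℝ) (a b ν : ℝ → ℝ) (L : ℝ), LeafFamily V J a b ν L ∧
    (∀ h, |h - h₀| < σ → ∀ x ∈ Icc (a₀ - s) (b₀ + s), V x ≤ h → h ∈ J ∧ x ∈ Icc (a h) (b h)) ∧
    (∀ h ∈ J, |h - h₀| < σ → J ∈ 𝓝[≥] h) ∧
    ∀ R, ∃ L', ∀ x ∈ Icc (a₀ - s) (b₀ + s), ∀ x' ∈ Icc (a₀ - s) (b₀ + s), ∀ y y', |y| ≤ R → |y'| ≤ R →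
      |ν (y ^ 2 / 2 + V x) - ν (y' ^ 2 / 2 + V x')| ≤ L' * (|x - x'| + |y - y'|)

lemma abs_sqrt_sq_add_sq_sub_le (u v u' v' : ℝ) :
    |Real.sqrt (u ^ 2 + v ^ 2) - Real.sqrt (u' ^ 2 + v' ^ 2)| ≤ |u - u'| + |v - v'| := by
  have h (u v : ℝ) : Real.sqrt (u ^ 2 + v ^ 2) = ‖(⟨u, v⟩ : ℂ)‖ := by
    rw [Complex.norm_def, Complex.normSq_mk]; congr 1; ring
  rw [h, h]
  refine (abs_norm_sub_norm_le _ _).trans ((Complex.norm_le_abs_re_add_abs_im _).trans ?_)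
  simp

/-- Morse lemma in one variable: V = h₀ + k² with k = (x - a₀)√Q increasing near a₀. The leaf ends
are the solutions of k = ∓ν with ν = √(h - h₀), so the period is Lipschitz in ν. On the phase plane
ν is √(y²/2 + k(x)²), a norm of Lipschitz functions, hence Lipschitz up to the center itself. -/
lemma IsLeaf.hasLeafFamily_of_center (hl : IsLeaf V a₀ b₀ h₀) (hV : ContDiff ℝ 3 V)
    (hab : a₀ = b₀) : HasLeafFamily V a₀ b₀ h₀ := by
  subst hab
  obtain ⟨sP, hsP, LP, hLP, hP⟩ := hl.exists_lipschitz_leafPeriod hV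
  set Q := secondDiff V a₀ a₀ with hQdef
  have hQ : ContDiff ℝ 1 Q := contDiff_secondDiff_right (n := 1) hV a₀ a₀
  have hQ0 : 0 < Q a₀ := hl.secondDiff_pos hV ⟨le_rfl, le_rfl⟩
  have hVQ : ∀ x, V x - h₀ = (x - a₀) * (x - a₀) * Q x := hl.sub_eq (hV.of_le (by norm_num))
  set k : ℝ → ℝ := fun x => (x - a₀) * Real.sqrt (Q x) with hk
  have hk1 : ContDiffAt ℝ 1 k a₀ :=
    (contDiffAt_id.sub contDiffAt_const).mul (hQ.contDiffAt.sqrt hQ0.ne')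
  have hk0 : k a₀ = 0 := by simp [hk]
  have hk' : 0 < deriv k a₀ := by
    have h1 : HasDerivAt (fun x => Real.sqrt (Q x)) (deriv (fun x => Real.sqrt (Q x)) a₀) a₀ :=
      ((hQ.contDiffAt.sqrt hQ0.ne').differentiableAt one_ne_zero).hasDerivAt
    have h2 := ((hasDerivAt_id a₀).sub_const a₀).fun_mul h1
    simp only [id, one_mul, sub_self, zero_mul, add_zero] at h2
    have : deriv k a₀ = Real.sqrt (Q a₀) := h2.deriv
    rw [this]
    exact Real.sqrt_pos.2 hQ0
  obtain ⟨K, t, ht, hK⟩ := hk1.exists_lipschitzOnWith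
  obtain ⟨sK, hsK, hsK'⟩ := Metric.mem_nhds_iff.1 ht
  obtain ⟨sQ, hsQ, hsQ'⟩ := Metric.eventually_nhds_iff.1
    ((hQ.continuous.tendsto a₀).eventually (lt_mem_nhds hQ0))
  obtain ⟨s₀, hs₀, c, hc, hexp⟩ := exists_expanding hk1 hk'
  -- On the closed interval of radius `s`, `k` expands, the period bound applies, `k` is Lipschitz
  -- and Q is positive; the halves pass from open balls to a closed interval.
  set s := min (min s₀ sP) (min (sK / 2) (sQ / 2)) with hs
  have hs0 : 0 < s := by positivity
  have hss₀ : s ≤ s₀ := (min_le_left _ _).trans (min_le_left _ _)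
  have hssP : s ≤ sP := (min_le_left _ _).trans (min_le_right _ _)
  have hssK : s ≤ sK / 2 := (min_le_right _ _).trans (min_le_left _ _)
  have hssQ : s ≤ sQ / 2 := (min_le_right _ _).trans (min_le_right _ _)
  obtain ⟨-, hder, hmono, hinv⟩ := hexp s ⟨hs0, hss₀⟩
  rw [hk0] at hinv
  set I := Icc (a₀ - s) (a₀ + s) with hI
  have hQI : ∀ x ∈ I, 0 < Q x := fun x hx => by
    apply hsQ'
    rw [Real.dist_eq, abs_lt]
    constructor <;> linarith [hx.1, hx.2]
  have hkI : ∀ x ∈ I, ∀ y ∈ I, |k x - k y| ≤ K * |x - y| := fun x hx y hy => by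
    have hsub : I ⊆ t := fun z hz => hsK' (by
      rw [Metric.mem_ball, Real.dist_eq, abs_lt]
      constructor <;> linarith [hz.1, hz.2])
    simpa only [Real.dist_eq] using hK.dist_le_mul x (hsub hx) y (hsub hy)
  have hVk : ∀ x ∈ I, V x = k x ^ 2 + h₀ := fun x hx => by
    have := hVQ x
    rw [hk]
    simp only
    rw [mul_pow, Real.sq_sqrt (hQI x hx).le]
    linarith
  have hlt : ∀ x ∈ I, ∀ y ∈ I, k x < k y → x < y := fun x hx y hy hxy => by
    by_contra hle
    push Not at hle
    nlinarith [hmono y hy x hx hle]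
  have hle' : ∀ x ∈ I, ∀ y ∈ I, k x ≤ k y → x ≤ y := fun x hx y hy hxy => by
    by_contra hle
    push Not at hle
    nlinarith [hmono y hy x hx hle.le]
  have hkmono : ∀ x ∈ I, ∀ y ∈ I, x < y → k x < k y := fun x hx y hy hxy => by
    have := hmono x hx y hy hxy.le
    nlinarith [mul_pos hc (sub_pos.2 hxy)]
  have hkmono' : ∀ x ∈ I, ∀ y ∈ I, x ≤ y → k x ≤ k y := fun x hx y hy hxy => by
    have := hmono x hx y hy hxy
    nlinarith [mul_nonneg hc.le (sub_nonneg.2 hxy)]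
  have hexpabs : ∀ x ∈ I, ∀ y ∈ I, c * |x - y| ≤ |k x - k y| := fun x hx y hy => by
    rcases le_total x y with h | h
    · rw [abs_of_nonpos (by linarith), abs_of_nonpos (by linarith [hkmono' x hx y hy h])]
      linarith [hmono x hx y hy h]
    · rw [abs_of_nonneg (by linarith), abs_of_nonneg (by linarith [hkmono' y hy x hx h])]
      linarith [hmono y hy x hx h]
  have hderivV : ∀ x ∈ I, x ≠ a₀ → deriv V x ≠ 0 ∧ (a₀ < x → 0 < deriv V x) ∧
      (x < a₀ → deriv V x < 0) := by
    intro x hx hxa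
    have hkd : HasDerivAt k (deriv k x) x := by
      refine DifferentiableAt.hasDerivAt ?_
      -- Without differentiability `deriv k x` would be the default value 0, against its lower bound
      -- `c`.
      by_contra hnd
      have := hder x hx
      rw [deriv_zero_of_not_differentiableAt hnd] at this
      linarith
    have hkpos := hder x hx
    have hVd : HasDerivAt V (2 * k x * deriv k x) x := by
      have h1 := (hkd.fun_pow 2).add_const h₀
      have hev : V =ᶠ[𝓝 x] fun y => k y ^ 2 + h₀ := by
        have : ∀ᶠ y in 𝓝 x, 0 < Q y := (hQ.continuous.tendsto x).eventually (lt_mem_nhds (hQI x hx))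
        filter_upwards [this] with y hy
        have := hVQ y
        rw [hk]
        simp only
        rw [mul_pow, Real.sq_sqrt hy.le]
        linarith
      have h2 := h1.congr_of_eventuallyEq hev
      exact h2.congr_deriv (by simp)
    have ha₀I : a₀ ∈ I := ⟨by linarith, by linarith⟩
    rw [hVd.deriv]
    have hdk : 0 < deriv k x := by linarith
    rcases lt_or_gt_of_ne hxa with h | h
    · have h1 := hkmono x hx a₀ ha₀I h
      rw [hk0] at h1
      have h2 : 2 * k x * deriv k x < 0 := by nlinarith
      exact ⟨h2.ne, fun h' => absurd h' (not_lt.2 h.le), fun _ => h2⟩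
    · have h1 := hkmono a₀ ha₀I x hx h
      rw [hk0] at h1
      have h2 : 0 < 2 * k x * deriv k x := by positivity
      exact ⟨h2.ne', fun _ => h2, fun h' => absurd h' (not_lt.2 h.le)⟩
  choose! g hgI hgk using hinv
  set ν : ℝ → ℝ := fun h => Real.sqrt (h - h₀) with hν
  -- Up to this energy `ν h ≤ c * s`, the range in which `k` has preimages in `I`.
  set J := Icc h₀ (h₀ + (c * s) ^ 2) with hJ
  have hcs : 0 < c * s := by positivity
  have hνJ : ∀ h ∈ J, ν h ≤ c * s := fun h hh => by
    rw [hν]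
    simp only
    rw [Real.sqrt_le_left hcs.le]
    linarith [hh.2]
  have hν0 : ∀ h, 0 ≤ ν h := fun h => Real.sqrt_nonneg _
  have hνsq : ∀ h ∈ J, ν h ^ 2 = h - h₀ := fun h hh => Real.sq_sqrt (by linarith [hh.1])
  have hb1 : ∀ h ∈ J, |ν h| ≤ c * s := fun h hh => by rw [abs_of_nonneg (hν0 h)]; exact hνJ h hh
  have ha1 : ∀ h ∈ J, |-ν h| ≤ c * s := fun h hh => by rw [abs_neg]; exact hb1 h hh
  simp only [sub_zero] at hgI hgk
  have hmem : ∀ h ∈ J, ∀ x ∈ I, V x ≤ h → x ∈ Icc (g (-ν h)) (g (ν h)) := by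
    intro h hh x hx hxh
    rw [hVk x hx] at hxh
    have h1 : k x ^ 2 ≤ ν h ^ 2 := by rw [hνsq h hh]; linarith
    have h2 := abs_le_of_sq_le_sq' h1 (hν0 h)
    exact ⟨hle' _ (hgI _ (ha1 h hh)) _ hx (by rw [hgk _ (ha1 h hh)]; exact h2.1),
      hle' _ hx _ (hgI _ (hb1 h hh)) (by rw [hgk _ (hb1 h hh)]; exact h2.2)⟩
  have hIccI : ∀ h ∈ J, Icc (g (-ν h)) (g (ν h)) ⊆ I := fun h hh x hx =>
    ⟨(hgI _ (ha1 h hh)).1.trans hx.1, hx.2.trans (hgI _ (hb1 h hh)).2⟩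
  have hleaf : ∀ h ∈ J, IsLeaf V (g (-ν h)) (g (ν h)) h := by
    intro h hh
    have hA := hgI _ (ha1 h hh)
    have hB := hgI _ (hb1 h hh)
    have kA := hgk _ (ha1 h hh)
    have kB := hgk _ (hb1 h hh)
    have ha₀I : a₀ ∈ I := ⟨by linarith, by linarith⟩
    refine ⟨hle' _ hA _ hB (by rw [kA, kB]; linarith [hν0 h]), ?_, ?_, ?_, ?_⟩
    · rw [hVk _ hA, kA, neg_sq, hνsq h hh]; ring
    · rw [hVk _ hB, kB, hνsq h hh]; ring
    · intro x hx
      have hxI := hIccI h hh (Ioo_subset_Icc_self hx)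
      have h1 := hkmono _ hA _ hxI hx.1
      have h2 := hkmono _ hxI _ hB hx.2
      rw [kA] at h1
      rw [kB] at h2
      rw [hVk x hxI]
      have := hνsq h hh
      nlinarith
    · rcases eq_or_lt_of_le (hν0 h) with h0 | h0
      · right
        have e0 : ν h = 0 := h0.symm
        rw [e0] at hB kB
        rw [e0, neg_zero]
        have : g 0 = a₀ := le_antisymm (hle' _ hB _ ha₀I (by rw [kB, hk0]))
          (hle' _ ha₀I _ hB (by rw [kB, hk0]))
        rw [this]
        rcases hl.nondegenerate with h1 | h1
        · exact absurd h1.1 (lt_irrefl _)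
        · exact h1
      · left
        have h1 : g (-ν h) < a₀ := hlt _ hA _ ha₀I (by rw [kA, hk0]; linarith)
        have h2 : a₀ < g (ν h) := hlt _ ha₀I _ hB (by rw [kB, hk0]; linarith)
        exact ⟨h1.trans h2, (hderivV _ hA h1.ne).2.2 h1, (hderivV _ hB h2.ne').2.1 h2⟩
  have hlipg : ∀ u v, |u| ≤ c * s → |v| ≤ c * s → |g u - g v| ≤ c⁻¹ * |u - v| := by
    intro u v hu hv
    have := hexpabs _ (hgI u hu) _ (hgI v hv)
    rw [hgk u hu, hgk v hv] at this
    rw [inv_mul_eq_div, le_div_iff₀ hc]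
    linarith
  have hνmono : Monotone ν := fun h h' hle => Real.sqrt_le_sqrt (by linarith)
  have hJsub : ∀ h ∈ J, ∀ h' ∈ J, h ≤ h' →
      Icc (g (-ν h)) (g (ν h)) ⊆ Icc (g (-ν h')) (g (ν h')) := by
    intro h hh h' hh' hle
    have h1 := hνmono hle
    refine Icc_subset_Icc (hle' _ (hgI _ (ha1 h' hh')) _ (hgI _ (ha1 h hh)) ?_)
      (hle' _ (hgI _ (hb1 h hh)) _ (hgI _ (hb1 h' hh')) ?_)
    · rw [hgk _ (ha1 h' hh'), hgk _ (ha1 h hh)]; linarith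
    · rw [hgk _ (hb1 h hh), hgk _ (hb1 h' hh')]; exact h1
  refine ⟨(c * s) ^ 2, by positivity, s, hs0, J, fun h => g (-ν h), fun h => g (ν h), ν,
    LP * (c⁻¹ + c⁻¹), ⟨hleaf, ordConnected_Icc, hJsub, ?_, ?_, hνmono.monotoneOn _, ?_, ?_, ?_⟩,
    ?_, ?_, ?_⟩
  · intro h hh h' hh' _ x hx hxh
    exact hmem h hh x (hIccI h' hh' hx) hxh
  · intro h hh h' hh' _ x hx
    have hxI := hIccI h' hh' hx.1
    refine (hderivV x hxI ?_).1
    rintro rfl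
    exact hx.2 (hmem h hh x hxI (by rw [hVk x hxI, hk0]; linarith [hh.1]))
  · exact Continuous.continuousOn (by rw [hν]; fun_prop)
  · positivity
  · intro h hh h' hh'
    have hsub : ∀ u, |u| ≤ c * s → g u ∈ Icc (a₀ - sP) (a₀ + sP) := fun u hu =>
      ⟨by linarith [(hgI u hu).1], by linarith [(hgI u hu).2]⟩
    refine (hP _ (hsub _ (ha1 h hh)) _ (hsub _ (hb1 h hh)) _ (hsub _ (ha1 h' hh')) _
      (hsub _ (hb1 h' hh'))).trans ?_
    rw [mul_assoc]
    refine mul_le_mul_of_nonneg_left ?_ hLP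
    have e1 := hlipg _ _ (ha1 h hh) (ha1 h' hh')
    have e2 := hlipg _ _ (hb1 h hh) (hb1 h' hh')
    rw [show -ν h - -ν h' = -(ν h - ν h') by ring, abs_neg] at e1
    linarith
  · intro h hh x hx hxh
    have h1 : h₀ ≤ h := by
      have := hVk x hx
      nlinarith [sq_nonneg (k x)]
    have hhJ : h ∈ J := ⟨h1, by linarith [(abs_lt.1 hh).2]⟩
    exact ⟨hhJ, hmem h hhJ x hx hxh⟩
  · intro h hh hlt
    have : h < h₀ + (c * s) ^ 2 := by linarith [(abs_lt.1 hlt).2]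
    exact mem_of_superset (Icc_mem_nhdsGE this) (Icc_subset_Icc_left hh.1)
  · intro R
    refine ⟨K + 1, fun x hx x' hx' y y' _ _ => ?_⟩
    have e1 : ∀ x ∈ I, ∀ y, ν (y ^ 2 / 2 + V x) =
        Real.sqrt ((y / Real.sqrt 2) ^ 2 + k x ^ 2) := by
      intro x hx y
      rw [hν]
      simp only
      rw [hVk x hx, div_pow, Real.sq_sqrt (by norm_num)]
      congr 1
      ring
    rw [e1 x hx, e1 x' hx']
    refine (abs_sqrt_sq_add_sq_sub_le _ _ _ _).trans ?_
    have e2 := hkI x hx x' hx'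
    have e3 : |y / Real.sqrt 2 - y' / Real.sqrt 2| ≤ |y - y'| := by
      rw [← sub_div, abs_div, abs_of_pos (by positivity : 0 < Real.sqrt 2)]
      exact div_le_self (abs_nonneg _) (Real.one_le_sqrt.2 (by norm_num))
    have e4 : 0 ≤ (K : ℝ) * |y - y'| := by positivity
    nlinarith [abs_nonneg (x - x')]

/-- Both turning points are simple zeros of V - h₀ and move in a Lipschitz way with the energy, so
the parameter ν can be the energy itself. -/
lemma IsLeaf.hasLeafFamily_of_lt (hl : IsLeaf V a₀ b₀ h₀) (hV : ContDiff ℝ 3 V)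
    (hab : a₀ < b₀) : HasLeafFamily V a₀ b₀ h₀ := by
  obtain ⟨sP, hsP, LP, hLP, hP⟩ := hl.exists_lipschitz_leafPeriod hV
  have hnd : deriv V a₀ < 0 ∧ 0 < deriv V b₀ := by
    rcases hl.nondegenerate with h | h
    · exact h.2
    · exact absurd h.1 hab.ne
  have hV1 : ContDiff ℝ 1 V := hV.of_le (by norm_num)
  have hnegd : ∀ x, deriv (fun x => -V x) x = -deriv V x := fun x => by
    rw [deriv.fun_neg]
  obtain ⟨s₁, hs₁, c₁, hc₁, hexp₁⟩ := exists_expanding (hV1.neg.contDiffAt (x := a₀))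
    (by rw [hnegd]; linarith)
  obtain ⟨s₂, hs₂, c₂, hc₂, hexp₂⟩ := exists_expanding (hV1.contDiffAt (x := b₀)) hnd.2
  set s := min (min s₁ s₂) (min sP ((b₀ - a₀) / 3)) with hs
  have hs0 : 0 < s := by
    have : 0 < (b₀ - a₀) / 3 := by linarith
    positivity
  have hss₁ : s ≤ s₁ := (min_le_left _ _).trans (min_le_left _ _)
  have hss₂ : s ≤ s₂ := (min_le_left _ _).trans (min_le_right _ _)
  have hssP : s ≤ sP := (min_le_right _ _).trans (min_le_left _ _)
  have hssd : s ≤ (b₀ - a₀) / 3 := (min_le_right _ _).trans (min_le_right _ _)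
  obtain ⟨-, hder₁, hmono₁, hinv₁⟩ := hexp₁ s ⟨hs0, hss₁⟩
  obtain ⟨-, hder₂, hmono₂, hinv₂⟩ := hexp₂ s ⟨hs0, hss₂⟩
  simp only [hnegd] at hder₁
  simp only [hl.left, hl.right] at hinv₁ hinv₂
  -- Between the two end intervals V stays below h₀ by a gap, so for energies within the gap no
  -- further turning point appears there.
  obtain ⟨κ, hκ, hκ'⟩ : ∃ κ > 0, ∀ x ∈ Icc (a₀ + s) (b₀ - s), V x ≤ h₀ - κ := by
    obtain ⟨z, hz, hzmax⟩ := isCompact_Icc.exists_isMaxOn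
      (nonempty_Icc.2 (by linarith : a₀ + s ≤ b₀ - s)) hV.continuous.continuousOn
    have := hl.lt z ⟨by linarith [hz.1], by linarith [hz.2]⟩
    exact ⟨h₀ - V z, by linarith, fun x hx => by have h1 : V x ≤ V z := hzmax hx; linarith⟩
  set σ := min (min (c₁ * s) (c₂ * s)) κ with hσ
  have hσ0 : 0 < σ := by positivity
  have hσ₁ : σ ≤ c₁ * s := (min_le_left _ _).trans (min_le_left _ _)
  have hσ₂ : σ ≤ c₂ * s := (min_le_left _ _).trans (min_le_right _ _)
  have hσκ : σ ≤ κ := min_le_right _ _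
  choose! g₁ hg₁I hg₁V using hinv₁
  choose! g₂ hg₂I hg₂V using hinv₂
  set J := Ioo (h₀ - σ) (h₀ + σ) with hJ
  -- `g₁` inverts `-V`, which is the increasing function at the left end.
  set a : ℝ → ℝ := fun h => g₁ (-h) with ha
  set b : ℝ → ℝ := g₂ with hb
  have haI : ∀ h ∈ J, a h ∈ Icc (a₀ - s) (a₀ + s) := fun h hh => hg₁I _ (by
    rw [abs_le]; constructor <;> linarith [hh.1, hh.2])
  have hbI : ∀ h ∈ J, b h ∈ Icc (b₀ - s) (b₀ + s) := fun h hh => hg₂I _ (by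
    rw [abs_le]; constructor <;> linarith [hh.1, hh.2])
  have haV : ∀ h ∈ J, V (a h) = h := fun h hh => by
    have := hg₁V (-h) (by rw [abs_le]; constructor <;> linarith [hh.1, hh.2])
    linarith
  have hbV : ∀ h ∈ J, V (b h) = h := fun h hh => hg₂V h (by
    rw [abs_le]; constructor <;> linarith [hh.1, hh.2])
  have hmem : ∀ h ∈ J, ∀ x ∈ Icc (a₀ - s) (b₀ + s), V x ≤ h → x ∈ Icc (a h) (b h) := by
    intro h hh x hx hxh
    have hA := haI h hh
    have hB := hbI h hh
    constructor
    · by_contra hlt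
      push Not at hlt
      have := hmono₁ x ⟨hx.1, hlt.le.trans hA.2⟩ (a h) hA hlt.le
      rw [haV h hh] at this
      nlinarith [mul_pos hc₁ (sub_pos.2 hlt)]
    · by_contra hlt
      push Not at hlt
      have := hmono₂ (b h) hB x ⟨hB.1.trans hlt.le, hx.2⟩ hlt.le
      rw [hbV h hh] at this
      nlinarith [mul_pos hc₂ (sub_pos.2 hlt)]
  have hsub : ∀ h ∈ J, Icc (a h) (b h) ⊆ Icc (a₀ - s) (b₀ + s) := fun h hh =>
    Icc_subset_Icc (haI h hh).1 (hbI h hh).2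
  have hle : ∀ h ∈ J, a h < b h := fun h hh => by
    have := (haI h hh).2
    have := (hbI h hh).1
    linarith
  have hleaf : ∀ h ∈ J, IsLeaf V (a h) (b h) h := by
    intro h hh
    refine ⟨(hle h hh).le, haV h hh, hbV h hh, ?_, Or.inl ⟨hle h hh, ?_, ?_⟩⟩
    · intro x hx
      rcases le_total x (a₀ + s) with h1 | h1
      · have := hmono₁ (a h) (haI h hh) x ⟨(haI h hh).1.trans hx.1.le, h1⟩ hx.1.le
        rw [haV h hh] at this
        nlinarith [mul_pos hc₁ (sub_pos.2 hx.1)]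
      rcases le_total x (b₀ - s) with h2 | h2
      · have := hκ' x ⟨h1, h2⟩
        linarith [hh.1]
      · have := hmono₂ x ⟨h2, hx.2.le.trans (hbI h hh).2⟩ (b h) (hbI h hh) hx.2.le
        rw [hbV h hh] at this
        nlinarith [mul_pos hc₂ (sub_pos.2 hx.2)]
    · linarith [hder₁ _ (haI h hh)]
    · linarith [hder₂ _ (hbI h hh)]
  have hnest : ∀ h ∈ J, ∀ h' ∈ J, h ≤ h' → Icc (a h) (b h) ⊆ Icc (a h') (b h') := by
    intro h hh h' hh' hle x hx
    exact hmem h' hh' x (hsub h hh hx) (((hleaf h hh).le_energy hx).trans hle)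
  have hlip₁ : ∀ h ∈ J, ∀ h' ∈ J, |a h - a h'| ≤ c₁⁻¹ * |h - h'| := by
    have key : ∀ h ∈ J, ∀ h' ∈ J, a h ≤ a h' → |a h - a h'| ≤ c₁⁻¹ * |h - h'| := by
      intro h hh h' hh' hle
      have := hmono₁ _ (haI h hh) _ (haI h' hh') hle
      rw [haV h hh, haV h' hh'] at this
      rw [inv_mul_eq_div, le_div_iff₀ hc₁, abs_of_nonpos (by linarith)]
      have := le_abs_self (h - h')
      linarith
    intro h hh h' hh'
    rcases le_total (a h) (a h') with h1 | h1
    · exact key h hh h' hh' h1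
    · rw [abs_sub_comm, abs_sub_comm h]; exact key h' hh' h hh h1
  have hlip₂ : ∀ h ∈ J, ∀ h' ∈ J, |b h - b h'| ≤ c₂⁻¹ * |h - h'| := by
    have key : ∀ h ∈ J, ∀ h' ∈ J, b h ≤ b h' → |b h - b h'| ≤ c₂⁻¹ * |h - h'| := by
      intro h hh h' hh' hle
      have := hmono₂ _ (hbI h hh) _ (hbI h' hh') hle
      rw [hbV h hh, hbV h' hh'] at this
      rw [inv_mul_eq_div, le_div_iff₀ hc₂, abs_of_nonpos (by linarith)]
      have := neg_abs_le (h - h')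
      linarith
    intro h hh h' hh'
    rcases le_total (b h) (b h') with h1 | h1
    · exact key h hh h' hh' h1
    · rw [abs_sub_comm, abs_sub_comm h]; exact key h' hh' h hh h1
  refine ⟨σ, hσ0, s, hs0, J, a, b, id, LP * (c₁⁻¹ + c₂⁻¹), ⟨hleaf, ordConnected_Ioo, hnest, ?_, ?_,
    monotone_id.monotoneOn _, continuousOn_id, by positivity, ?_⟩, ?_, ?_, ?_⟩
  · intro h hh h' hh' _ x hx hxh
    exact hmem h hh x (hsub h' hh' hx) hxh
  · intro h hh h' hh' hle x hx
    rcases lt_or_ge x (a h) with h1 | h1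
    · have := hder₁ x ⟨(haI h' hh').1.trans hx.1.1, h1.le.trans (haI h hh).2⟩
      intro h0
      linarith
    · rcases lt_or_ge (b h) x with h2 | h2
      · have := hder₂ x ⟨(hbI h hh).1.trans h2.le, hx.1.2.trans (hbI h' hh').2⟩
        intro h0
        linarith
      · exact absurd ⟨h1, h2⟩ hx.2
  · intro h hh h' hh'
    have hA : ∀ h ∈ J, a h ∈ Icc (a₀ - sP) (a₀ + sP) := fun h hh =>
      ⟨by linarith [(haI h hh).1], by linarith [(haI h hh).2]⟩
    have hB : ∀ h ∈ J, b h ∈ Icc (b₀ - sP) (b₀ + sP) := fun h hh =>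
      ⟨by linarith [(hbI h hh).1], by linarith [(hbI h hh).2]⟩
    refine (hP _ (hA h hh) _ (hB h hh) _ (hA h' hh') _ (hB h' hh')).trans ?_
    rw [mul_assoc]
    refine mul_le_mul_of_nonneg_left ?_ hLP
    simp only [id]
    linarith [hlip₁ h hh h' hh', hlip₂ h hh h' hh']
  · intro h hh x hx hxh
    have hhJ : h ∈ J := ⟨by linarith [(abs_lt.1 hh).1], by linarith [(abs_lt.1 hh).2]⟩
    exact ⟨hhJ, hmem h hhJ x hx hxh⟩
  · intro h hh _
    exact nhdsWithin_le_nhds (isOpen_Ioo.mem_nhds hh)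
  · intro R
    have hlip : LocallyLipschitz V := hV1.locallyLipschitz
    obtain ⟨K, hK⟩ := (hlip.locallyLipschitzOn (s := Icc (a₀ - s) (b₀ + s))).exists_lipschitzOnWith_of_compact
      isCompact_Icc
    refine ⟨K + |R|, fun x hx x' hx' y y' hy hy' => ?_⟩
    have h1 := hK.dist_le_mul x hx x' hx'
    rw [Real.dist_eq, Real.dist_eq] at h1
    have h2 : |y ^ 2 / 2 - y' ^ 2 / 2| ≤ |R| * |y - y'| := by
      rw [show y ^ 2 / 2 - y' ^ 2 / 2 = (y + y') / 2 * (y - y') by ring, abs_mul]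
      refine mul_le_mul_of_nonneg_right ?_ (abs_nonneg _)
      rw [abs_div, abs_two]
      have := abs_add_le y y'
      have := le_abs_self R
      linarith
    simp only [id]
    calc _ = |(y ^ 2 / 2 - y' ^ 2 / 2) + (V x - V x')| := by congr 1; ring
      _ ≤ _ := (abs_add_le _ _).trans (by
        have : 0 ≤ (K : ℝ) * |y - y'| := by positivity
        have : 0 ≤ |R| * |x - x'| := by positivity
        nlinarith)

theorem IsLeaf.hasLeafFamily (hl : IsLeaf V a₀ b₀ h₀) (hV : ContDiff ℝ 3 V) :
    HasLeafFamily V a₀ b₀ h₀ := by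
  rcases eq_or_lt_of_le hl.le with h | h
  · exact hl.hasLeafFamily_of_center hV h
  · exact hl.hasLeafFamily_of_lt hV h

end

end ImpactSystem

end

/-! ### Nonsingular components are leaves, and the action as a function on the phase plane -/

noncomputable section

namespace ImpactSystem

open Set Filter Topology MeasureTheory

/-! ### Existence of leaves -/

section

variable {V : ℝ → ℝ} {h₀ : ℝ}

lemma eventually_lt_of_hasDerivAt_pos {f : ℝ → ℝ} {v x₀ : ℝ} (hd : HasDerivAt f v x₀)
    (hv : 0 < v) : (∀ᶠ x in 𝓝[>] x₀, f x₀ < f x) ∧ ∀ᶠ x in 𝓝[<] x₀, f x < f x₀ := by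
  have h1 := hasDerivAt_iff_tendsto_slope.1 hd
  have h2 := h1.eventually (lt_mem_nhds hv)
  constructor
  · have h3 : ∀ᶠ x in 𝓝[>] x₀, 0 < slope f x₀ x :=
      h2.filter_mono (nhdsWithin_mono _ fun x hx => (ne_of_gt hx : x ≠ x₀))
    filter_upwards [h3, self_mem_nhdsWithin] with x hx hx0
    rw [slope_def_field] at hx
    have : 0 < x - x₀ := sub_pos.2 (mem_Ioi.1 hx0)
    have := (div_pos_iff_of_pos_right this).1 hx
    linarith
  · have h3 : ∀ᶠ x in 𝓝[<] x₀, 0 < slope f x₀ x :=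
      h2.filter_mono (nhdsWithin_mono _ fun x hx => (ne_of_lt hx : x ≠ x₀))
    filter_upwards [h3, self_mem_nhdsWithin] with x hx hx0
    rw [slope_def_field] at hx
    have h4 : x - x₀ < 0 := sub_neg.2 (mem_Iio.1 hx0)
    by_contra h5
    push Not at h5
    exact absurd hx (not_lt.2 (div_nonpos_of_nonneg_of_nonpos (by linarith) h4.le))

/-- Take the supremum of the b with V ≤ h₀ on [x₀, b], finite by coercivity. Maximality gives points
with V > h₀ arbitrarily close on the right, which later fixes the sign of the derivative at b. -/
lemma exists_right_endpoint (hV : Continuous V) (hc : Tendsto V (cocompact ℝ) atTop) {x₀ : ℝ}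
    (hx₀ : V x₀ ≤ h₀) : ∃ b, x₀ ≤ b ∧ V b = h₀ ∧ (∀ x ∈ Icc x₀ b, V x ≤ h₀) ∧
      ∃ᶠ x in 𝓝[>] b, h₀ < V x := by
  set S := {b | x₀ ≤ b ∧ ∀ x ∈ Icc x₀ b, V x ≤ h₀} with hS
  have hx₀S : x₀ ∈ S := ⟨le_rfl, fun x hx => by rw [le_antisymm hx.2 hx.1]; exact hx₀⟩
  have hbdd : BddAbove S := by
    have h1 : Tendsto V atTop atTop := hc.mono_left atTop_le_cocompact
    obtain ⟨M, hM⟩ := (h1.eventually (eventually_gt_atTop h₀)).exists_forall_of_atTop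
    refine ⟨M, fun b hb => ?_⟩
    by_contra hlt
    push Not at hlt
    exact absurd (hb.2 b ⟨hb.1, le_rfl⟩) (not_le.2 (hM b hlt.le))
  set b := sSup S with hb
  have hx₀b : x₀ ≤ b := le_csSup hbdd hx₀S
  have hIco : ∀ x ∈ Ico x₀ b, V x ≤ h₀ := by
    intro x hx
    obtain ⟨b', hb', hlt⟩ := exists_lt_of_lt_csSup ⟨x₀, hx₀S⟩ hx.2
    exact hb'.2 x ⟨hx.1, hlt.le⟩
  have hIcc : ∀ x ∈ Icc x₀ b, V x ≤ h₀ := by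
    rcases eq_or_lt_of_le hx₀b with h | h
    · intro x hx
      rw [← h] at hx
      exact hx₀S.2 x hx
    · have : closure (Ico x₀ b) ⊆ {x | V x ≤ h₀} :=
        closure_minimal hIco (isClosed_le hV continuous_const)
      rwa [closure_Ico h.ne] at this
  have hfreq : ∃ᶠ x in 𝓝[>] b, h₀ < V x := by
    intro hev
    obtain ⟨u, hu, hu'⟩ := (mem_nhdsGT_iff_exists_Ioo_subset.1 hev)
    have hmem : (b + u) / 2 ∈ S := by
      have hbu : b < u := hu
      refine ⟨by linarith, fun x hx => ?_⟩
      rcases le_or_gt x b with h | h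
      · exact hIcc x ⟨hx.1, h⟩
      · exact not_lt.1 (hu' ⟨h, by linarith [hx.2]⟩)
    have := le_csSup hbdd hmem
    have hbu : b < u := hu
    linarith
  refine ⟨b, hx₀b, le_antisymm (hIcc b ⟨hx₀b, le_rfl⟩) ?_, hIcc, hfreq⟩
  by_contra hlt
  push Not at hlt
  have h1 : ∀ᶠ x in 𝓝[>] b, V x < h₀ :=
    nhdsWithin_le_nhds ((hV.tendsto b).eventually (gt_mem_nhds hlt))
  obtain ⟨x, hx, hx'⟩ := (hfreq.and_eventually h1).exists
  exact absurd hx (not_lt.2 hx'.le)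

lemma deriv_nonneg_of_frequently {b : ℝ} (hd : DifferentiableAt ℝ V b) (hb : V b = h₀)
    (hf : ∃ᶠ x in 𝓝[>] b, h₀ < V x) : 0 ≤ deriv V b := by
  by_contra hlt
  push Not at hlt
  have h1 := (eventually_lt_of_hasDerivAt_pos (f := fun x => -V x) hd.hasDerivAt.fun_neg
    (by linarith)).1
  obtain ⟨x, hx, hx'⟩ := (hf.and_eventually h1).exists
  rw [hb] at hx'
  linarith

/-- A critical point at level h₀ is not a saddle, so it is a nondegenerate minimum and V > h₀ on
both sides of it. Hence it cannot lie inside [a, b], where V = h₀ would be a local maximum, nor be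
an end point of a nontrivial interval. -/
lemma exists_leaf (hV : ContDiff ℝ 3 V) (hm : ∀ x, deriv V x = 0 → deriv (deriv V) x ≠ 0)
    (hc : Tendsto V (cocompact ℝ) atTop) (hs : ∀ s, IsSaddle V s → V s ≠ h₀) {x₀ : ℝ}
    (hx₀ : V x₀ ≤ h₀) : ∃ a b, IsLeaf V a b h₀ ∧ x₀ ∈ Icc a b := by
  have hd : Differentiable ℝ V := hV.differentiable (by norm_num)
  obtain ⟨b, hxb, hb, hIb, hfb⟩ := exists_right_endpoint hV.continuous hc hx₀
  -- The left end point is the right end point for the reflected potential.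
  obtain ⟨a', hxa', ha', hIa', hfa'⟩ := exists_right_endpoint (V := fun x => V (-x)) (x₀ := -x₀)
    (h₀ := h₀) (hV.continuous.comp continuous_neg)
    (hc.comp (Homeomorph.neg ℝ).isClosedEmbedding.tendsto_cocompact)
    (by simpa using hx₀)
  obtain ⟨a, rfl⟩ : ∃ a, a' = -a := ⟨-a', by ring⟩
  simp only [neg_neg] at ha'
  have hax : a ≤ x₀ := by linarith
  have hIcc : ∀ x ∈ Icc a b, V x ≤ h₀ := by
    intro x hx
    rcases le_total x x₀ with h | h
    · have := hIa' (-x) ⟨by linarith, by linarith [hx.1]⟩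
      simpa using this
    · exact hIb x ⟨h, hx.2⟩
  have hmin : ∀ x, V x = h₀ → deriv V x = 0 → IsLeaf V x x h₀ := by
    intro x hx hx'
    refine ⟨le_rfl, hx, hx, fun y hy => absurd (hy.1.trans hy.2) (lt_irrefl _), Or.inr ⟨rfl, hx', ?_⟩⟩
    rcases lt_or_gt_of_ne (hm x hx') with h | h
    · exact absurd hx (hs x ⟨hx', h⟩)
    · exact h
  have hdb := deriv_nonneg_of_frequently (hd b) hb hfb
  have hda : deriv V a ≤ 0 := by
    have h1 : HasDerivAt (fun x => V (-x)) (-deriv V a) (-a) := by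
      have h2 : HasDerivAt V (deriv V a) (-(-a)) := by rw [neg_neg]; exact (hd a).hasDerivAt
      have := h2.comp (-a) (hasDerivAt_neg (-a))
      rw [mul_neg_one] at this
      exact this
    have := deriv_nonneg_of_frequently h1.differentiableAt (by simpa using ha') hfa'
    rw [h1.deriv] at this
    linarith
  have hab : a ≤ b := hax.trans hxb
  refine ⟨a, b, ⟨hab, ha', hb, ?_, ?_⟩, hax, hxb⟩
  · intro x hx
    refine lt_of_le_of_ne (hIcc x (Ioo_subset_Icc_self hx)) fun heq => ?_
    have hmax : IsLocalMax V x := by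
      filter_upwards [isOpen_Ioo.mem_nhds hx] with y hy
      rw [heq]
      exact hIcc y (Ioo_subset_Icc_self hy)
    have h1 := (hmin x heq hmax.deriv_eq_zero).frequently_gt_right hV
    obtain ⟨y, hy, hy'⟩ := (h1.and (Ioo_mem_nhdsGT hx.2)).exists
    exact absurd (hIcc y ⟨hx.1.le.trans hy'.1.le, hy'.2.le⟩) (not_le.2 hy)
  · rcases eq_or_lt_of_le hab with h | h
    · right
      have h0 : deriv V a = 0 := le_antisymm hda (by rw [h]; exact hdb)
      exact ⟨h, h0, ((hmin a ha' h0).nondegenerate.resolve_left fun h' => lt_irrefl _ h'.1).2.2⟩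
    · left
      refine ⟨h, lt_of_le_of_ne hda fun h0 => ?_, lt_of_le_of_ne hdb fun h0 => ?_⟩
      · have h1 := (hmin a ha' h0).frequently_gt_right hV
        obtain ⟨y, hy, hy'⟩ := (h1.and (Ioo_mem_nhdsGT h)).exists
        exact absurd (hIcc y (Ioo_subset_Icc_self hy')) (not_le.2 hy)
      · have h1 := (hmin b hb h0.symm).frequently_gt_left hV
        obtain ⟨y, hy, hy'⟩ := (h1.and (Ioo_mem_nhdsLT h)).exists
        exact absurd (hIcc y (Ioo_subset_Icc_self hy')) (not_le.2 hy)

end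

/-! ### Action and frequency near a leaf -/

section

variable {V : ℝ → ℝ} {a b e : ℝ}

lemma IsLeaf.one_div_freq (hl : IsLeaf V a b e) (hV : ContDiff ℝ 3 V) {x : ℝ} (hx : x ∈ Icc a b) :
    1 / freq V x e = leafPeriod V a b / (2 * Real.pi) := by
  obtain ⟨σ, hσ, s, hs, J, a', b', ν, L, hF, h1, h2, -⟩ := hl.hasLeafFamily hV
  have hxs : Icc a b ⊆ Icc (a - s) (b + s) := Icc_subset_Icc (by linarith) (by linarith)
  have h0 : |e - e| < σ := by simpa using hσ
  have hmem : ∀ x ∈ Icc a b, e ∈ J ∧ x ∈ Icc (a' e) (b' e) := fun x hx =>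
    h1 e h0 x (hxs hx) (hl.le_energy hx)
  obtain ⟨heJ, hx'⟩ := hmem x hx
  have hw : Icc (a' e) (b' e) = Icc a b := by
    rw [← (hF.leaf e heJ).well_eq hV hx', hl.well_eq hV hx]
  have hle := (hF.leaf e heJ).le
  have ha : a' e = a := le_antisymm (hmem a ⟨le_rfl, hl.le⟩).2.1
    ((hw.le ⟨le_rfl, hle⟩ : a' e ∈ Icc a b)).1
  have hb : b' e = b := le_antisymm ((hw.le ⟨hle, le_rfl⟩ : b' e ∈ Icc a b)).2
    (hmem b ⟨hl.le, le_rfl⟩).2.2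
  rw [hF.inv_freq hV heJ (h2 e heJ h0) hx', ha, hb]

/-- Removing the time spent in q ≤ 0 leaves twice the travel time from `b` down to `max a 0`, which
is the wall if the leaf crosses it and the inner turning point otherwise. -/
lemma IsLeaf.impactPeriod_eq (hl : IsLeaf V a b e) (hV : ContDiff ℝ 3 V) (hab : a < b)
    (hb : 0 < b) (ha : a ≠ 0) :
    impactPeriod V b e = 2 * ∫ x in Ioo (max a 0) b, 1 / Real.sqrt (2 * (e - V x)) := by
  have hbm : b ∈ Icc a b := ⟨hl.le, le_rfl⟩
  have h1 : 2 * Real.pi / freq V b e = 2 * ∫ x in Icc a b, 1 / Real.sqrt (2 * (e - V x)) := by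
    rw [hl.integral_eq_leafPeriod hV hab, ← mul_one_div, hl.one_div_freq hV hbm]
    field_simp
  rw [impactPeriod, h1, travelTime, hl.well_eq hV hbm, ← mul_sub]
  congr 1
  have hi := hl.integrableOn hV hab
  rcases lt_or_gt_of_ne ha with h | h
  · rw [max_eq_right h.le]
    have e1 : Icc a b ∩ Iic 0 = Icc a 0 := by
      ext x
      constructor
      · exact fun hx => ⟨hx.1.1, hx.2⟩
      · exact fun hx => ⟨⟨hx.1, hx.2.trans hb.le⟩, hx.2⟩
    have e2 : Icc a b = Icc a 0 ∪ Ioc 0 b := (Icc_union_Ioc_eq_Icc h.le hb.le).symm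
    rw [e1, ← integral_Ioc_eq_integral_Ioo]
    have e3 : Disjoint (Icc a 0) (Ioc 0 b) := by
      rw [Set.disjoint_left]
      exact fun x hx hx' => absurd hx.2 (not_le.2 hx'.1)
    rw [e2] at hi ⊢
    rw [setIntegral_union e3 measurableSet_Ioc (hi.mono_set subset_union_left)
      (hi.mono_set subset_union_right)]
    ring
  · rw [max_eq_left h.le]
    have e1 : Icc a b ∩ Iic 0 = ∅ := by
      ext x
      simp only [mem_inter_iff, mem_Icc, mem_Iic, mem_empty_iff_false, iff_false]
      exact fun hx => absurd (h.trans_le hx.1.1) (not_lt.2 hx.2)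
    rw [e1, setIntegral_empty, sub_zero, integral_Icc_eq_integral_Ioo]

/-- Near a leaf, the action is a function of the energy, which is differentiable with a quadratic
error in terms of the distance in phase space. -/
theorem IsLeaf.exists_action_expansion (hl : IsLeaf V a b e) (hV : ContDiff ℝ 3 V) :
    ∃ σ > 0, ∃ s > 0, ∃ A A' : ℝ → ℝ, ∃ M : ℝ,
      (∀ h, |h - e| < σ → ∀ x ∈ Icc (a - s) (b + s), V x ≤ h →
        action V x h = A h ∧ 1 / freq V x h = A' h ∧
        ∀ h', |h' - e| < σ → ∀ x' ∈ Icc (a - s) (b + s), V x' ≤ h' →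
          SameBranch V x h x' h' ∧ |A h' - A h| ≤ M * |h' - h|) ∧
      ∀ x ∈ Icc (a - s) (b + s), ∀ x' ∈ Icc (a - s) (b + s), ∀ y y' : ℝ,
        |y ^ 2 / 2 + V x - e| < σ → |y' ^ 2 / 2 + V x' - e| < σ →
        |A (y' ^ 2 / 2 + V x') - A (y ^ 2 / 2 + V x) -
          A' (y ^ 2 / 2 + V x) * (y' ^ 2 / 2 + V x' - (y ^ 2 / 2 + V x))| ≤
          M * (|x - x'| + |y - y'|) ^ 2 := by
  obtain ⟨σ, hσ, s, hs, J, a', b', ν, L, hF, h1, h2, h3⟩ := hl.hasLeafFamily hV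
  set B := Icc (a - s) (b + s) with hB
  set P : ℝ → ℝ := fun h => leafPeriod V (a' h) (b' h) with hP
  obtain ⟨m, hm⟩ : ∃ m, ∀ x ∈ B, |V x| ≤ m := by
    obtain ⟨m, hm⟩ := isCompact_Icc.exists_bound_of_continuousOn (hV.continuous.continuousOn (s := B))
    exact ⟨m, hm⟩
  obtain ⟨K, hK⟩ := (((hV.of_le (by norm_num) : ContDiff ℝ 1 V).locallyLipschitz).locallyLipschitzOn
    (s := B)).exists_lipschitzOnWith_of_compact isCompact_Icc
  set R := Real.sqrt (2 * (|e| + σ + |m|)) with hR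
  have hy : ∀ x ∈ B, ∀ y, |y ^ 2 / 2 + V x - e| < σ → |y| ≤ R := by
    intro x hx y hxy
    apply Real.abs_le_sqrt
    have e1 := (abs_lt.1 hxy).2
    have e2 := (abs_le.1 (hm x hx)).1
    have e3 := le_abs_self m
    have e4 := le_abs_self e
    linarith
  obtain ⟨L', hL'⟩ := h3 R
  -- The Lipschitz bound on the phase plane also bounds ν as a function of the energy: an energy h ≥
  -- e is realized over `a` with momentum √(2(h - e)), an energy h < e at the turning point `a' h`
  -- with momentum 0.
  obtain ⟨M₀, hM₀⟩ : ∃ M₀, ∀ h ∈ J, |h - e| < σ → |ν h - ν e| ≤ M₀ := by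
    refine ⟨|L'| * ((b + s - (a - s)) + 2 * R), fun h hh hlt => ?_⟩
    have hleaf := hF.leaf h hh
    by_cases hle : e ≤ h
    · have hnear : V a ≤ h := by rw [hl.left]; exact hle
      have haB : a ∈ B := ⟨by linarith, by linarith [hl.le]⟩
      set y := Real.sqrt (2 * (h - e)) with hyd
      have hy2 : y ^ 2 / 2 + V a = h := by
        rw [hyd, Real.sq_sqrt (by linarith), hl.left]; ring
      have e1 := hL' a haB a haB y 0 (hy a haB y (by rw [hy2]; exact hlt)) (by
        rw [abs_zero]; positivity)
      rw [hy2, hl.left] at e1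
      simp only [ne_eq, OfNat.ofNat_ne_zero, not_false_eq_true, zero_pow, zero_div, zero_add,
        sub_self, abs_zero, sub_zero] at e1
      refine e1.trans ((mul_le_mul_of_nonneg_right (le_abs_self L') (abs_nonneg _)).trans ?_)
      refine mul_le_mul_of_nonneg_left ?_ (abs_nonneg _)
      have := hy a haB y (by rw [hy2]; exact hlt)
      have : 0 ≤ R := Real.sqrt_nonneg _
      linarith [hl.le]
    · push Not at hle
      have heJ : e ∈ J := (h1 e (by simpa using hσ) a ⟨by linarith, by linarith [hl.le]⟩ hl.left.le).1
      have hsub := hF.nested h hh e heJ hle.le ⟨le_rfl, hleaf.le⟩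
      have hsub' : a' h ∈ B := by
        have h5 : IsLeaf V (a' e) (b' e) e := hF.leaf e heJ
        have h6 := (h1 e (by simpa using hσ) a ⟨by linarith, by linarith [hl.le]⟩ hl.left.le).2
        have h7 : Icc (a' e) (b' e) = Icc a b := by
          rw [← h5.well_eq hV h6, hl.well_eq hV ⟨le_rfl, hl.le⟩]
        rw [h7] at hsub
        exact ⟨by linarith [hsub.1], by linarith [hsub.2]⟩
      have haB : a ∈ B := ⟨by linarith, by linarith [hl.le]⟩
      have hR0 : 0 ≤ R := Real.sqrt_nonneg _
      have e1 := hL' (a' h) hsub' a haB 0 0 (by rw [abs_zero]; exact hR0) (by rw [abs_zero]; exact hR0)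
      rw [hleaf.left, hl.left] at e1
      simp only [ne_eq, OfNat.ofNat_ne_zero, not_false_eq_true, zero_pow, zero_div, zero_add,
        sub_self, abs_zero, add_zero] at e1
      refine e1.trans ((mul_le_mul_of_nonneg_right (le_abs_self L') (abs_nonneg _)).trans ?_)
      refine mul_le_mul_of_nonneg_left ?_ (abs_nonneg _)
      have : |a' h - a| ≤ b + s - (a - s) := by
        rw [abs_le]; constructor <;> linarith [hsub'.1, hsub'.2, haB.1, haB.2]
      linarith
  have haB : a ∈ B := ⟨by linarith, by linarith [hl.le]⟩
  have heJ : e ∈ J := (h1 e (by simpa using hσ) a haB hl.left.le).1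
  set M₁ := |P e| + L * M₀ + L * (2 * M₀) with hM₁
  -- `M₁` is the Lipschitz constant of the action in the energy. `M₂` is the quadratic constant: the
  -- error L |h' - h| |ν h' - ν h| has two factors, both Lipschitz in phase space.
  set M₂ := L * ((R + K) * |L'|) with hM₂
  have hM₀0 : 0 ≤ M₀ := (abs_nonneg _).trans (hM₀ e heJ (by simpa using hσ))
  have hL0 := hF.nonneg
  have hR0 : 0 ≤ R := Real.sqrt_nonneg _
  have hM₂0 : 0 ≤ M₂ := by positivity
  have hM₁0 : 0 ≤ M₁ := by positivity
  refine ⟨σ, hσ, s, hs, fun h => leafAction V (a' h) (b' h) h, fun h => P h / (2 * Real.pi),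
    M₁ + M₂, ?_, ?_⟩
  · intro h hh x hx hxh
    obtain ⟨hJ, hxm⟩ := h1 h hh x hx hxh
    refine ⟨(hF.leaf h hJ).action_eq hV hxm, hF.inv_freq hV hJ (h2 h hJ hh) hxm, ?_⟩
    intro h' hh' x' hx' hxh'
    obtain ⟨hJ', hxm'⟩ := h1 h' hh' x' hx' hxh'
    refine ⟨hF.sameBranch hV hJ hJ' hxm hxm', ?_⟩
    have e1 := hF.action_taylor hV hJ hJ'
    have e2 : |P h| ≤ |P e| + L * M₀ := by
      have e3 := hF.lipschitz h hJ e heJ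
      have e4 := mul_le_mul_of_nonneg_left (hM₀ h hJ hh) hL0
      have e5 : |P h| ≤ |P e| + |P h - P e| := by
        have := abs_add_le (P e) (P h - P e)
        simpa using this
      have e6 : |P h - P e| ≤ L * |ν h - ν e| := e3
      linarith
    have e3 : |ν h' - ν h| ≤ 2 * M₀ := by
      have e4 := hM₀ h hJ hh
      have e5 := hM₀ h' hJ' hh'
      have := abs_sub_le (ν h') (ν e) (ν h)
      rw [abs_sub_comm (ν e)] at this
      linarith
    have e4 : |P h / (2 * Real.pi) * (h' - h)| ≤ |P h| * |h' - h| := by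
      rw [abs_mul, abs_div, abs_of_pos (by positivity : 0 < 2 * Real.pi)]
      refine mul_le_mul_of_nonneg_right (div_le_self (abs_nonneg _) ?_) (abs_nonneg _)
      nlinarith [Real.pi_gt_three]
    have e5 : L * (|h' - h| * |ν h' - ν h|) ≤ L * (2 * M₀) * |h' - h| := by
      have := mul_le_mul_of_nonneg_left e3 (mul_nonneg hL0 (abs_nonneg (h' - h)))
      linarith
    have e6 := mul_le_mul_of_nonneg_right e2 (abs_nonneg (h' - h))
    have e7 : |leafAction V (a' h') (b' h') h' - leafAction V (a' h) (b' h) h| ≤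
        |P h / (2 * Real.pi) * (h' - h)| + L * (|h' - h| * |ν h' - ν h|) := by
      have := abs_add_le (P h / (2 * Real.pi) * (h' - h))
        (leafAction V (a' h') (b' h') h' - leafAction V (a' h) (b' h) h -
          P h / (2 * Real.pi) * (h' - h))
      rw [add_sub_cancel] at this
      linarith
    have e8 : 0 ≤ M₂ * |h' - h| := by positivity
    rw [hM₁]
    linarith
  · intro x hx x' hx' y y' hxy hxy'
    set h := y ^ 2 / 2 + V x with hh
    set h' := y' ^ 2 / 2 + V x' with hh'
    obtain ⟨hJ, -⟩ := h1 h hxy x hx (by rw [hh]; linarith [sq_nonneg y])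
    obtain ⟨hJ', -⟩ := h1 h' hxy' x' hx' (by rw [hh']; linarith [sq_nonneg y'])
    have hyR := hy x hx y hxy
    have hyR' := hy x' hx' y' hxy'
    refine (hF.action_taylor hV hJ hJ').trans ?_
    set D := |x - x'| + |y - y'| with hD
    have hD0 : 0 ≤ D := by positivity
    have e1 : |ν h' - ν h| ≤ |L'| * D := by
      rw [abs_sub_comm]
      exact (hL' x hx x' hx' y y' hyR hyR').trans
        (mul_le_mul_of_nonneg_right (le_abs_self _) hD0)
    have e2 : |h' - h| ≤ (R + K) * D := by
      have e3 : h' - h = (y + y') / 2 * (y' - y) + (V x' - V x) := by rw [hh, hh']; ring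
      have e4 := hK.dist_le_mul x' hx' x hx
      rw [Real.dist_eq, Real.dist_eq, abs_sub_comm x'] at e4
      have e5 : |(y + y') / 2| ≤ R := by
        rw [abs_div, abs_two]
        have := abs_add_le y y'
        linarith
      have e6 := mul_le_mul_of_nonneg_right e5 (abs_nonneg (y - y'))
      have e7 : |(y + y') / 2 * (y' - y)| = |(y + y') / 2| * |y - y'| := by
        rw [abs_mul, abs_sub_comm y']
      have e8 := abs_add_le ((y + y') / 2 * (y' - y)) (V x' - V x)
      have e9 : 0 ≤ (K : ℝ) * |y - y'| := by positivity
      have e10 : 0 ≤ R * |x - x'| := by positivity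
      rw [e3, hD]
      nlinarith
    calc L * (|h' - h| * |ν h' - ν h|) ≤ L * (((R + K) * D) * (|L'| * D)) := by gcongr
      _ = M₂ * D ^ 2 := by rw [hM₂]; ring
      _ ≤ (M₁ + M₂) * D ^ 2 := by
        have : 0 ≤ M₁ * D ^ 2 := by positivity
        linarith

end

end ImpactSystem

end

/-! ### Transversal hitting of a hyperplane by a smooth flow -/

noncomputable section

namespace ImpactSystem

open Set Filter Topology MeasureTheory

/-! ### Flows near a reference trajectory -/

section

variable {E : Type*} [NormedAddCommGroup E] [NormedSpace ℝ E] [FiniteDimensional ℝ E]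

/-- A flow of a `C¹` vector field near a reference trajectory, up to time `T`. -/
lemma exists_flow {X : E → E} (hX : ContDiff ℝ 1 X) {γ : ℝ → E}
    (hγ : ∀ t, HasDerivAt γ (X (γ t)) t) {T : ℝ} (hT : 0 < T) :
    ∃ r > 0, ∃ L > 0, ∃ Φ : E → ℝ → E, ∀ w ∈ Metric.ball (γ 0) r,
      Φ w 0 = w ∧ (∀ t ∈ Icc 0 T, HasDerivAt (Φ w) (X (Φ w t)) t) ∧
      (∀ t ∈ Icc 0 T, ∀ t' ∈ Icc 0 T, dist (Φ w t) (Φ w t') ≤ L * |t - t'|) ∧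
      (∀ w' ∈ Metric.ball (γ 0) r, ∀ t ∈ Icc 0 T, dist (Φ w t) (Φ w' t) ≤ L * dist w w' ∧
        dist (X (Φ w t)) (X (Φ w' t)) ≤ L * dist w w') ∧
      ∀ t ∈ Icc 0 T, Φ (γ 0) t = γ t := by
  have hγc : Continuous γ := continuous_iff_continuousAt.2 fun t => (hγ t).continuousAt
  obtain ⟨R₀, hR₀⟩ := (isCompact_Icc (a := -1) (b := T + 1)).exists_bound_of_continuousOn
    hγc.continuousOn
  set R := |R₀| with hR
  have hγR : ∀ t ∈ Icc (-1) (T + 1), ‖γ t‖ ≤ R := fun t ht => (hR₀ t ht).trans (le_abs_self _)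
  have hR0 : 0 ≤ R := abs_nonneg _
  -- Cutting off makes the field bounded and globally Lipschitz, so solutions exist on the whole
  -- interval, while nothing changes within distance 1 of the reference curve.
  let χ : ContDiffBump (0 : E) := ⟨R + 1, R + 2, by linarith, by linarith⟩
  set Y : E → E := fun x => χ x • X x with hY
  have hYd : ContDiff ℝ 1 Y := χ.contDiff.smul hX
  have hYs : HasCompactSupport Y := χ.hasCompactSupport.smul_right
  have hYX : ∀ x : E, ‖x‖ ≤ R + 1 → Y x = X x := fun x hx => by
    have : χ x = 1 := χ.one_of_mem_closedBall (by simpa using hx)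
    rw [hY]; simp only; rw [this, one_smul]
  obtain ⟨K, hK⟩ : ∃ K, LipschitzWith K Y := ⟨_, hYd.lipschitzWith_of_hasCompactSupport hYs one_ne_zero |>.choose_spec⟩
  obtain ⟨M₀, hM₀⟩ := hYs.exists_bound_of_continuous hYd.continuous
  set M : NNReal := Real.toNNReal |M₀| with hM
  have hMcoe : (M : ℝ) = |M₀| := Real.coe_toNNReal _ (abs_nonneg _)
  have hYM : ∀ x, ‖Y x‖ ≤ M := fun x => by rw [hMcoe]; exact (hM₀ x).trans (le_abs_self _)
  have h0 : (0 : ℝ) ∈ Icc (-1) (T + 1) := ⟨by norm_num, by linarith⟩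
  -- The time interval exceeds [0, T] on both sides, which gives two-sided derivatives at 0 and T.
  -- The radius is the largest distance travelled plus the initial displacement 1.
  have hPL : IsPicardLindelof (fun _ => Y) (⟨0, h0⟩ : Icc (-1 : ℝ) (T + 1)) (γ 0)
      (M * Real.toNNReal (T + 1) + 1) 1 M K := by
    refine ⟨fun t _ => hK.lipschitzOnWith, fun x _ => continuousOn_const, fun t _ x _ => hYM x, ?_⟩
    simp only [sub_zero, zero_sub, neg_neg, NNReal.coe_add, NNReal.coe_mul, NNReal.coe_one,
      add_sub_cancel_right]
    rw [max_eq_left (by linarith), Real.coe_toNNReal (T + 1) (by linarith)]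
  obtain ⟨Φ, hΦ, L₀, hL₀⟩ := hPL.exists_forall_mem_closedBall_eq_hasDerivWithinAt_lipschitzOnWith
  simp only [NNReal.coe_one] at hΦ hL₀
  have hIcc : ∀ t ∈ Icc 0 T, t ∈ Icc (-1) (T + 1) := fun t ht =>
    ⟨by linarith [ht.1], by linarith [ht.2]⟩
  have hnhds : ∀ t ∈ Icc 0 T, Icc (-1) (T + 1) ∈ 𝓝 t := fun t ht =>
    Icc_mem_nhds (by linarith [ht.1]) (by linarith [ht.2])
  have hderY : ∀ w ∈ Metric.closedBall (γ 0) 1, ∀ t ∈ Icc 0 T,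
      HasDerivAt (Φ w) (Y (Φ w t)) t := fun w hw t ht =>
    ((hΦ w hw).2 t (hIcc t ht)).hasDerivAt (hnhds t ht)
  have hbase : ∀ t ∈ Icc 0 T, Φ (γ 0) t = γ t := by
    have hw : γ 0 ∈ Metric.closedBall (γ 0) 1 := Metric.mem_closedBall_self zero_le_one
    refine ODE_solution_unique_of_mem_Icc_right (v := fun _ => Y) (s := fun _ => univ) (K := K)
      (fun t _ => hK.lipschitzOnWith)
      (fun t ht => (hderY _ hw t ht).continuousAt.continuousWithinAt)
      (fun t ht => (hderY _ hw t (Ico_subset_Icc_self ht)).hasDerivWithinAt)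
      (fun _ _ => mem_univ _) hγc.continuousOn ?_ (fun _ _ => mem_univ _) (hΦ _ hw).1
    intro t ht
    rw [hYX _ (by linarith [hγR t (hIcc t (Ico_subset_Icc_self ht))])]
    exact (hγ t).hasDerivWithinAt
  set L : ℝ := L₀ + K * L₀ + M + 1 with hL
  have hL0 : 0 < L := by positivity
  have hKL : (0 : ℝ) ≤ K * L₀ := by positivity
  -- The bound `1 / L` keeps solutions within distance 1 of the reference curve, where the cut-off
  -- field is the original one.
  have hr : 0 < min 1 (1 / L) := by positivity
  have hball : ∀ w ∈ Metric.ball (γ 0) (min 1 (1 / L)), w ∈ Metric.closedBall (γ 0) 1 :=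
    fun w hw => Metric.ball_subset_closedBall (Metric.ball_subset_ball (min_le_left _ _) hw)
  have hlip : ∀ w ∈ Metric.closedBall (γ 0) 1, ∀ w' ∈ Metric.closedBall (γ 0) 1, ∀ t ∈ Icc 0 T,
      dist (Φ w t) (Φ w' t) ≤ L₀ * dist w w' := fun w hw w' hw' t ht =>
    (hL₀ t (hIcc t ht)).dist_le_mul w hw w' hw'
  have hYΦ : ∀ w ∈ Metric.ball (γ 0) (min 1 (1 / L)), ∀ t ∈ Icc 0 T, Y (Φ w t) = X (Φ w t) := by
    intro w hw t ht
    apply hYX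
    have h1 := hlip w (hball w hw) (γ 0) (Metric.mem_closedBall_self zero_le_one) t ht
    rw [hbase t ht, dist_eq_norm] at h1
    have h2 : dist w (γ 0) < 1 / L := lt_of_lt_of_le hw (min_le_right _ _)
    have h3 : (L₀ : ℝ) * dist w (γ 0) ≤ 1 := by
      have : (L₀ : ℝ) * dist w (γ 0) ≤ L * (1 / L) := by
        apply mul_le_mul _ h2.le dist_nonneg hL0.le
        have : (0 : ℝ) ≤ M := M.2
        linarith
      rwa [mul_one_div_cancel hL0.ne'] at this
    have h4 := norm_le_norm_add_norm_sub' (Φ w t) (γ t)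
    linarith [hγR t (hIcc t ht)]
  refine ⟨min 1 (1 / L), hr, L, hL0, Φ, fun w hw => ⟨(hΦ w (hball w hw)).1, ?_, ?_, ?_, hbase⟩⟩
  · intro t ht
    rw [← hYΦ w hw t ht]
    exact hderY w (hball w hw) t ht
  · intro t ht t' ht'
    have := Convex.norm_image_sub_le_of_norm_hasDerivWithin_le
      (fun s hs => (hderY w (hball w hw) s hs).hasDerivWithinAt) (fun s _ => hYM _)
      (convex_Icc 0 T) ht' ht
    rw [← dist_eq_norm, Real.norm_eq_abs] at this
    refine this.trans (mul_le_mul_of_nonneg_right ?_ (abs_nonneg _))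
    have : (0 : ℝ) ≤ L₀ := L₀.2
    linarith
  · intro w' hw' t ht
    have h1 := hlip w (hball w hw) w' (hball w' hw') t ht
    have hd : 0 ≤ dist w w' := dist_nonneg
    constructor
    · refine h1.trans (mul_le_mul_of_nonneg_right ?_ hd)
      have : (0 : ℝ) ≤ M := M.2
      linarith
    · rw [← hYΦ w hw t ht, ← hYΦ w' hw' t ht]
      refine (hK.dist_le_mul _ _).trans ?_
      calc (K : ℝ) * dist (Φ w t) (Φ w' t) ≤ K * (L₀ * dist w w') := by gcongr
        _ = K * L₀ * dist w w' := by ring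
        _ ≤ L * dist w w' := by
          refine mul_le_mul_of_nonneg_right ?_ hd
          have : (0 : ℝ) ≤ M := M.2
          have : (0 : ℝ) ≤ L₀ := L₀.2
          linarith

end

/-! ### First zeros of families of functions -/

section

variable {E : Type*} [PseudoMetricSpace E] {w₀ : E} {r L T : ℝ} {u u' : E → ℝ → ℝ}

/-- A family of functions on `[0, T]` that is Lipschitz in the parameter together with the time
derivative. -/
structure IsLipschitzFamily (w₀ : E) (r L T : ℝ) (u u' : E → ℝ → ℝ) : Prop where
  r_pos : 0 < r
  L_pos : 0 < L
  hasDerivAt : ∀ w ∈ Metric.ball w₀ r, ∀ t ∈ Icc 0 T, HasDerivAt (u w) (u' w t) t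
  lipschitz : ∀ w ∈ Metric.ball w₀ r, ∀ w' ∈ Metric.ball w₀ r, ∀ t ∈ Icc 0 T,
    |u w t - u w' t| ≤ L * dist w w' ∧ |u' w t - u' w' t| ≤ L * dist w w'
  continuousOn : ContinuousOn (u' w₀) (Icc 0 T)

/-- The function starts with a positive value, or at zero with a positive derivative. -/
def StartsPositive (u u' : ℝ → ℝ) : Prop := 0 < u 0 ∨ (u 0 = 0 ∧ 0 < u' 0)

/-- Away from 0 this is compactness. If the reference function starts at zero, its positive initial
slope persists, but positivity right after 0 then requires that the perturbed function also starts
exactly at zero; hence the compatibility condition, which recurs for every leg. -/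
lemma IsLipschitzFamily.exists_pos (h : IsLipschitzFamily w₀ r L T u u')
    (hs : StartsPositive (u w₀) (u' w₀)) {τ : ℝ} (hτ : 0 < τ) (hτT : τ ≤ T)
    (hpos : ∀ t ∈ Ioc 0 τ, 0 < u w₀ t) :
    ∃ r' > 0, r' ≤ r ∧ ∀ w ∈ Metric.ball w₀ r', (u w₀ 0 = 0 → u w 0 = 0) →
      ∀ t ∈ Ioc 0 τ, 0 < u w t := by
  have hw₀ : w₀ ∈ Metric.ball w₀ r := Metric.mem_ball_self h.r_pos
  have hL := h.L_pos
  have hr := h.r_pos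
  have hcont : ContinuousOn (u w₀) (Icc 0 T) := fun t ht =>
    (h.hasDerivAt w₀ hw₀ t ht).continuousAt.continuousWithinAt
  have key : ∀ s ∈ Icc 0 τ, (∀ t ∈ Icc s τ, 0 < u w₀ t) → ∃ r' > 0, r' ≤ r ∧
      ∀ w ∈ Metric.ball w₀ r', ∀ t ∈ Icc s τ, 0 < u w t := by
    intro s hs hp
    obtain ⟨z, hz, hzmin⟩ := isCompact_Icc.exists_isMinOn (nonempty_Icc.2 hs.2)
      (hcont.mono (Icc_subset_Icc hs.1 hτT))
    have hm := hp z hz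
    refine ⟨min r (u w₀ z / L), lt_min hr (by positivity), min_le_left _ _, fun w hw t ht => ?_⟩
    have h1 := (h.lipschitz w (Metric.ball_subset_ball (min_le_left _ _) hw) w₀ hw₀ t
      ⟨hs.1.trans ht.1, ht.2.trans hτT⟩).1
    have h2 : u w₀ z ≤ u w₀ t := hzmin ht
    have h3 : dist w w₀ < u w₀ z / L := lt_of_lt_of_le hw (min_le_right _ _)
    rw [lt_div_iff₀ hL] at h3
    have h4 := (abs_le.1 h1).1
    linarith
  rcases hs with h0 | ⟨h0, h0'⟩
  · obtain ⟨r', hr', hle, H⟩ := key 0 ⟨le_rfl, hτ.le⟩ fun t ht => by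
      rcases eq_or_lt_of_le ht.1 with h | h
      · rwa [← h]
      · exact hpos t ⟨h, ht.2⟩
    exact ⟨r', hr', hle, fun w hw _ t ht => H w hw t (Ioc_subset_Icc_self ht)⟩
  · have h0T : (0 : ℝ) ∈ Icc 0 T := ⟨le_rfl, hτ.le.trans hτT⟩
    have h1 : ∀ᶠ t in 𝓝[Icc 0 T] 0, u' w₀ 0 / 2 < u' w₀ t :=
      (h.continuousOn 0 h0T).eventually (lt_mem_nhds (by linarith))
    obtain ⟨s₀, hs₀, hs₀'⟩ := Metric.mem_nhdsWithin_iff.1 h1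
    set s := min (s₀ / 2) τ with hs
    have hs0 : 0 < s := by positivity
    have hsτ : s ≤ τ := min_le_right _ _
    have hss₀ : s ≤ s₀ / 2 := min_le_left _ _
    have hder : ∀ t ∈ Icc 0 s, u' w₀ 0 / 2 < u' w₀ t := fun t ht => by
      refine hs₀' ⟨?_, ht.1, ht.2.trans (hsτ.trans hτT)⟩
      rw [Metric.mem_ball, Real.dist_eq, sub_zero, abs_of_nonneg ht.1]
      linarith [ht.2]
    obtain ⟨r', hr', hle, H⟩ := key s ⟨hs0.le, hsτ⟩ fun t ht => hpos t ⟨hs0.trans_le ht.1, ht.2⟩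
    refine ⟨min r' (u' w₀ 0 / (2 * L)), lt_min hr' (by positivity), (min_le_left _ _).trans hle,
      fun w hw hw0 t ht => ?_⟩
    have hw' : w ∈ Metric.ball w₀ r' := Metric.ball_subset_ball (min_le_left _ _) hw
    have hwr : w ∈ Metric.ball w₀ r := Metric.ball_subset_ball hle hw'
    rcases le_total s t with hst | hst
    · exact H w hw' t ⟨hst, ht.2⟩
    · have hIcc : Icc 0 t ⊆ Icc 0 T := Icc_subset_Icc_right (ht.2.trans hτT)
      have hmono : StrictMonoOn (u w) (Icc 0 t) := by
        refine strictMonoOn_of_deriv_pos (convex_Icc _ _) (fun z hz =>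
          (h.hasDerivAt w hwr z (hIcc hz)).continuousAt.continuousWithinAt) fun z hz => ?_
        have hz' := interior_subset hz
        rw [(h.hasDerivAt w hwr z (hIcc hz')).deriv]
        have h2 := (abs_le.1 (h.lipschitz w hwr w₀ hw₀ z (hIcc hz')).2).1
        have h3 : dist w w₀ < u' w₀ 0 / (2 * L) := lt_of_lt_of_le hw (min_le_right _ _)
        rw [lt_div_iff₀ (by positivity)] at h3
        have := hder z ⟨hz'.1, hz'.2.trans hst⟩
        linarith
      have := hmono ⟨le_rfl, ht.1.le⟩ ⟨ht.1.le, le_rfl⟩ ht.1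
      rwa [hw0 h0] at this

/-- In a window around τ₀ all nearby functions decrease with slope at most -d/4, so each has one
zero there, and earlier zeros are excluded by positivity. Evaluating one function at the zero of
another and dividing by the slope gives the Lipschitz constant 4L/d. -/
lemma IsLipschitzFamily.exists_first_zero (h : IsLipschitzFamily w₀ r L T u u')
    (hs : StartsPositive (u w₀) (u' w₀)) {τ₀ : ℝ} (hτ : 0 < τ₀) (hτT : τ₀ < T)
    (hpos : ∀ t ∈ Ioo 0 τ₀, 0 < u w₀ t) (h0 : u w₀ τ₀ = 0) (h0' : u' w₀ τ₀ < 0) {η₀ : ℝ}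
    (hη₀ : 0 < η₀) :
    ∃ r' > 0, r' ≤ r ∧ ∃ L' > 0, ∃ τ : E → ℝ, τ w₀ = τ₀ ∧
      ∀ w ∈ Metric.ball w₀ r', (u w₀ 0 = 0 → u w 0 = 0) →
        0 < τ w ∧ |τ w - τ₀| < η₀ ∧ τ w ≤ T ∧ (∀ t ∈ Ioo 0 (τ w), 0 < u w t) ∧ u w (τ w) = 0 ∧
        u' w (τ w) < 0 ∧
        ∀ w' ∈ Metric.ball w₀ r', (u w₀ 0 = 0 → u w' 0 = 0) → |τ w - τ w'| ≤ L' * dist w w' := by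
  have hr := h.r_pos
  have hL := h.L_pos
  have hw₀ : w₀ ∈ Metric.ball w₀ r := Metric.mem_ball_self hr
  set d := -u' w₀ τ₀ with hd
  have hd0 : 0 < d := by linarith
  have h1 : ∀ᶠ t in 𝓝[Icc 0 T] τ₀, u' w₀ t < -(d / 2) :=
    (h.continuousOn τ₀ ⟨hτ.le, hτT.le⟩).eventually (gt_mem_nhds (by linarith))
  obtain ⟨s₀, hs₀, hs₀'⟩ := Metric.mem_nhdsWithin_iff.1 h1
  set η := min (min (s₀ / 2) (η₀ / 2)) (min (τ₀ / 2) (T - τ₀)) with hη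
  have hη0 : 0 < η := by
    have : 0 < T - τ₀ := by linarith
    positivity
  have hη1 : η ≤ s₀ / 2 := (min_le_left _ _).trans (min_le_left _ _)
  have hη2 : η ≤ η₀ / 2 := (min_le_left _ _).trans (min_le_right _ _)
  have hη3 : η ≤ τ₀ / 2 := (min_le_right _ _).trans (min_le_left _ _)
  have hη4 : η ≤ T - τ₀ := (min_le_right _ _).trans (min_le_right _ _)
  set I := Icc (τ₀ - η) (τ₀ + η) with hI
  have hIT : I ⊆ Icc 0 T := Icc_subset_Icc (by linarith) (by linarith)
  have hder₀ : ∀ t ∈ I, u' w₀ t < -(d / 2) := fun t ht => by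
    refine hs₀' ⟨?_, hIT ht⟩
    rw [Metric.mem_ball, Real.dist_eq, abs_lt]
    constructor <;> linarith [ht.1, ht.2]
  obtain ⟨r₁, hr₁, hr₁r, H₁⟩ := h.exists_pos hs (τ := τ₀ - η) (by linarith) (by linarith)
    fun t ht => hpos t ⟨ht.1, by linarith [ht.2]⟩
  have hdec : ∀ w ∈ Metric.ball w₀ r, (∀ t ∈ I, u' w t < -(d / 4)) →
      ∀ t ∈ I, ∀ t' ∈ I, t ≤ t' → d / 4 * (t' - t) ≤ u w t - u w t' := by
    intro w hw hw' t ht t' ht' htt'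
    have := (convex_Icc (τ₀ - η) (τ₀ + η)).image_sub_le_mul_sub_of_deriv_le (f := u w) (C := -(d / 4))
      (fun z hz => (h.hasDerivAt w hw z (hIT hz)).continuousAt.continuousWithinAt)
      (fun z hz => (h.hasDerivAt w hw z (hIT (interior_subset hz))).differentiableAt.differentiableWithinAt)
      (fun z hz => by
        rw [(h.hasDerivAt w hw z (hIT (interior_subset hz))).deriv]
        exact (hw' z (interior_subset hz)).le) t ht t' ht' htt'
    linarith
  -- The second bound costs at most `d / 4` of the slope; the third keeps the values at `τ₀ ± η` of
  -- opposite sign.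
  set r' := min r₁ (min (d / (4 * L)) (d / 4 * η / L)) with hr'
  have hr'0 : 0 < r' := by positivity
  have hr'1 : r' ≤ r₁ := min_le_left _ _
  have hr'2 : r' ≤ d / (4 * L) := (min_le_right _ _).trans (min_le_left _ _)
  have hr'3 : r' ≤ d / 4 * η / L := (min_le_right _ _).trans (min_le_right _ _)
  have hball : ∀ w ∈ Metric.ball w₀ r', w ∈ Metric.ball w₀ r := fun w hw =>
    Metric.ball_subset_ball (hr'1.trans hr₁r) hw
  have hder : ∀ w ∈ Metric.ball w₀ r', ∀ t ∈ I, u' w t < -(d / 4) := by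
    intro w hw t ht
    have h2 := (abs_le.1 (h.lipschitz w (hball w hw) w₀ hw₀ t (hIT ht)).2).2
    have h3 : dist w w₀ < d / (4 * L) := lt_of_lt_of_le hw hr'2
    rw [lt_div_iff₀ (by positivity)] at h3
    have := hder₀ t ht
    linarith
  have hτI : τ₀ ∈ I := ⟨by linarith, by linarith⟩
  have hex : ∀ w ∈ Metric.ball w₀ r', ∃ t ∈ I, u w t = 0 := by
    intro w hw
    have hc : ContinuousOn (u w) I := fun t ht =>
      (h.hasDerivAt w (hball w hw) t (hIT ht)).continuousAt.continuousWithinAt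
    have h3 : dist w w₀ < d / 4 * η / L := lt_of_lt_of_le hw hr'3
    rw [lt_div_iff₀ hL] at h3
    have hd₀ := hdec w₀ hw₀ fun t ht => (hder₀ t ht).trans (by linarith)
    have e1 := hd₀ (τ₀ - η) ⟨le_rfl, by linarith⟩ τ₀ hτI (by linarith)
    have e2 := hd₀ τ₀ hτI (τ₀ + η) ⟨by linarith, le_rfl⟩ (by linarith)
    have e3 := (abs_le.1 (h.lipschitz w (hball w hw) w₀ hw₀ (τ₀ - η) (hIT ⟨le_rfl, by linarith⟩)).1).1
    have e4 := (abs_le.1 (h.lipschitz w (hball w hw) w₀ hw₀ (τ₀ + η) (hIT ⟨by linarith, le_rfl⟩)).1).2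
    exact intermediate_value_Icc' (by linarith) hc ⟨by linarith, by linarith⟩
  choose! τ hτI' hτ0 using hex
  have huniq : ∀ w ∈ Metric.ball w₀ r', ∀ t ∈ I, d / 4 * |t - τ w| ≤ |u w t| := by
    intro w hw t ht
    have hd := hdec w (hball w hw) (hder w hw)
    rcases le_total t (τ w) with hle | hle
    · have := hd t ht (τ w) (hτI' w hw) hle
      rw [hτ0 w hw, sub_zero] at this
      rw [abs_of_nonpos (by linarith)]
      have := le_abs_self (u w t)
      linarith
    · have := hd (τ w) (hτI' w hw) t ht hle
      rw [hτ0 w hw, zero_sub] at this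
      rw [abs_of_nonneg (by linarith)]
      have := neg_le_abs (u w t)
      linarith
  have hw₀' : w₀ ∈ Metric.ball w₀ r' := Metric.mem_ball_self hr'0
  refine ⟨r', hr'0, hr'1.trans hr₁r, 4 * L / d, by positivity, τ, ?_, fun w hw hw0 => ?_⟩
  · have := huniq w₀ hw₀' τ₀ hτI
    rw [h0, abs_zero] at this
    have h5 : |τ₀ - τ w₀| ≤ 0 := by
      by_contra hlt
      push Not at hlt
      nlinarith
    have := abs_eq_zero.1 (le_antisymm h5 (abs_nonneg _))
    linarith
  · have hτw := hτI' w hw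
    refine ⟨by linarith [hτw.1], ?_, (hIT hτw).2, ?_, hτ0 w hw, ?_, ?_⟩
    · rw [abs_lt]; constructor <;> linarith [hτw.1, hτw.2]
    · intro t ht
      rcases le_total t (τ₀ - η) with hle | hle
      · exact H₁ w (Metric.ball_subset_ball hr'1 hw) hw0 t ⟨ht.1, hle⟩
      · have := hdec w (hball w hw) (hder w hw) t ⟨hle, ht.2.le.trans hτw.2⟩ (τ w) hτw ht.2.le
        rw [hτ0 w hw] at this
        have := mul_pos (by linarith : 0 < d / 4) (sub_pos.2 ht.2)
        linarith
    · have := hder w hw (τ w) hτw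
      linarith
    · intro w' hw' _
      have e1 := huniq w hw (τ w') (hτI' w' hw')
      have e2 := (h.lipschitz w (hball w hw) w' (hball w' hw') (τ w') (hIT (hτI' w' hw'))).1
      rw [hτ0 w' hw', sub_zero] at e2
      rw [abs_sub_comm, div_mul_eq_mul_div, le_div_iff₀ hd0]
      linarith

end

/-! ### Legs of a trajectory -/

section

variable {E : Type*} [NormedAddCommGroup E] [NormedSpace ℝ E] [FiniteDimensional ℝ E]

/-- A reference trajectory on which `σ` vanishes for the first time, transversally, at time `τ₀`,
while `θ` stays positive. -/
structure IsReferenceLeg (X : E → E) (σ θ : E →L[ℝ] ℝ) (γ : ℝ → E) (τ₀ : ℝ) : Prop where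
  hasDerivAt : ∀ t, HasDerivAt γ (X (γ t)) t
  pos : 0 < τ₀
  start_event : StartsPositive (fun t => σ (γ t)) (fun t => σ (X (γ t)))
  start_guard : StartsPositive (fun t => θ (γ t)) (fun t => θ (X (γ t)))
  event_pos : ∀ t ∈ Ioo 0 τ₀, 0 < σ (γ t)
  guard_pos : ∀ t ∈ Ioc 0 τ₀, 0 < θ (γ t)
  event_eq : σ (γ τ₀) = 0
  transversal : σ (X (γ τ₀)) < 0

/-- `z` is a trajectory of `X` on `[0, τ]` that starts at `w` on which `σ` vanishes for the first
time, transversally, at time `τ`, while `θ` stays positive. -/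
structure IsLeg (X : E → E) (σ θ : E →L[ℝ] ℝ) (w : E) (z : ℝ → E) (τ : ℝ) : Prop where
  hasDerivAt : ∀ t ∈ Icc 0 τ, HasDerivAt z (X (z t)) t
  start : z 0 = w
  pos : 0 < τ
  event_pos : ∀ t ∈ Ioo 0 τ, 0 < σ (z t)
  guard_pos : ∀ t ∈ Ioc 0 τ, 0 < θ (z t)
  event_eq : σ (z τ) = 0
  transversal : σ (X (z τ)) < 0

omit [FiniteDimensional ℝ E] in
lemma IsReferenceLeg.isLeg {X : E → E} {σ θ : E →L[ℝ] ℝ} {γ : ℝ → E} {τ₀ : ℝ}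
    (h : IsReferenceLeg X σ θ γ τ₀) : IsLeg X σ θ (γ 0) γ τ₀ :=
  ⟨fun t _ => h.hasDerivAt t, rfl, h.pos, h.event_pos, h.guard_pos, h.event_eq, h.transversal⟩

/-- Trajectories starting near a reference leg are legs, with end points that depend on the
starting point in a Lipschitz way. -/
theorem IsReferenceLeg.exists_legs {X : E → E} (hX : ContDiff ℝ 1 X) {σ θ : E →L[ℝ] ℝ}
    {γ : ℝ → E} {τ₀ : ℝ} (h : IsReferenceLeg X σ θ γ τ₀) :
    ∃ r > 0, ∃ L > 0, ∃ (Φ : E → ℝ → E) (τ : E → ℝ), Φ (γ 0) (τ (γ 0)) = γ τ₀ ∧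
      ∀ w ∈ Metric.ball (γ 0) r, (σ (γ 0) = 0 → σ w = 0) → (θ (γ 0) = 0 → θ w = 0) →
        IsLeg X σ θ w (Φ w) (τ w) ∧
        ∀ w' ∈ Metric.ball (γ 0) r, (σ (γ 0) = 0 → σ w' = 0) → (θ (γ 0) = 0 → θ w' = 0) →
          dist (Φ w (τ w)) (Φ w' (τ w')) ≤ L * dist w w' := by
  have hτ := h.pos
  set T := τ₀ + 1 with hT
  obtain ⟨r, hr, L, hL, Φ, hΦ⟩ := exists_flow hX h.hasDerivAt (T := T) (by linarith)
  have hγc : Continuous γ := continuous_iff_continuousAt.2 fun t => (h.hasDerivAt t).continuousAt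
  have hb : γ 0 ∈ Metric.ball (γ 0) r := Metric.mem_ball_self hr
  have hbase : ∀ t ∈ Icc 0 T, Φ (γ 0) t = γ t := (hΦ _ hb).2.2.2.2
  have h0T : (0 : ℝ) ∈ Icc 0 T := ⟨le_rfl, by linarith⟩
  have hfam : ∀ ψ : E →L[ℝ] ℝ, IsLipschitzFamily (γ 0) r ((‖ψ‖ + 1) * L) T
      (fun w t => ψ (Φ w t)) (fun w t => ψ (X (Φ w t))) := by
    intro ψ
    refine ⟨hr, by positivity, fun w hw t ht => ?_, fun w hw w' hw' t ht => ?_, ?_⟩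
    · exact ψ.hasFDerivAt.comp_hasDerivAt t ((hΦ w hw).2.1 t ht)
    · obtain ⟨e1, e2⟩ := (hΦ w hw).2.2.2.1 w' hw' t ht
      have hd : 0 ≤ L * dist w w' := by positivity
      have key : ∀ x y : E, dist x y ≤ L * dist w w' →
          |ψ x - ψ y| ≤ (‖ψ‖ + 1) * L * dist w w' := by
        intro x y hxy
        rw [← map_sub, ← Real.norm_eq_abs]
        refine (ψ.le_opNorm _).trans ?_
        rw [dist_eq_norm] at hxy
        have := mul_le_mul_of_nonneg_left hxy (norm_nonneg ψ)
        linarith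
      exact ⟨key _ _ e1, key _ _ e2⟩
    · refine ContinuousOn.congr (f := fun t => ψ (X (γ t))) ?_ fun t ht => by
        simp only [hbase t ht]
      exact (ψ.continuous.comp (hX.continuous.comp hγc)).continuousOn
  have hstart : ∀ ψ : E →L[ℝ] ℝ, StartsPositive (fun t => ψ (γ t)) (fun t => ψ (X (γ t))) →
      StartsPositive (fun t => ψ (Φ (γ 0) t)) (fun t => ψ (X (Φ (γ 0) t))) := by
    intro ψ hψ
    simpa only [StartsPositive, hbase 0 h0T] using hψ
  have hΦ0 : ∀ w ∈ Metric.ball (γ 0) r, Φ w 0 = w := fun w hw => (hΦ w hw).1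
  -- Perturbed legs may end later than `τ₀`, so the guard must stay positive slightly beyond it.
  obtain ⟨η, hη, hη'⟩ : ∃ η > 0, ∀ t ∈ Ioc 0 (τ₀ + η), 0 < θ (γ t) := by
    have h1 : ∀ᶠ t in 𝓝 τ₀, 0 < θ (γ t) :=
      ((θ.continuous.comp hγc).tendsto τ₀).eventually (lt_mem_nhds (h.guard_pos τ₀ ⟨hτ, le_rfl⟩))
    obtain ⟨η, hη, hη'⟩ := Metric.eventually_nhds_iff.1 h1
    refine ⟨η / 2, by positivity, fun t ht => ?_⟩
    rcases le_total t τ₀ with hle | hle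
    · exact h.guard_pos t ⟨ht.1, hle⟩
    · apply hη'
      rw [Real.dist_eq, abs_of_nonneg (by linarith)]
      linarith [ht.2]
  have hη1 : 0 < min η 1 := by positivity
  obtain ⟨r₁, hr₁, hr₁r, L', hL', τ, hτ0, Hτ⟩ := (hfam σ).exists_first_zero (hstart σ h.start_event)
    hτ (by linarith)
    (fun t ht => by simp only [hbase t ⟨ht.1.le, by linarith [ht.2]⟩]; exact h.event_pos t ht)
    (by simp only [hbase τ₀ ⟨hτ.le, by linarith⟩]; exact h.event_eq)
    (by simp only [hbase τ₀ ⟨hτ.le, by linarith⟩]; exact h.transversal) hη1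
  obtain ⟨r₂, hr₂, hr₂r, Hθ⟩ := (hfam θ).exists_pos (hstart θ h.start_guard)
    (τ := τ₀ + min η 1) (by linarith) (by linarith [min_le_right η 1])
    (fun t ht => by
      simp only [hbase t ⟨ht.1.le, by linarith [ht.2, min_le_right η 1]⟩]
      exact hη' t ⟨ht.1, by linarith [ht.2, min_le_left η 1]⟩)
  set ρ := min r₁ r₂ with hρ
  have hρ1 : ∀ w ∈ Metric.ball (γ 0) ρ, w ∈ Metric.ball (γ 0) r₁ := fun w hw =>
    Metric.ball_subset_ball (min_le_left _ _) hw
  have hρ2 : ∀ w ∈ Metric.ball (γ 0) ρ, w ∈ Metric.ball (γ 0) r₂ := fun w hw =>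
    Metric.ball_subset_ball (min_le_right _ _) hw
  have hρr : ∀ w ∈ Metric.ball (γ 0) ρ, w ∈ Metric.ball (γ 0) r := fun w hw =>
    Metric.ball_subset_ball hr₁r (hρ1 w hw)
  have hstart' : ∀ ψ : E →L[ℝ] ℝ, ∀ w ∈ Metric.ball (γ 0) ρ, (ψ (γ 0) = 0 → ψ w = 0) →
      (ψ (Φ (γ 0) 0) = 0 → ψ (Φ w 0) = 0) := fun ψ w hw hψ => by
    rwa [hΦ0 w (hρr w hw), hΦ0 _ hb]
  -- `L * L'` accounts for the shift of the end time, `L` for the displacement at equal times.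
  refine ⟨ρ, by positivity, L * L' + L, by positivity, Φ, τ,
    by rw [hτ0, hbase τ₀ ⟨hτ.le, by linarith⟩], fun w hw hσw hθw => ?_⟩
  obtain ⟨h1, h2, h3, h4, h5, h6, h7⟩ := Hτ w (hρ1 w hw) (hstart' σ w hw hσw)
  refine ⟨⟨fun t ht => (hΦ w (hρr w hw)).2.1 t ⟨ht.1, ht.2.trans h3⟩, hΦ0 w (hρr w hw), h1, h4,
    fun t ht => ?_, h5, h6⟩, fun w' hw' hσw' hθw' => ?_⟩
  · refine Hθ w (hρ2 w hw) (hstart' θ w hw hθw) t ⟨ht.1, ht.2.trans ?_⟩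
    linarith [(abs_lt.1 h2).2]
  · obtain ⟨k1, -, k3, -⟩ := Hτ w' (hρ1 w' hw') (hstart' σ w' hw' hσw')
    have e1 := (hΦ w (hρr w hw)).2.2.1 (τ w) ⟨h1.le, h3⟩ (τ w') ⟨k1.le, k3⟩
    have e2 := ((hΦ w (hρr w hw)).2.2.2.1 w' (hρr w' hw') (τ w') ⟨k1.le, k3⟩).1
    have e3 := h7 w' (hρ1 w' hw') (hstart' σ w' hw' hσw')
    have e4 := mul_le_mul_of_nonneg_left e3 hL.le
    have := dist_triangle (Φ w (τ w)) (Φ w (τ w')) (Φ w' (τ w'))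
    linarith

end

end ImpactSystem

end

/-! ### Uniqueness and construction of impact motions -/

noncomputable section

namespace ImpactSystem

open Set Filter Topology MeasureTheory

/-! ### Impact motions with a perpendicular wall -/

lemma dot_one_zero (q : ℝ × ℝ) : dot (1, 0) q = q.1 := by simp [dot]

lemma reflect_one_zero (p : ℝ × ℝ) : reflect (1, 0) p = (-p.1, p.2) := by
  ext
  · simp [reflect, dot]; ring
  · simp [reflect, dot]

/-- The Hamiltonian vector field of `energy U`. -/
def hamField (U : ℝ × ℝ → ℝ) (z : (ℝ × ℝ) × (ℝ × ℝ)) : (ℝ × ℝ) × (ℝ × ℝ) := (z.2, -grad U z.1)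

lemma contDiff_grad {U : ℝ × ℝ → ℝ} (hU : ContDiff ℝ 2 U) : ContDiff ℝ 1 (grad U) := by
  have h : ContDiff ℝ 1 (fderiv ℝ U) := hU.fderiv_right (by norm_num)
  exact (h.clm_apply contDiff_const).prodMk (h.clm_apply contDiff_const)

lemma contDiff_hamField {U : ℝ × ℝ → ℝ} (hU : ContDiff ℝ 2 U) : ContDiff ℝ 1 (hamField U) :=
  contDiff_snd.prodMk ((contDiff_grad hU).comp contDiff_fst).neg

section Unique

variable {U : ℝ × ℝ → ℝ} {T T' : ℝ} {q p q' p' : ℝ → ℝ × ℝ}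

lemma IsImpactMotion.exists_pos_right (h : IsImpactMotion U (1, 0) T q p) {t : ℝ}
    (ht : t ∈ Ico 0 T) (hp : 0 < (q t).1 ∨ 0 < (p t).1) : ∀ᶠ s in 𝓝[>] t, 0 < (q s).1 := by
  have h0 : 0 ≤ (q t).1 := by
    simpa [dot_one_zero] using h.inside t ⟨ht.1, ht.2.le⟩
  have hd := (h.velocity t ht)
  rcases h0.lt_or_eq with h0 | h0
  · have := (continuous_fst.tendsto (q t)).comp
      (hd.continuousWithinAt.mono Ioi_subset_Ici_self).tendsto
    exact this.eventually (lt_mem_nhds h0)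
  · have hp : 0 < (p t).1 := hp.resolve_left (by rw [← h0]; exact lt_irrefl _)
    have hd1 : HasDerivWithinAt (fun s => (q s).1) (p t).1 (Ici t) t :=
      (ContinuousLinearMap.fst ℝ ℝ ℝ).hasFDerivAt.comp_hasDerivWithinAt t hd
    have := (hasDerivWithinAt_iff_tendsto_slope'
      (s := Ioi t) (by simp)).1 (hd1.mono Ioi_subset_Ici_self)
    filter_upwards [this.eventually (lt_mem_nhds hp), self_mem_nhdsWithin] with s hs hst
    rw [slope_def_field, ← h0, sub_zero] at hs
    exact (div_pos_iff_of_pos_right (sub_pos.2 (mem_Ioi.1 hst))).1 hs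

lemma IsImpactMotion.continuousAt_momentum (h : IsImpactMotion U (1, 0) T q p) {t : ℝ}
    (ht : t ∈ Ioo 0 T) (hq : 0 < (q t).1) : ContinuousAt p t := by
  rw [continuousAt_iff_continuous_left'_right']
  exact ⟨h.free t ⟨ht.1, ht.2.le⟩ (by rwa [dot_one_zero]),
    (h.force t ⟨ht.1.le, ht.2⟩).continuousWithinAt.mono Ioi_subset_Ici_self⟩

/-- A motion off the wall, or on it with outgoing momentum, stays in the open half plane for a short
time. There it solves the smooth equation with one-sided derivatives, and Gronwall uniqueness
applies. -/
lemma IsImpactMotion.eq_right (hU : ContDiff ℝ 2 U) (h : IsImpactMotion U (1, 0) T q p)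
    (h' : IsImpactMotion U (1, 0) T' q' p') {t : ℝ} (ht : t ∈ Ico 0 T) (ht' : t ∈ Ico 0 T')
    (hq : q t = q' t) (hp : p t = p' t) (htr : 0 < (q t).1 ∨ 0 < (p t).1) :
    ∃ t₁ > t, ∀ s ∈ Icc t t₁, q s = q' s ∧ p s = p' s := by
  obtain ⟨K, N, hN, hK⟩ := ((contDiff_hamField hU).contDiffAt (x := (q t, p t))).exists_lipschitzOnWith
  have hz : ∀ {T q p}, IsImpactMotion U (1, 0) T q p → t ∈ Ico 0 T → (0 < (q t).1 ∨ 0 < (p t).1) →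
      N ∈ 𝓝 (q t, p t) → ∃ t₁ ∈ Ioi t, t₁ ≤ T ∧ ∀ s ∈ Ioo t t₁, 0 < (q s).1 ∧ (q s, p s) ∈ N := by
    intro T q p h ht htr hN
    have hc : Tendsto (fun s => (q s, p s)) (𝓝[>] t) (𝓝 (q t, p t)) :=
      ((h.velocity t ht).continuousWithinAt.mono Ioi_subset_Ici_self).tendsto.prodMk_nhds
        ((h.force t ht).continuousWithinAt.mono Ioi_subset_Ici_self).tendsto
    obtain ⟨t₁, ht₁, H⟩ := mem_nhdsGT_iff_exists_Ioo_subset.1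
      ((h.exists_pos_right ht htr).and (hc hN))
    exact ⟨min t₁ T, lt_min ht₁ ht.2, min_le_right _ _,
      fun s hs => H ⟨hs.1, hs.2.trans_le (min_le_left _ _)⟩⟩
  obtain ⟨t₁, ht₁, hT₁, H₁⟩ := hz h ht htr hN
  obtain ⟨t₂, ht₂, hT₂, H₂⟩ := hz h' ht' (by rwa [← hq, ← hp]) (by rwa [← hq, ← hp])
  obtain ⟨t₃, ht₃, ht₃'⟩ := exists_between (lt_min (mem_Ioi.1 ht₁) (mem_Ioi.1 ht₂))
  have ht₃₁ := ht₃'.trans_le (min_le_left _ _)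
  have ht₃₂ := ht₃'.trans_le (min_le_right _ _)
  have hcont : ∀ {T q p t'}, IsImpactMotion U (1, 0) T q p → t ∈ Ico 0 T → t₃ < t' → t' ≤ T →
      (∀ s ∈ Ioo t t', 0 < (q s).1 ∧ (q s, p s) ∈ N) →
      ContinuousOn (fun s => (q s, p s)) (Icc t t₃) := by
    intro T q p t' h ht h3 hT H s hs
    refine ContinuousWithinAt.prodMk ?_ ?_
    · exact (h.continuousOn s ⟨ht.1.trans hs.1, by linarith [hs.2]⟩).mono
        (Icc_subset_Icc ht.1 (by linarith))
    · rcases eq_or_lt_of_le hs.1 with rfl | hlt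
      · exact (h.force t ht).continuousWithinAt.mono Icc_subset_Ici_self
      · exact (h.continuousAt_momentum ⟨ht.1.trans_lt hlt, by linarith [hs.2]⟩
          (H s ⟨hlt, by linarith [hs.2]⟩).1).continuousWithinAt
  have hN0 := mem_of_mem_nhds hN
  have key := ODE_solution_unique_of_mem_Icc_right (v := fun _ => hamField U) (s := fun _ => N)
    (K := K) (f := fun s => (q s, p s)) (g := fun s => (q' s, p' s)) (a := t) (b := t₃)
    (fun _ _ => hK) (hcont h ht ht₃₁ hT₁ H₁)
    (fun s hs => (h.velocity s ⟨ht.1.trans hs.1, by linarith [hs.2]⟩).prodMk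
      (h.force s ⟨ht.1.trans hs.1, by linarith [hs.2]⟩))
    (fun s hs => by
      rcases eq_or_lt_of_le hs.1 with rfl | hlt
      · exact hN0
      · exact (H₁ s ⟨hlt, by linarith [hs.2]⟩).2)
    (hcont h' ht' ht₃₂ hT₂ H₂)
    (fun s hs => (h'.velocity s ⟨ht.1.trans hs.1, by linarith [hs.2]⟩).prodMk
      (h'.force s ⟨ht.1.trans hs.1, by linarith [hs.2]⟩))
    (fun s hs => by
      rcases eq_or_lt_of_le hs.1 with rfl | hlt
      · rw [← hq, ← hp]; exact hN0
      · exact (H₂ s ⟨hlt, by linarith [hs.2]⟩).2) (by simp only [hq, hp])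
  exact ⟨t₃, ht₃, fun s hs => Prod.mk.inj (key hs)⟩

/-- The left limit of the state determines the state, by continuity off the wall and by the
reflection law on it. -/
lemma IsImpactMotion.eq_of_eq_left (h : IsImpactMotion U (1, 0) T q p)
    (h' : IsImpactMotion U (1, 0) T' q' p') {t : ℝ} (ht : t ∈ Ioc 0 T) (ht' : t ∈ Ioc 0 T')
    (heq : ∀ s ∈ Ico 0 t, q s = q' s ∧ p s = p' s) : q t = q' t ∧ p t = p' t := by
  have hmem : Ico 0 t ∈ 𝓝[<] t := Ico_mem_nhdsLT ht.1
  have hlim : ∀ {T q p}, IsImpactMotion U (1, 0) T q p → t ∈ Ioc 0 T →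
      Tendsto q (𝓝[<] t) (𝓝 (q t)) := by
    intro T q p h ht
    have := (h.continuousOn t ⟨ht.1.le, ht.2⟩).tendsto
    refine this.mono_left (nhdsWithin_le_iff.2 ?_)
    exact mem_of_superset hmem fun s hs => ⟨hs.1, hs.2.le.trans ht.2⟩
  have hq : q t = q' t := tendsto_nhds_unique_of_eventuallyEq (hlim h ht) (hlim h' ht')
    (mem_of_superset hmem fun s hs => (heq s hs).1)
  have hpe : p =ᶠ[𝓝[<] t] p' := mem_of_superset hmem fun s hs => (heq s hs).2
  refine ⟨hq, ?_⟩
  have h0 := h.inside t ⟨ht.1.le, ht.2⟩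
  rcases h0.lt_or_eq with h0 | h0
  · exact tendsto_nhds_unique_of_eventuallyEq (h.free t ht h0) (h'.free t ht' (by rwa [← hq])) hpe
  · obtain ⟨v, hv, e⟩ := h.impact t ht h0.symm
    obtain ⟨v', hv', e'⟩ := h'.impact t ht' (by rw [← hq, ← h0])
    rw [e, e', tendsto_nhds_unique_of_eventuallyEq hv hv' hpe]

/-- Impact motions are determined by their initial states as long as they leave the wall. -/
theorem IsImpactMotion.eqOn (hU : ContDiff ℝ 2 U) (h : IsImpactMotion U (1, 0) T q p)
    (h' : IsImpactMotion U (1, 0) T' q' p') (hq : q 0 = q' 0) (hp : p 0 = p' 0)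
    (htr : ∀ t ∈ Ico 0 T, 0 < (q t).1 ∨ 0 < (p t).1) {t : ℝ} (ht : t ∈ Icc 0 T)
    (ht' : t ∈ Icc 0 T') : q t = q' t ∧ p t = p' t := by
  by_contra hne
  -- The motions still agree at the infimum of the times of disagreement, by left limits, and then a
  -- little longer, by local uniqueness. Excluding states with q₁ = p₁ = 0 is what makes this last
  -- step possible.
  set S := {s | s ∈ Icc 0 t ∧ ¬ (q s = q' s ∧ p s = p' s)} with hS
  have hSne : S.Nonempty := ⟨t, ⟨ht.1, le_rfl⟩, hne⟩
  have hSb : BddBelow S := ⟨0, fun s hs => hs.1.1⟩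
  set m := sInf S with hm
  have hm0 : 0 ≤ m := le_csInf hSne fun s hs => hs.1.1
  have hmt : m ≤ t := csInf_le hSb ⟨⟨ht.1, le_rfl⟩, hne⟩
  have hlt : ∀ s ∈ Ico 0 m, q s = q' s ∧ p s = p' s := by
    intro s hs
    by_contra hc
    exact absurd (csInf_le hSb ⟨⟨hs.1, hs.2.le.trans hmt⟩, hc⟩) (not_le.2 hs.2)
  have hmeq : q m = q' m ∧ p m = p' m := by
    rcases hm0.eq_or_lt with h0 | h0
    · rw [← h0]; exact ⟨hq, hp⟩
    · exact h.eq_of_eq_left h' ⟨h0, hmt.trans ht.2⟩ ⟨h0, hmt.trans ht'.2⟩ hlt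
  have hmt' : m < t := hmt.lt_of_ne fun e => hne (e ▸ hmeq)
  have hmT : m ∈ Ico 0 T := ⟨hm0, hmt'.trans_le ht.2⟩
  obtain ⟨t₁, ht₁, H⟩ := h.eq_right hU h' hmT ⟨hm0, hmt'.trans_le ht'.2⟩ hmeq.1 hmeq.2 (htr m hmT)
  obtain ⟨s, hs, hst⟩ := exists_lt_of_csInf_lt hSne ht₁
  exact hs.2 (H s ⟨csInf_le hSb hs, hst.le⟩)

lemma IsFirstReturn.time_eq {S : ℝ × ℝ → ℝ × ℝ → Prop} (hU : ContDiff ℝ 2 U)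
    (h : IsFirstReturn U (1, 0) S T q p) (h' : IsFirstReturn U (1, 0) S T' q' p')
    (hq : q 0 = q' 0) (hp : p 0 = p' 0) (htr : ∀ t ∈ Ico 0 T, 0 < (q t).1 ∨ 0 < (p t).1) :
    T = T' := by
  obtain ⟨hT, hm, -, hS, hn⟩ := h
  obtain ⟨hT', hm', -, hS', hn'⟩ := h'
  rcases lt_trichotomy T T' with hlt | rfl | hlt
  · have := hm.eqOn hU hm' hq hp htr (t := T) ⟨hT.le, le_rfl⟩ ⟨hT.le, hlt.le⟩
    exact absurd (this.1 ▸ this.2 ▸ hS) (hn' T ⟨hT, hlt⟩)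
  · rfl
  · have := hm.eqOn hU hm' hq hp htr (t := T') ⟨hT'.le, hlt.le⟩ ⟨hT'.le, le_rfl⟩
    exact absurd (this.1.symm ▸ this.2.symm ▸ hS') (hn T' ⟨hT', hlt⟩)

end Unique

/-! ### Motions with two legs -/

section Join

/-- The curve that follows `z₁` until time `τ` and then `z₂`. -/
def joinAt {α : Type*} (τ : ℝ) (z₁ z₂ : ℝ → α) (t : ℝ) : α := if t < τ then z₁ t else z₂ (t - τ)

variable {α : Type*} {τ t : ℝ} {z₁ z₂ : ℝ → α}

lemma joinAt_of_lt (h : t < τ) : joinAt τ z₁ z₂ t = z₁ t := if_pos h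

lemma joinAt_of_ge (h : τ ≤ t) : joinAt τ z₁ z₂ t = z₂ (t - τ) := if_neg (not_lt.2 h)

lemma joinAt_eventuallyEq_left (h : t ≤ τ) : joinAt τ z₁ z₂ =ᶠ[𝓝[<] t] z₁ := by
  filter_upwards [self_mem_nhdsWithin] with s hs
  exact joinAt_of_lt (lt_of_lt_of_le (mem_Iio.1 hs) h)

lemma joinAt_eventuallyEq_right (h : τ ≤ t) : joinAt τ z₁ z₂ =ᶠ[𝓝[≥] t] fun s => z₂ (s - τ) := by
  filter_upwards [self_mem_nhdsWithin] with s hs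
  exact joinAt_of_ge (h.trans (mem_Ici.1 hs))

lemma joinAt_eventuallyEq_of_lt (h : t < τ) : joinAt τ z₁ z₂ =ᶠ[𝓝 t] z₁ := by
  filter_upwards [gt_mem_nhds h] with s hs
  exact joinAt_of_lt hs

lemma joinAt_eventuallyEq_of_gt (h : τ < t) :
    joinAt τ z₁ z₂ =ᶠ[𝓝 t] fun s => z₂ (s - τ) := by
  filter_upwards [lt_mem_nhds h] with s hs
  exact joinAt_of_ge (le_of_lt hs)

end Join

section TwoLegs

variable {U : ℝ × ℝ → ℝ} {τ₁ τ₂ : ℝ} {z₁ z₂ : ℝ → (ℝ × ℝ) × (ℝ × ℝ)}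

/-- Two smooth pieces of motion, one before and one after meeting the wall (`p₁ ≠ 0`) or turning
(`p₁ = 0`). -/
structure IsTwoLegMotion (U : ℝ × ℝ → ℝ) (τ₁ τ₂ : ℝ) (z₁ z₂ : ℝ → (ℝ × ℝ) × (ℝ × ℝ)) :
    Prop where
  pos₁ : 0 < τ₁
  pos₂ : 0 < τ₂
  hasDerivAt₁ : ∀ t ∈ Icc 0 τ₁, HasDerivAt z₁ (hamField U (z₁ t)) t
  hasDerivAt₂ : ∀ t ∈ Icc 0 τ₂, HasDerivAt z₂ (hamField U (z₂ t)) t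
  inside₁ : ∀ t ∈ Ico 0 τ₁, 0 < (z₁ t).1.1
  inside₂ : ∀ t ∈ Ioc 0 τ₂, 0 < (z₂ t).1.1
  join : z₂ 0 = ((z₁ τ₁).1, (-(z₁ τ₁).2.1, (z₁ τ₁).2.2))
  wall : ((z₁ τ₁).1.1 = 0 ∧ (z₁ τ₁).2.1 < 0) ∨
    (0 < (z₁ τ₁).1.1 ∧ (z₁ τ₁).2.1 = 0 ∧ (grad U (z₁ τ₁).1).1 < 0)
  momentum₁ : ∀ t ∈ Ioo 0 τ₁, (z₁ t).2.1 < 0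
  momentum₂ : ∀ t ∈ Ioo 0 τ₂, 0 < (z₂ t).2.1
  start : turningSection U (z₁ 0).1 (z₁ 0).2
  finish : turningSection U (z₂ τ₂).1 (z₂ τ₂).2

/-- Reversing p₁ at the junction is the elastic reflection when the wall is met. At an inner turning
point p₁ = 0, so the reversal does nothing and the momentum is continuous, as required off the wall.
-/
lemma IsTwoLegMotion.isImpactMotion (h : IsTwoLegMotion U τ₁ τ₂ z₁ z₂) :
    IsImpactMotion U (1, 0) (τ₁ + τ₂) (fun t => (joinAt τ₁ z₁ z₂ t).1)
      (fun t => (joinAt τ₁ z₁ z₂ t).2) := by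
  have h1 := h.pos₁
  have h2 := h.pos₂
  have hsub : ∀ t, t ∈ Icc τ₁ (τ₁ + τ₂) → t - τ₁ ∈ Icc 0 τ₂ := fun t ht =>
    ⟨by linarith [ht.1], by linarith [ht.2]⟩
  have hd₂ : ∀ t ∈ Icc τ₁ (τ₁ + τ₂),
      HasDerivAt (fun s => z₂ (s - τ₁)) (hamField U (z₂ (t - τ₁))) t := fun t ht => by
    have := HasDerivAt.comp_sub_const t τ₁ (h.hasDerivAt₂ (t - τ₁) (hsub t ht))
    exact this
  have hright : ∀ t ∈ Ico 0 (τ₁ + τ₂),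
      HasDerivWithinAt (joinAt τ₁ z₁ z₂) (hamField U (joinAt τ₁ z₁ z₂ t)) (Ici t) t := by
    intro t ht
    rcases lt_or_ge t τ₁ with hlt | hge
    · rw [joinAt_of_lt hlt]
      exact ((h.hasDerivAt₁ t ⟨ht.1, hlt.le⟩).congr_of_eventuallyEq
        (joinAt_eventuallyEq_of_lt hlt)).hasDerivWithinAt
    · rw [joinAt_of_ge hge]
      exact (hd₂ t ⟨hge, ht.2.le⟩).hasDerivWithinAt.congr_of_eventuallyEq
        (joinAt_eventuallyEq_right hge) (joinAt_of_ge hge)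
  have hfree : ∀ t ∈ Ioc 0 (τ₁ + τ₂), t ≠ τ₁ → ContinuousAt (joinAt τ₁ z₁ z₂) t := by
    intro t ht hne
    rcases lt_or_gt_of_ne hne with hlt | hgt
    · exact (h.hasDerivAt₁ t ⟨ht.1.le, hlt.le⟩).continuousAt.congr
        (joinAt_eventuallyEq_of_lt hlt).symm
    · exact (hd₂ t ⟨hgt.le, ht.2⟩).continuousAt.congr (joinAt_eventuallyEq_of_gt hgt).symm
  have hleft : Tendsto (joinAt τ₁ z₁ z₂) (𝓝[<] τ₁) (𝓝 (z₁ τ₁)) :=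
    ((h.hasDerivAt₁ τ₁ ⟨h1.le, le_rfl⟩).continuousAt.tendsto.mono_left
      nhdsWithin_le_nhds).congr' (joinAt_eventuallyEq_left le_rfl).symm
  have hat : joinAt τ₁ z₁ z₂ τ₁ = z₂ 0 := by rw [joinAt_of_ge le_rfl, sub_self]
  have hat1 : (joinAt τ₁ z₁ z₂ τ₁).1 = (z₁ τ₁).1 := by rw [hat, h.join]
  have hat2 : (joinAt τ₁ z₁ z₂ τ₁).2 = (-(z₁ τ₁).2.1, (z₁ τ₁).2.2) := by rw [hat, h.join]
  have hpos : ∀ t ∈ Icc 0 (τ₁ + τ₂), t ≠ τ₁ → 0 < (joinAt τ₁ z₁ z₂ t).1.1 := by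
    intro t ht hne
    rcases lt_or_gt_of_ne hne with hlt | hgt
    · rw [joinAt_of_lt hlt]; exact h.inside₁ t ⟨ht.1, hlt⟩
    · rw [joinAt_of_ge hgt.le]; exact h.inside₂ _ ⟨by linarith, by linarith [ht.2]⟩
  refine ⟨fun t ht => ?_, fun t ht => ?_, fun t ht => ?_, fun t ht => ?_, fun t ht hp => ?_,
    fun t ht hw => ?_⟩
  · rcases eq_or_ne t τ₁ with rfl | hne
    · refine ContinuousAt.continuousWithinAt ?_
      rw [continuousAt_iff_continuous_left'_right']
      refine ⟨?_, ?_⟩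
      · rw [ContinuousWithinAt, hat1]
        exact (continuous_fst.tendsto _).comp hleft
      · exact continuous_fst.continuousAt.comp_continuousWithinAt
          ((hright t ⟨ht.1, by linarith⟩).continuousWithinAt.mono Ioi_subset_Ici_self)
    · rcases ht.1.eq_or_lt with rfl | h0
      · exact continuous_fst.continuousAt.comp_continuousWithinAt
          ((hright 0 ⟨le_rfl, by linarith⟩).continuousWithinAt.mono Icc_subset_Ici_self)
      · exact (continuous_fst.continuousAt.comp (hfree t ⟨h0, ht.2⟩ hne)).continuousWithinAt
  · rw [dot_one_zero]
    rcases eq_or_ne t τ₁ with rfl | hne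
    · rw [hat1]
      rcases h.wall with hw | hw
      · exact hw.1.ge
      · exact hw.1.le
    · exact (hpos t ht hne).le
  · exact (ContinuousLinearMap.fst ℝ (ℝ × ℝ) (ℝ × ℝ)).hasFDerivAt.comp_hasDerivWithinAt t
      (hright t ht)
  · exact (ContinuousLinearMap.snd ℝ (ℝ × ℝ) (ℝ × ℝ)).hasFDerivAt.comp_hasDerivWithinAt t
      (hright t ht)
  · rcases eq_or_ne t τ₁ with rfl | hne
    · rw [dot_one_zero, hat1] at hp
      rcases h.wall with hw | hw
      · exact absurd hw.1 hp.ne'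
      · have e : (joinAt t z₁ z₂ t).2 = (z₁ t).2 := by
          rw [hat2]; ext <;> simp [hw.2.1]
        rw [e]
        exact (continuous_snd.tendsto _).comp hleft
    · exact (continuous_snd.continuousAt.comp (hfree t ht hne)).tendsto.mono_left
        nhdsWithin_le_nhds
  · rw [dot_one_zero] at hw
    rcases eq_or_ne t τ₁ with rfl | hne
    · refine ⟨(z₁ t).2, (continuous_snd.tendsto _).comp hleft, ?_⟩
      rw [hat2, reflect_one_zero]
    · exact absurd hw (hpos t ⟨ht.1.le, ht.2⟩ hne).ne'

/-- On the open legs p₁ has a strict sign. At the junction either p₁ ≠ 0, or the first component of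
the force is positive, which is the wrong sign for the section. -/
lemma IsTwoLegMotion.isFirstReturn (h : IsTwoLegMotion U τ₁ τ₂ z₁ z₂) :
    IsFirstReturn U (1, 0) (turningSection U) (τ₁ + τ₂) (fun t => (joinAt τ₁ z₁ z₂ t).1)
      (fun t => (joinAt τ₁ z₁ z₂ t).2) := by
  have h1 := h.pos₁
  have h2 := h.pos₂
  have hat : joinAt τ₁ z₁ z₂ τ₁ = z₂ 0 := by rw [joinAt_of_ge le_rfl, sub_self]
  refine ⟨by linarith, h.isImpactMotion, ?_, ?_, fun t ht hS => ?_⟩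
  · simp only [joinAt_of_lt h1]; exact h.start
  · simp only [joinAt_of_ge (by linarith : τ₁ ≤ τ₁ + τ₂), add_sub_cancel_left]; exact h.finish
  · rcases lt_trichotomy t τ₁ with hlt | rfl | hgt
    · simp only [joinAt_of_lt hlt] at hS
      exact absurd hS.1 (h.momentum₁ t ⟨ht.1, hlt⟩).ne
    · simp only [hat, h.join] at hS
      rcases h.wall with hw | hw
      · exact absurd (neg_eq_zero.1 hS.1) hw.2.ne
      · have h3 := hS.2
        have h4 := hw.2.2
        linarith
    · simp only [joinAt_of_ge hgt.le] at hS
      exact absurd hS.1 (h.momentum₂ _ ⟨by linarith, by linarith [ht.2]⟩).ne'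

lemma IsTwoLegMotion.pos_or_pos (h : IsTwoLegMotion U τ₁ τ₂ z₁ z₂) :
    ∀ t ∈ Ico 0 (τ₁ + τ₂), 0 < (joinAt τ₁ z₁ z₂ t).1.1 ∨ 0 < (joinAt τ₁ z₁ z₂ t).2.1 := by
  intro t ht
  rcases lt_trichotomy t τ₁ with hlt | rfl | hgt
  · rw [joinAt_of_lt hlt]; exact Or.inl (h.inside₁ t ⟨ht.1, hlt⟩)
  · rw [joinAt_of_ge le_rfl, sub_self, h.join]
    rcases h.wall with hw | hw
    · exact Or.inr (neg_pos.2 hw.2)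
    · exact Or.inl hw.1
  · rw [joinAt_of_ge hgt.le]; exact Or.inl (h.inside₂ _ ⟨by linarith, by linarith [ht.2]⟩)

/-- The integral of a function along a motion with two legs. -/
lemma IsTwoLegMotion.integral_eq (h : IsTwoLegMotion U τ₁ τ₂ z₁ z₂)
    {F : (ℝ × ℝ) × (ℝ × ℝ) → ℝ} (hF : Continuous F) {s₁ s₂ : ℝ → ℝ}
    (hs₁ : ∀ t ∈ Icc 0 τ₁, HasDerivAt s₁ (F (z₁ t)) t)
    (hs₂ : ∀ t ∈ Icc 0 τ₂, HasDerivAt s₂ (F (z₂ t)) t) (hs : s₂ 0 = s₁ τ₁) :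
    ∫ t in (0 : ℝ)..(τ₁ + τ₂), F (joinAt τ₁ z₁ z₂ t) = s₂ τ₂ - s₁ 0 := by
  have h1 := h.pos₁
  have h2 := h.pos₂
  have hc₁ : ContinuousOn (fun t => F (z₁ t)) (uIcc 0 τ₁) := by
    rw [uIcc_of_le h1.le]
    exact hF.comp_continuousOn fun t ht => (h.hasDerivAt₁ t ht).continuousAt.continuousWithinAt
  have hc₂ : ContinuousOn (fun t => F (z₂ t)) (uIcc 0 τ₂) := by
    rw [uIcc_of_le h2.le]
    exact hF.comp_continuousOn fun t ht => (h.hasDerivAt₂ t ht).continuousAt.continuousWithinAt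
  have i₁ := intervalIntegral.integral_eq_sub_of_hasDerivAt
    (by rwa [uIcc_of_le h1.le]) hc₁.intervalIntegrable
  have i₂ := intervalIntegral.integral_eq_sub_of_hasDerivAt
    (by rwa [uIcc_of_le h2.le]) hc₂.intervalIntegrable
  have hae : ∀ t ∈ uIoo 0 τ₁, F (z₁ t) = F (joinAt τ₁ z₁ z₂ t) := fun t ht => by
    rw [uIoo_of_le h1.le] at ht
    rw [joinAt_of_lt ht.2]
  have hae₂ : ∀ t ∈ uIoo τ₁ (τ₁ + τ₂), F (z₂ (t - τ₁)) = F (joinAt τ₁ z₁ z₂ t) := fun t ht => by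
    rw [uIoo_of_le (by linarith)] at ht
    rw [joinAt_of_ge ht.1.le]
  have hi₂ : IntervalIntegrable (fun t => F (z₂ (t - τ₁))) volume τ₁ (τ₁ + τ₂) := by
    have := hc₂.intervalIntegrable.comp_sub_right τ₁
    rwa [zero_add, add_comm] at this
  have i₃ : ∫ t in τ₁..(τ₁ + τ₂), F (z₂ (t - τ₁)) = ∫ t in (0 : ℝ)..τ₂, F (z₂ t) := by
    rw [intervalIntegral.integral_comp_sub_right (fun t => F (z₂ t)) τ₁]
    simp
  rw [← intervalIntegral.integral_add_adjacent_intervals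
      (hc₁.intervalIntegrable.congr_uIoo hae) (hi₂.congr_uIoo hae₂),
    ← intervalIntegral.integral_congr_uIoo hae, ← intervalIntegral.integral_congr_uIoo hae₂,
    i₁, i₃, i₂, hs]
  ring

end TwoLegs

end ImpactSystem

end

/-! ### The return as a composition of two legs of an extended flow -/

noncomputable section

namespace ImpactSystem

open Set Filter Topology MeasureTheory

/-! ### The extended vector field -/

/-- A parameter, a position, a momentum, and the value of an integral along the motion. -/
abbrev ExtState : Type := ℝ × (((ℝ × ℝ) × (ℝ × ℝ)) × ℝ)

/-- The Hamiltonian vector field of the family `W` of potentials, together with the integral of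
`K p₂`. -/
def extField (W K : ℝ × (ℝ × ℝ) → ℝ) (e : ExtState) : ExtState :=
  (0, hamField (fun q => W (e.1, q)) e.2.1, K (e.1, e.2.1.1) * e.2.1.2.2)

/-- The first position. -/
def evalQ : ExtState →L[ℝ] ℝ :=
  (ContinuousLinearMap.fst ℝ ℝ ℝ).comp ((ContinuousLinearMap.fst ℝ (ℝ × ℝ) (ℝ × ℝ)).comp
    ((ContinuousLinearMap.fst ℝ ((ℝ × ℝ) × (ℝ × ℝ)) ℝ).comp
      (ContinuousLinearMap.snd ℝ ℝ (((ℝ × ℝ) × (ℝ × ℝ)) × ℝ))))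

/-- The first momentum. -/
def evalP : ExtState →L[ℝ] ℝ :=
  (ContinuousLinearMap.fst ℝ ℝ ℝ).comp ((ContinuousLinearMap.snd ℝ (ℝ × ℝ) (ℝ × ℝ)).comp
    ((ContinuousLinearMap.fst ℝ ((ℝ × ℝ) × (ℝ × ℝ)) ℝ).comp
      (ContinuousLinearMap.snd ℝ ℝ (((ℝ × ℝ) × (ℝ × ℝ)) × ℝ))))

@[simp] lemma evalQ_apply (e : ExtState) : evalQ e = e.2.1.1.1 := rfl

@[simp] lemma evalP_apply (e : ExtState) : evalP e = e.2.1.2.1 := rfl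

/-- Reversal of the first momentum. -/
def flip (e : ExtState) : ExtState := (e.1, (e.2.1.1, (-e.2.1.2.1, e.2.1.2.2)), e.2.2)

lemma dist_flip (e e' : ExtState) : dist (flip e) (flip e') = dist e e' := by
  simp [flip, Prod.dist_eq]

section

variable {W K : ℝ × (ℝ × ℝ) → ℝ}

lemma fderiv_section (hW : Differentiable ℝ W) (ε : ℝ) (q v : ℝ × ℝ) :
    fderiv ℝ (fun q => W (ε, q)) q v = fderiv ℝ W (ε, q) (0, v) := by
  have h1 : HasFDerivAt (fun q : ℝ × ℝ => (ε, q)) (ContinuousLinearMap.inr ℝ ℝ (ℝ × ℝ)) q :=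
    hasFDerivAt_prodMk_right ε q
  have h2 := (hW (ε, q)).hasFDerivAt.comp q h1
  have h3 := h2.fderiv
  simp only [Function.comp_def] at h3
  rw [h3]
  simp

lemma contDiff_section {n : WithTop ℕ∞} (hW : ContDiff ℝ n W) (ε : ℝ) :
    ContDiff ℝ n (fun q => W (ε, q)) := hW.comp (contDiff_const.prodMk contDiff_id)

/-- Since the parameter is a constant component of the state, Lipschitz dependence on initial states
includes dependence on the perturbation. -/
lemma contDiff_extField (hW : ContDiff ℝ 2 W) (hK : ContDiff ℝ 1 K) :
    ContDiff ℝ 1 (extField W K) := by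
  have hd : Differentiable ℝ W := hW.differentiable (by norm_num)
  have h1 : ContDiff ℝ 1 (fderiv ℝ W) := hW.fderiv_right (by norm_num)
  have h2 : ContDiff ℝ 1 (fun e : ExtState => fderiv ℝ W (e.1, e.2.1.1)) := h1.comp (by fun_prop)
  have h3 : ContDiff ℝ 1 (fun e : ExtState => grad (fun q => W (e.1, q)) e.2.1.1) := by
    simp only [grad, fderiv_section hd]
    exact (h2.clm_apply contDiff_const).prodMk (h2.clm_apply contDiff_const)
  have h4 : ContDiff ℝ 1 (fun e : ExtState => K (e.1, e.2.1.1)) := hK.comp (by fun_prop)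
  unfold extField hamField
  refine contDiff_const.prodMk ((ContDiff.prodMk ?_ h3.neg).prodMk (h4.mul ?_)) <;> fun_prop

lemma grad_separable {V₁ V₂ : ℝ → ℝ} (h₁ : Differentiable ℝ V₁) (h₂ : Differentiable ℝ V₂)
    (q : ℝ × ℝ) : grad (fun q => V₁ q.1 + V₂ q.2) q = (deriv V₁ q.1, deriv V₂ q.2) := by
  have e1 : HasFDerivAt (fun q : ℝ × ℝ => V₁ q.1) _ q :=
    (h₁ q.1).hasDerivAt.hasFDerivAt.comp q (hasFDerivAt_fst (𝕜 := ℝ) (p := q))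
  have e2 : HasFDerivAt (fun q : ℝ × ℝ => V₂ q.2) _ q :=
    (h₂ q.2).hasDerivAt.hasFDerivAt.comp q (hasFDerivAt_snd (𝕜 := ℝ) (p := q))
  have := (e1.fun_add e2).fderiv
  simp only [grad, this]
  simp

end

/-! ### Reference legs -/

lemma IsLeaf.deriv_signs {V : ℝ → ℝ} {a b e : ℝ} (h : IsLeaf V a b e) (hab : a < b) :
    deriv V a < 0 ∧ 0 < deriv V b := by
  rcases h.nondegenerate with h | h
  · exact h.2
  · exact absurd h.1 hab.ne

section Reference

variable {W K : ℝ × (ℝ × ℝ) → ℝ} {V₁ V₂ : ℝ → ℝ} {m a c d e₁ e₂ : ℝ}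

/-- The extended motion of the unperturbed separable system. -/
def refCurve (K : ℝ × (ℝ × ℝ) → ℝ) (V₁ V₂ : ℝ → ℝ) (m a c d φ₁ φ₂ s₀ t : ℝ) : ExtState :=
  (0, ((leafQ V₁ m a (t + φ₁), leafQ V₂ c d (t + φ₂)),
    (leafP V₁ m a (t + φ₁), leafP V₂ c d (t + φ₂))),
    s₀ + ∫ s in (0 : ℝ)..t,
      K (0, (leafQ V₁ m a (s + φ₁), leafQ V₂ c d (s + φ₂))) * leafP V₂ c d (s + φ₂))

lemma hasDerivAt_refCurve (hV₁ : ContDiff ℝ 3 V₁) (hV₂ : ContDiff ℝ 3 V₂)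
    (hW0 : ∀ q, W (0, q) = V₁ q.1 + V₂ q.2) (hK : Continuous K) (l₁ : IsLeaf V₁ m a e₁)
    (l₂ : IsLeaf V₂ c d e₂) (φ₁ φ₂ s₀ t : ℝ) :
    HasDerivAt (refCurve K V₁ V₂ m a c d φ₁ φ₂ s₀)
      (extField W K (refCurve K V₁ V₂ m a c d φ₁ φ₂ s₀ t)) t := by
  have hq₁ := fun t => HasDerivAt.comp_add_const t φ₁ (l₁.hasDerivAt_leafQ hV₁ (t + φ₁))
  have hp₁ := fun t => HasDerivAt.comp_add_const t φ₁ (l₁.hasDerivAt_leafP hV₁ (t + φ₁))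
  have hq₂ := fun t => HasDerivAt.comp_add_const t φ₂ (l₂.hasDerivAt_leafQ hV₂ (t + φ₂))
  have hp₂ := fun t => HasDerivAt.comp_add_const t φ₂ (l₂.hasDerivAt_leafP hV₂ (t + φ₂))
  have cq₁ : Continuous fun t => leafQ V₁ m a (t + φ₁) :=
    continuous_iff_continuousAt.2 fun t => (hq₁ t).continuousAt
  have cq₂ : Continuous fun t => leafQ V₂ c d (t + φ₂) :=
    continuous_iff_continuousAt.2 fun t => (hq₂ t).continuousAt
  have cp₂ : Continuous fun t => leafP V₂ c d (t + φ₂) :=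
    continuous_iff_continuousAt.2 fun t => (hp₂ t).continuousAt
  have hc : Continuous fun s =>
      K (0, (leafQ V₁ m a (s + φ₁), leafQ V₂ c d (s + φ₂))) * leafP V₂ c d (s + φ₂) :=
    (hK.comp (continuous_const.prodMk (cq₁.prodMk cq₂))).mul cp₂
  have hs := (hc.integral_hasStrictDerivAt 0 t).hasDerivAt.const_add s₀
  have hg : grad (fun q => W (0, q)) (leafQ V₁ m a (t + φ₁), leafQ V₂ c d (t + φ₂)) =
      (deriv V₁ (leafQ V₁ m a (t + φ₁)), deriv V₂ (leafQ V₂ c d (t + φ₂))) := by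
    simp only [hW0]
    exact grad_separable (hV₁.differentiable (by norm_num)) (hV₂.differentiable (by norm_num)) _
  refine ((hasDerivAt_const t (0 : ℝ)).prodMk ((((hq₁ t).prodMk (hq₂ t)).prodMk
    ((hp₁ t).prodMk (hp₂ t))).prodMk hs)).congr_deriv ?_
  simp only [extField, refCurve, hamField, hg, Prod.neg_mk]

/-- The event that ends the first leg, and the guard: either the wall is met with negative momentum,
or the first degree of freedom turns before the wall. -/
def IsEventPair (σ θ : ExtState →L[ℝ] ℝ) : Prop :=
  (σ = evalQ ∧ θ = -evalP) ∨ (σ = -evalP ∧ θ = evalQ)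

/-- In the first degree of freedom the second leg is the time reversal of the first, (Q(τ - t), -P(τ
- t)), while the second degree of freedom simply continues. Both legs therefore last the same time
τ, and 2τ is the impact period. -/
theorem exists_referenceLegs (hV₁ : ContDiff ℝ 3 V₁) (hV₂ : ContDiff ℝ 3 V₂)
    (hW0 : ∀ q, W (0, q) = V₁ q.1 + V₂ q.2) (hK : Continuous K) (l₁ : IsLeaf V₁ m a e₁)
    (hma : m < a) (ha : 0 < a) (hm : m ≠ 0) (l₂ : IsLeaf V₂ c d e₂) {x y : ℝ} (hx : x ∈ Icc c d)
    (hy : y ^ 2 / 2 + V₂ x = e₂) :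
    ∃ σ θ, IsEventPair σ θ ∧ ∃ (γ₁ γ₂ : ℝ → ExtState) (τ : ℝ),
      γ₁ 0 = (0, ((a, x), (0, y)), 0) ∧ γ₂ 0 = flip (γ₁ τ) ∧ (γ₂ τ).2.1.1.2 ∈ Icc c d ∧
      2 * τ = impactPeriod V₁ a e₁ ∧
      IsReferenceLeg (extField W K) σ θ γ₁ τ ∧
      IsReferenceLeg (extField W K) evalP evalQ γ₂ τ := by
  obtain ⟨φ, hφq, hφp⟩ := l₂.exists_leafQ_eq hV₂ hx hy
  -- The first leg ends at `max m 0`: the wall if `m < 0`, the inner turning point if `0 < m`. The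
  -- case `m = 0` would be tangency.
  have hmax : max m 0 ∈ Ico m a := ⟨le_max_left _ _, max_lt hma ha⟩
  obtain ⟨τ, hτ, hτI, hτq, hτp, hτp', hτ'⟩ := l₁.exists_time hV₁ hma hmax
  have hper : 2 * τ = impactPeriod V₁ a e₁ := by rw [l₁.impactPeriod_eq hV₁ hma ha hm, hτI]
  obtain ⟨hdm, hda⟩ := l₁.deriv_signs hma
  have q0 : leafQ V₁ m a 0 = a := l₁.leafQ_zero hV₁
  have p0 : leafP V₁ m a 0 = 0 := l₁.leafP_zero hV₁
  have hc0 : 0 ≤ max m 0 := le_max_right _ _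
  set γ₁ := refCurve K V₁ V₂ m a c d 0 φ 0 with hγ₁
  set γ₂ := refCurve K V₁ V₂ m a c d (-τ) (τ + φ) (γ₁ τ).2.2 with hγ₂
  have d₁ := hasDerivAt_refCurve hV₁ hV₂ hW0 hK l₁ l₂ 0 φ 0
  have d₂ := hasDerivAt_refCurve hV₁ hV₂ hW0 hK l₁ l₂ (-τ) (τ + φ) (γ₁ τ).2.2
  have hflow : ∀ φ₁ φ₂ s₀ t, (extField W K (refCurve K V₁ V₂ m a c d φ₁ φ₂ s₀ t)).2.1 =
      ((leafP V₁ m a (t + φ₁), leafP V₂ c d (t + φ₂)),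
        (-deriv V₁ (leafQ V₁ m a (t + φ₁)), -deriv V₂ (leafQ V₂ c d (t + φ₂)))) := by
    intro φ₁ φ₂ s₀ t
    have := grad_separable (hV₁.differentiable (by norm_num)) (hV₂.differentiable (by norm_num))
      (leafQ V₁ m a (t + φ₁), leafQ V₂ c d (t + φ₂))
    simp only [extField, refCurve, hamField, hW0, this, Prod.neg_mk]
  have hq₁ : ∀ t, evalQ (γ₁ t) = leafQ V₁ m a t := fun t => by simp [hγ₁, refCurve]
  have hp₁ : ∀ t, evalP (γ₁ t) = leafP V₁ m a t := fun t => by simp [hγ₁, refCurve]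
  have hq₁' : ∀ t, evalQ (extField W K (γ₁ t)) = leafP V₁ m a t := fun t => by
    simp [hγ₁, hflow]
  have hp₁' : ∀ t, evalP (extField W K (γ₁ t)) = -deriv V₁ (leafQ V₁ m a t) := fun t => by
    simp [hγ₁, hflow]
  have hQm : ∀ t, leafQ V₁ m a (t + -τ) = leafQ V₁ m a (τ - t) := fun t => by
    rw [← l₁.leafQ_neg hV₁]; congr 1; ring
  have hPm : ∀ t, leafP V₁ m a (t + -τ) = -leafP V₁ m a (τ - t) := fun t => by
    rw [← l₁.leafP_neg hV₁]; congr 1; ring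
  have hq₂ : ∀ t, evalQ (γ₂ t) = leafQ V₁ m a (τ - t) := fun t => by
    simp [hγ₂, refCurve, hQm]
  have hp₂ : ∀ t, evalP (γ₂ t) = -leafP V₁ m a (τ - t) := fun t => by
    simp [hγ₂, refCurve, hPm]
  have hq₂' : ∀ t, evalQ (extField W K (γ₂ t)) = -leafP V₁ m a (τ - t) := fun t => by
    simp [hγ₂, hflow, hPm]
  have hp₂' : ∀ t, evalP (extField W K (γ₂ t)) = -deriv V₁ (leafQ V₁ m a (τ - t)) := fun t => by
    simp [hγ₂, hflow, hQm]
  have hsub : ∀ t ∈ Ioo 0 τ, τ - t ∈ Ioo 0 τ := fun t ht =>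
    ⟨by linarith [ht.2], by linarith [ht.1]⟩
  have hγ₁0 : γ₁ 0 = (0, ((a, x), (0, y)), 0) := by
    simp [hγ₁, refCurve, q0, p0, hφq, hφp]
  have hγ₂0 : γ₂ 0 = flip (γ₁ τ) := by
    have e1 := hQm 0
    have e2 := hPm 0
    simp only [zero_add, sub_zero] at e1 e2
    simp [hγ₁, hγ₂, refCurve, flip, e1, e2]
  have hstart₂ : StartsPositive (fun t => evalP (γ₂ t)) (fun t => evalP (extField W K (γ₂ t))) ∧
      StartsPositive (fun t => evalQ (γ₂ t)) (fun t => evalQ (extField W K (γ₂ t))) := by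
    simp only [StartsPositive, hq₂, hp₂, hq₂', hp₂', sub_zero]
    rcases lt_or_gt_of_ne hm with h | h
    · rw [max_eq_right h.le] at hτq hτp'
      have := hτp' h
      exact ⟨Or.inl (by linarith), Or.inr ⟨hτq, by linarith⟩⟩
    · rw [max_eq_left h.le] at hτq hτp
      refine ⟨Or.inr ⟨by rw [hτp rfl, neg_zero], by rw [hτq]; linarith⟩, Or.inl (by rwa [hτq])⟩
  have leg₂ : IsReferenceLeg (extField W K) evalP evalQ γ₂ τ := by
    refine ⟨d₂, hτ, hstart₂.1, hstart₂.2, fun t ht => ?_, fun t ht => ?_, ?_, ?_⟩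
    · rw [hp₂]
      linarith [(hτ' _ (hsub t ht)).1]
    · rw [hq₂]
      rcases ht.2.lt_or_eq with h | h
      · linarith [(hτ' _ (hsub t ⟨ht.1, h⟩)).2]
      · rw [h, sub_self, q0]; exact ha
    · rw [hp₂, sub_self, p0, neg_zero]
    · rw [hp₂', sub_self, q0]; linarith
  rcases lt_or_gt_of_ne hm with h | h
  · rw [max_eq_right h.le] at hτq hτp' hτ'
    have hPτ := hτp' h
    refine ⟨evalQ, -evalP, Or.inl ⟨rfl, rfl⟩, γ₁, γ₂, τ, hγ₁0, hγ₂0, leafPos_mem l₂.le _, hper, ?_, leg₂⟩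
    refine ⟨d₁, hτ, ?_, ?_, fun t ht => ?_, fun t ht => ?_, ?_, ?_⟩
    · simp only [StartsPositive, hq₁, q0]; exact Or.inl ha
    · simp only [StartsPositive, neg_apply, hp₁, hp₁', p0, q0]
      exact Or.inr ⟨neg_zero, by linarith⟩
    · rw [hq₁]; exact (hτ' t ht).2
    · rw [neg_apply, hp₁]
      rcases ht.2.lt_or_eq with h | h
      · linarith [(hτ' t ⟨ht.1, h⟩).1]
      · rw [h]; linarith
    · rw [hq₁, hτq]
    · rw [hq₁']; exact hPτ
  · rw [max_eq_left h.le] at hτq hτp hτ'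
    have hPτ := hτp rfl
    refine ⟨-evalP, evalQ, Or.inr ⟨rfl, rfl⟩, γ₁, γ₂, τ, hγ₁0, hγ₂0, leafPos_mem l₂.le _, hper, ?_, leg₂⟩
    refine ⟨d₁, hτ, ?_, ?_, fun t ht => ?_, fun t ht => ?_, ?_, ?_⟩
    · simp only [StartsPositive, neg_apply, hp₁, hp₁', p0, q0]
      exact Or.inr ⟨neg_zero, by linarith⟩
    · simp only [StartsPositive, hq₁, q0]; exact Or.inl ha
    · rw [neg_apply, hp₁]; linarith [(hτ' t ht).1]
    · rw [hq₁]
      rcases ht.2.lt_or_eq with h' | h'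
      · linarith [(hτ' t ⟨ht.1, h'⟩).2]
      · rw [h', hτq]; exact h
    · rw [neg_apply, hp₁, hPτ, neg_zero]
    · rw [neg_apply, hp₁', hτq]; linarith

end Reference

/-! ### From legs to first returns -/

section Legs

variable {W K : ℝ × (ℝ × ℝ) → ℝ} {σ θ σ' θ' : ExtState →L[ℝ] ℝ} {w w₁ w₂ : ExtState}
  {z z₁ z₂ : ℝ → ExtState} {τ τ₁ τ₂ : ℝ}

lemma IsLeg.param_eq (h : IsLeg (extField W K) σ θ w z τ) {t : ℝ} (ht : t ∈ Icc 0 τ) :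
    (z t).1 = w.1 := by
  have hd : ∀ t ∈ Icc 0 τ, HasDerivAt (fun t => (z t).1) 0 t := fun t ht =>
    (ContinuousLinearMap.fst ℝ ℝ (((ℝ × ℝ) × (ℝ × ℝ)) × ℝ)).hasFDerivAt.comp_hasDerivAt t
      (h.hasDerivAt t ht)
  rw [← h.start]
  exact constant_of_has_deriv_right_zero (fun t ht => (hd t ht).continuousAt.continuousWithinAt)
    (fun t ht => (hd t (Ico_subset_Icc_self ht)).hasDerivWithinAt) t ht

lemma IsLeg.hasDerivAt_state (h : IsLeg (extField W K) σ θ w z τ) {t : ℝ} (ht : t ∈ Icc 0 τ) :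
    HasDerivAt (fun t => (z t).2.1) (hamField (fun q => W (w.1, q)) (z t).2.1) t := by
  have := (((ContinuousLinearMap.fst ℝ ((ℝ × ℝ) × (ℝ × ℝ)) ℝ).comp
    (ContinuousLinearMap.snd ℝ ℝ (((ℝ × ℝ) × (ℝ × ℝ)) × ℝ)))).hasFDerivAt.comp_hasDerivAt t
      (h.hasDerivAt t ht)
  refine this.congr_deriv ?_
  simp [extField, h.param_eq ht]

lemma IsLeg.hasDerivAt_integral (h : IsLeg (extField W K) σ θ w z τ) {t : ℝ} (ht : t ∈ Icc 0 τ) :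
    HasDerivAt (fun t => (z t).2.2) (K (w.1, (z t).2.1.1) * (z t).2.1.2.2) t := by
  have := (((ContinuousLinearMap.snd ℝ ((ℝ × ℝ) × (ℝ × ℝ)) ℝ).comp
    (ContinuousLinearMap.snd ℝ ℝ (((ℝ × ℝ) × (ℝ × ℝ)) × ℝ)))).hasFDerivAt.comp_hasDerivAt t
      (h.hasDerivAt t ht)
  refine this.congr_deriv ?_
  simp [extField, h.param_eq ht]

/-- Along a leg the change of the second energy is measured by the integral. -/
lemma IsLeg.energy_sub (h : IsLeg (extField W K) σ θ w z τ) {V₂ : ℝ → ℝ}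
    (hV₂ : Differentiable ℝ V₂)
    (hK : ∀ ε q, deriv V₂ q.2 - fderiv ℝ (fun q => W (ε, q)) q (0, 1) = ε * K (ε, q)) :
    (z τ).2.1.2.2 ^ 2 / 2 + V₂ (z τ).2.1.1.2 - w.1 * (z τ).2.2 =
      w.2.1.2.2 ^ 2 / 2 + V₂ w.2.1.1.2 - w.1 * w.2.2 := by
  have hd : ∀ t ∈ Icc 0 τ, HasDerivAt
      (fun t => (z t).2.1.2.2 ^ 2 / 2 + V₂ (z t).2.1.1.2 - w.1 * (z t).2.2) 0 t := by
    intro t ht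
    have hz := h.hasDerivAt_state ht
    have hq : HasDerivAt (fun t => (z t).2.1.1.2) ((z t).2.1.2.2) t :=
      (((ContinuousLinearMap.snd ℝ ℝ ℝ).comp
        (ContinuousLinearMap.fst ℝ (ℝ × ℝ) (ℝ × ℝ)))).hasFDerivAt.comp_hasDerivAt t hz
    have hp : HasDerivAt (fun t => (z t).2.1.2.2)
        (-fderiv ℝ (fun q => W (w.1, q)) (z t).2.1.1 (0, 1)) t :=
      (((ContinuousLinearMap.snd ℝ ℝ ℝ).comp
        (ContinuousLinearMap.snd ℝ (ℝ × ℝ) (ℝ × ℝ)))).hasFDerivAt.comp_hasDerivAt t hz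
    have hVq := (hV₂ (z t).2.1.1.2).hasDerivAt.comp t hq
    refine ((((hp.fun_pow 2).div_const 2).fun_add hVq).fun_sub
      ((h.hasDerivAt_integral ht).const_mul w.1)).congr_deriv ?_
    have := hK w.1 (z t).2.1.1
    linear_combination (z t).2.1.2.2 * this
  have := constant_of_has_deriv_right_zero
    (fun t ht => (hd t ht).continuousAt.continuousWithinAt)
    (fun t ht => (hd t (Ico_subset_Icc_self ht)).hasDerivWithinAt) τ ⟨h.pos.le, le_rfl⟩
  rw [this, h.start]

/-- Event and guard exchange roles between the two cases, but together they always give q₁ > 0 and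
p₁ < 0 inside the first leg. Transversality of the event gives the sign of the force at a turning
point. -/
lemma isTwoLegMotion_of_legs {ε a x y : ℝ} (hp : IsEventPair σ θ)
    (h₁ : IsLeg (extField W K) σ θ (ε, ((a, x), (0, y)), 0) z₁ τ₁)
    (h₂ : IsLeg (extField W K) evalP evalQ (flip (z₁ τ₁)) z₂ τ₂) (ha : 0 < a)
    (hd : 0 < (grad (fun q => W (ε, q)) (a, x)).1) :
    IsTwoLegMotion (fun q => W (ε, q)) τ₁ τ₂ (fun t => (z₁ t).2.1) (fun t => (z₂ t).2.1) := by
  have t₁ : τ₁ ∈ Icc 0 τ₁ := ⟨h₁.pos.le, le_rfl⟩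
  have t₂ : τ₂ ∈ Icc 0 τ₂ := ⟨h₂.pos.le, le_rfl⟩
  have hε : (flip (z₁ τ₁)).1 = ε := by
    simp only [flip]; rw [h₁.param_eq t₁]
  have hin : ∀ t ∈ Ico 0 τ₁, 0 < (z₁ t).2.1.1.1 := by
    intro t ht
    rcases ht.1.eq_or_lt with rfl | h0
    · rw [h₁.start]; exact ha
    · rcases hp with ⟨rfl, rfl⟩ | ⟨rfl, rfl⟩
      · exact h₁.event_pos t ⟨h0, ht.2⟩
      · exact h₁.guard_pos t ⟨h0, ht.2.le⟩
  refine ⟨h₁.pos, h₂.pos, fun t ht => h₁.hasDerivAt_state ht, fun t ht => ?_, hin,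
    fun t ht => h₂.guard_pos t ht, ?_, ?_, ?_, fun t ht => h₂.event_pos t ht, ?_, ?_⟩
  · have := h₂.hasDerivAt_state ht
    rwa [hε] at this
  · rw [h₂.start]; rfl
  · rcases hp with ⟨rfl, rfl⟩ | ⟨rfl, rfl⟩
    · exact Or.inl ⟨h₁.event_eq, by have := h₁.guard_pos τ₁ ⟨h₁.pos, le_rfl⟩; simpa using this⟩
    · have e1 := h₁.event_eq
      have e2 := h₁.transversal
      simp only [neg_apply, evalP_apply, neg_eq_zero] at e1 e2
      simp only [extField, hamField, h₁.param_eq t₁, Prod.fst_neg, neg_neg] at e2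
      exact Or.inr ⟨h₁.guard_pos τ₁ ⟨h₁.pos, le_rfl⟩, e1, e2⟩
  · intro t ht
    rcases hp with ⟨rfl, rfl⟩ | ⟨rfl, rfl⟩
    · have := h₁.guard_pos t ⟨ht.1, ht.2.le⟩
      simpa using this
    · have := h₁.event_pos t ht
      simpa using this
  · simp only [h₁.start]
    exact ⟨rfl, by linarith⟩
  · have e2 := h₂.transversal
    simp only [evalP_apply, extField, hamField, h₂.param_eq t₂, hε] at e2
    exact ⟨h₂.event_eq, e2⟩

/-- The first return composed of two legs, with the change of the second energy. -/
theorem exists_isFirstReturn_of_legs {ε a x y : ℝ} (hK : Continuous K)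
    (hp : IsEventPair σ θ)
    (h₁ : IsLeg (extField W K) σ θ (ε, ((a, x), (0, y)), 0) z₁ τ₁)
    (h₂ : IsLeg (extField W K) evalP evalQ (flip (z₁ τ₁)) z₂ τ₂) (ha : 0 < a)
    (hd : 0 < (grad (fun q => W (ε, q)) (a, x)).1) {V₂ : ℝ → ℝ} (hV₂ : Differentiable ℝ V₂)
    (hKW : ∀ ε q, deriv V₂ q.2 - fderiv ℝ (fun q => W (ε, q)) q (0, 1) = ε * K (ε, q)) :
    ∃ q p : ℝ → ℝ × ℝ, IsFirstReturn (fun q => W (ε, q)) (1, 0)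
        (turningSection (fun q => W (ε, q))) (τ₁ + τ₂) q p ∧
      q 0 = (a, x) ∧ p 0 = (0, y) ∧ (q (τ₁ + τ₂), p (τ₁ + τ₂)) = (z₂ τ₂).2.1 ∧
      (∀ t ∈ Ico 0 (τ₁ + τ₂), 0 < (q t).1 ∨ 0 < (p t).1) ∧
      (z₂ τ₂).2.1.2.2 ^ 2 / 2 + V₂ (z₂ τ₂).2.1.1.2 = y ^ 2 / 2 + V₂ x + ε * (z₂ τ₂).2.2 ∧
      ∫ t in (0 : ℝ)..(τ₁ + τ₂), K (ε, q t) * (p t).2 = (z₂ τ₂).2.2 := by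
  have h := isTwoLegMotion_of_legs hp h₁ h₂ ha hd
  have t₁ : τ₁ ∈ Icc 0 τ₁ := ⟨h₁.pos.le, le_rfl⟩
  have hε : (flip (z₁ τ₁)).1 = ε := by
    simp only [flip]; rw [h₁.param_eq t₁]
  refine ⟨_, _, h.isFirstReturn, ?_, ?_, ?_, h.pos_or_pos, ?_, ?_⟩
  · rw [joinAt_of_lt h₁.pos, h₁.start]
  · rw [joinAt_of_lt h₁.pos, h₁.start]
  · rw [joinAt_of_ge (by linarith [h₂.pos]), add_sub_cancel_left]
  -- The reversal of p₁ alters neither the second degree of freedom nor the running integral, so the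
  -- energy balances of the two legs add up.
  · have e1 := h₁.energy_sub hV₂ hKW
    have e2 := h₂.energy_sub hV₂ hKW
    rw [hε] at e2
    simp only [flip] at e2
    simp only at e1
    linarith
  · have := h.integral_eq (F := fun z => K (ε, z.1) * z.2.2) (s₁ := fun t => (z₁ t).2.2)
      (s₂ := fun t => (z₂ t).2.2) (by fun_prop) (fun t ht => h₁.hasDerivAt_integral ht)
      (fun t ht => by have := h₂.hasDerivAt_integral ht; rwa [hε] at this)
      (by rw [h₂.start]; rfl)
    rw [this, h₁.start]
    simp

end Legs

end ImpactSystem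

end

/-! ### The local return map and the perturbed energy surface -/

noncomputable section

namespace ImpactSystem

open Set Filter Topology MeasureTheory

/-! ### The return map near an unperturbed motion -/

/-- The extended state at the beginning of a motion on the cross-section. -/
def initState (ε a x y : ℝ) : ExtState := (ε, ((a, x), (0, y)), 0)

lemma dist_initState_lt {ε a x y ε' a' x' y' r : ℝ} (hε : |ε - ε'| < r) (ha : |a - a'| < r)
    (hx : |x - x'| < r) (hy : |y - y'| < r) :
    dist (initState ε a x y) (initState ε' a' x' y') < r := by
  have : 0 < r := (abs_nonneg _).trans_lt hε
  simp [initState, Prod.dist_eq, Real.dist_eq, *]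

lemma dist_initState_le (ε a x y ε' a' : ℝ) :
    dist (initState ε a x y) (initState ε' a' x y) ≤ |ε - ε'| + |a - a'| := by
  have h1 := abs_nonneg (ε - ε')
  have h2 := abs_nonneg (a - a')
  simp [initState, Prod.dist_eq, Real.dist_eq]

/-- The unperturbed motions to which perturbation theory applies: the turning point `a > 0` of the
first degree of freedom belongs to a regular leaf that is not tangent to the wall, and the leaf of
the second degree of freedom is regular or a center. -/
def IsRegularStart (V₁ V₂ : ℝ → ℝ) (a x y : ℝ) : Prop :=
  0 < a ∧ ∃ m c d : ℝ, IsLeaf V₁ m a (V₁ a) ∧ m < a ∧ m ≠ 0 ∧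
    IsLeaf V₂ c d (y ^ 2 / 2 + V₂ x) ∧ x ∈ Icc c d

section

variable {W K : ℝ × (ℝ × ℝ) → ℝ} {V₁ V₂ : ℝ → ℝ}

lemma grad_fst_zero (hV₁ : ContDiff ℝ 3 V₁) (hV₂ : ContDiff ℝ 3 V₂)
    (hW0 : ∀ q, W (0, q) = V₁ q.1 + V₂ q.2) (a x : ℝ) :
    (grad (fun q => W (0, q)) (a, x)).1 = deriv V₁ a := by
  simp only [hW0]
  rw [grad_separable (hV₁.differentiable (by norm_num)) (hV₂.differentiable (by norm_num))]

/-- The unperturbed first return, with its explicit return time. -/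
theorem IsRegularStart.exists_isFirstReturn {a x y : ℝ} (h : IsRegularStart V₁ V₂ a x y)
    (hV₁ : ContDiff ℝ 3 V₁) (hV₂ : ContDiff ℝ 3 V₂) (hW0 : ∀ q, W (0, q) = V₁ q.1 + V₂ q.2)
    (hK : Continuous K)
    (hKW : ∀ ε q, deriv V₂ q.2 - fderiv ℝ (fun q => W (ε, q)) q (0, 1) = ε * K (ε, q)) :
    ∃ q p : ℝ → ℝ × ℝ, IsFirstReturn (fun q => W (0, q)) (1, 0)
        (turningSection (fun q => W (0, q))) (impactPeriod V₁ a (V₁ a)) q p ∧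
      q 0 = (a, x) ∧ p 0 = (0, y) := by
  obtain ⟨ha, m, c, d, l₁, hma, hm, l₂, hx⟩ := h
  obtain ⟨σ, θ, hp, γ₁, γ₂, τ, e1, e2, -, hτ, r₁, r₂⟩ :=
    exists_referenceLegs hV₁ hV₂ hW0 hK l₁ hma ha hm l₂ hx rfl
  have g₁ := r₁.isLeg
  have g₂ := r₂.isLeg
  rw [e1] at g₁
  rw [e2] at g₂
  have hd : 0 < (grad (fun q => W (0, q)) (a, x)).1 := by
    rw [grad_fst_zero hV₁ hV₂ hW0]; exact (l₁.deriv_signs hma).2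
  obtain ⟨q, p, h1, h2, h3, -⟩ := exists_isFirstReturn_of_legs hK hp g₁ g₂ ha hd
    (hV₂.differentiable (by norm_num)) hKW
  rw [← two_mul, hτ] at h1
  exact ⟨q, p, h1, h2, h3⟩

/-- Motions starting near a regular unperturbed motion return, with a Lipschitz dependence on the
perturbation and on the initial state. -/
theorem IsRegularStart.exists_returnMap {a x y : ℝ} (h : IsRegularStart V₁ V₂ a x y)
    (hV₁ : ContDiff ℝ 3 V₁) (hV₂ : ContDiff ℝ 3 V₂) (hW : ContDiff ℝ 2 W)
    (hW0 : ∀ q, W (0, q) = V₁ q.1 + V₂ q.2) (hK : ContDiff ℝ 1 K)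
    (hKW : ∀ ε q, deriv V₂ q.2 - fderiv ℝ (fun q => W (ε, q)) q (0, 1) = ε * K (ε, q))
    {c d : ℝ} (l₂ : IsLeaf V₂ c d (y ^ 2 / 2 + V₂ x)) (hx : x ∈ Icc c d) :
    ∃ r > 0, ∃ L > 0, ∃ Z : ExtState → ExtState, (Z (initState 0 a x y)).2.1.1.2 ∈ Icc c d ∧
      ∀ ε a' x' y', dist (initState ε a' x' y') (initState 0 a x y) < r →
        (∃ (T : ℝ) (q p : ℝ → ℝ × ℝ), IsFirstReturn (fun q => W (ε, q)) (1, 0)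
            (turningSection (fun q => W (ε, q))) T q p ∧
          q 0 = (a', x') ∧ p 0 = (0, y') ∧ (q T, p T) = (Z (initState ε a' x' y')).2.1 ∧
          (∀ t ∈ Ico 0 T, 0 < (q t).1 ∨ 0 < (p t).1) ∧
          (Z (initState ε a' x' y')).2.1.2.2 ^ 2 / 2 + V₂ (Z (initState ε a' x' y')).2.1.1.2 =
            y' ^ 2 / 2 + V₂ x' + ε * (Z (initState ε a' x' y')).2.2 ∧
          ∫ t in (0 : ℝ)..T, K (ε, q t) * (p t).2 = (Z (initState ε a' x' y')).2.2) ∧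
        ∀ ε'' a'' x'' y'', dist (initState ε'' a'' x'' y'') (initState 0 a x y) < r →
          dist (Z (initState ε a' x' y')) (Z (initState ε'' a'' x'' y'')) ≤
            L * dist (initState ε a' x' y') (initState ε'' a'' x'' y'') := by
  obtain ⟨ha, m, -, -, l₁, hma, hm, -, -⟩ := h
  obtain ⟨σ, θ, hp, γ₁, γ₂, τ, e1, e2, he, -, r₁, r₂⟩ :=
    exists_referenceLegs hV₁ hV₂ hW0 hK.continuous l₁ hma ha hm l₂ hx rfl
  have hX := contDiff_extField hW hK
  obtain ⟨ρ₁, hρ₁, L₁, hL₁, Φ₁, τ₁, b₁, H₁⟩ := r₁.exists_legs hX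
  obtain ⟨ρ₂, hρ₂, L₂, hL₂, Φ₂, τ₂, b₂, H₂⟩ := r₂.exists_legs hX
  have e1' : γ₁ 0 = initState 0 a x y := e1
  -- Every state considered has p₁ = 0 exactly; the condition on q₁ is void because `a > 0`.
  have hstart₁ : ∀ ε a' x' y', (σ (γ₁ 0) = 0 → σ (initState ε a' x' y') = 0) ∧
      (θ (γ₁ 0) = 0 → θ (initState ε a' x' y') = 0) := by
    intro ε a' x' y'
    rcases hp with ⟨rfl, rfl⟩ | ⟨rfl, rfl⟩
    · exact ⟨fun h => absurd (by rw [e1] at h; exact h) ha.ne', fun _ => by simp [initState]⟩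
    · exact ⟨fun _ => by simp [initState], fun h => absurd (by rw [e1] at h; exact h) ha.ne'⟩
  -- The first leg ends with its event satisfied exactly, and this is the functional that vanishes
  -- at the start of the reference second leg. The other one is nonzero there, by the guard.
  have hstart₂ : ∀ ε a' x' y', initState ε a' x' y' ∈ Metric.ball (γ₁ 0) ρ₁ →
      (evalP (γ₂ 0) = 0 → evalP (flip (Φ₁ (initState ε a' x' y') (τ₁ (initState ε a' x' y')))) = 0) ∧
      (evalQ (γ₂ 0) = 0 →
        evalQ (flip (Φ₁ (initState ε a' x' y') (τ₁ (initState ε a' x' y')))) = 0) := by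
    intro ε a' x' y' hw
    have hl := (H₁ _ hw (hstart₁ ε a' x' y').1 (hstart₁ ε a' x' y').2).1
    rw [e2]
    have hg := r₁.guard_pos τ ⟨r₁.pos, le_rfl⟩
    have hev := hl.event_eq
    rcases hp with ⟨rfl, rfl⟩ | ⟨rfl, rfl⟩
    · refine ⟨fun h => absurd h ?_, fun _ => hev⟩
      simp only [evalP_apply, flip]
      simp only [neg_apply, evalP_apply] at hg
      exact hg.ne'
    · refine ⟨fun _ => ?_, fun h => absurd h hg.ne'⟩
      simpa only [neg_apply, evalP_apply, flip] using hev
  have hgrad : ∀ᶠ w : ExtState in 𝓝 (γ₁ 0), 0 < w.2.1.1.1 ∧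
      0 < (grad (fun q => W (w.1, q)) w.2.1.1).1 := by
    have c1 : Continuous fun w : ExtState => w.2.1.1.1 := by fun_prop
    have c2 : Continuous fun w : ExtState => (grad (fun q => W (w.1, q)) w.2.1.1).1 := by
      have := hX.continuous
      have h3 : Continuous fun w : ExtState => -evalP (extField W K w) :=
        (evalP.continuous.comp this).neg
      refine h3.congr fun w => ?_
      simp [extField, hamField]
    have h1 : 0 < (γ₁ 0).2.1.1.1 := by rw [e1]; exact ha
    have h2 : 0 < (grad (fun q => W ((γ₁ 0).1, q)) (γ₁ 0).2.1.1).1 := by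
      rw [e1]
      simp only
      rw [grad_fst_zero hV₁ hV₂ hW0]; exact (l₁.deriv_signs hma).2
    exact (c1.continuousAt.eventually (lt_mem_nhds h1)).and
      (c2.continuousAt.eventually (lt_mem_nhds h2))
  obtain ⟨ρ₃, hρ₃, H₃⟩ := Metric.eventually_nhds_iff.1 hgrad
  have hmid : Φ₁ (γ₁ 0) (τ₁ (γ₁ 0)) = γ₁ τ := b₁
  set Y : ExtState → ExtState := fun w => flip (Φ₁ w (τ₁ w)) with hY
  have hY0 : Y (γ₁ 0) = γ₂ 0 := by simp only [hY, hmid, e2]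
  -- The bound `ρ₂ / L₁` keeps the end of the first leg in the domain of the second.
  set r := min ρ₁ (min ρ₃ (ρ₂ / L₁)) with hr
  have hr1 : r ≤ ρ₁ := min_le_left _ _
  have hr3 : r ≤ ρ₃ := (min_le_right _ _).trans (min_le_left _ _)
  have hr2 : r ≤ ρ₂ / L₁ := (min_le_right _ _).trans (min_le_right _ _)
  have hball : ∀ ε a' x' y', dist (initState ε a' x' y') (initState 0 a x y) < r →
      initState ε a' x' y' ∈ Metric.ball (γ₁ 0) ρ₁ := fun ε a' x' y' hw => by
    rw [e1']; exact lt_of_lt_of_le hw hr1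
  have hYlip : ∀ ε a' x' y', dist (initState ε a' x' y') (initState 0 a x y) < r →
      ∀ ε'' a'' x'' y'', dist (initState ε'' a'' x'' y'') (initState 0 a x y) < r →
      dist (Y (initState ε a' x' y')) (Y (initState ε'' a'' x'' y'')) ≤
        L₁ * dist (initState ε a' x' y') (initState ε'' a'' x'' y'') := by
    intro ε a' x' y' hw ε'' a'' x'' y'' hw'
    rw [hY]
    simp only [dist_flip]
    exact (H₁ _ (hball _ _ _ _ hw) (hstart₁ _ _ _ _).1 (hstart₁ _ _ _ _).2).2 _
      (hball _ _ _ _ hw') (hstart₁ _ _ _ _).1 (hstart₁ _ _ _ _).2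
  have hr0 : 0 < r := by positivity
  have hYball : ∀ ε a' x' y', dist (initState ε a' x' y') (initState 0 a x y) < r →
      Y (initState ε a' x' y') ∈ Metric.ball (γ₂ 0) ρ₂ := by
    intro ε a' x' y' hw
    have h1 := hYlip _ _ _ _ hw 0 a x y (by rw [dist_self]; exact hr0)
    rw [← e1', hY0, e1'] at h1
    refine lt_of_le_of_lt h1 ?_
    rw [mul_comm, ← lt_div_iff₀ hL₁]
    exact hw.trans_le hr2
  refine ⟨r, hr0, L₂ * L₁, by positivity, fun w => Φ₂ (Y w) (τ₂ (Y w)), ?_,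
    fun ε a' x' y' hw => ⟨?_, fun ε'' a'' x'' y'' hw' => ?_⟩⟩
  · rw [← e1']
    change (Φ₂ (Y (γ₁ 0)) (τ₂ (Y (γ₁ 0)))).2.1.1.2 ∈ Icc c d
    rw [hY0, b₂]; exact he
  · have g₁ := (H₁ _ (hball _ _ _ _ hw) (hstart₁ _ _ _ _).1 (hstart₁ _ _ _ _).2).1
    have g₂ := (H₂ _ (hYball _ _ _ _ hw) (hstart₂ _ _ _ _ (hball _ _ _ _ hw)).1
      (hstart₂ _ _ _ _ (hball _ _ _ _ hw)).2).1
    obtain ⟨h3, h4⟩ := H₃ (y := initState ε a' x' y') (by rw [e1']; exact hw.trans_le hr3)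
    obtain ⟨q, p, hqp⟩ := exists_isFirstReturn_of_legs hK.continuous hp g₁ g₂ h3 h4
      (hV₂.differentiable (by norm_num)) hKW
    exact ⟨_, q, p, hqp⟩
  · refine ((H₂ _ (hYball _ _ _ _ hw) (hstart₂ _ _ _ _ (hball _ _ _ _ hw)).1
      (hstart₂ _ _ _ _ (hball _ _ _ _ hw)).2).2 _ (hYball _ _ _ _ hw')
      (hstart₂ _ _ _ _ (hball _ _ _ _ hw')).1 (hstart₂ _ _ _ _ (hball _ _ _ _ hw')).2).trans ?_
    rw [mul_assoc]
    exact mul_le_mul_of_nonneg_left (hYlip _ _ _ _ hw _ _ _ _ hw') hL₂.le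

/-- The energy surface near the section: the first position is a function of the other data. -/
theorem exists_energy_eq (hW : ContDiff ℝ 2 W) {a₀ x₀ : ℝ}
    (hd : 0 < (grad (fun q => W (0, q)) (a₀, x₀)).1) :
    ∃ r > 0, ∃ M : ℝ, ∀ η > 0, η ≤ r → ∃ ε₀ > 0, ∀ a x : ℝ, |a - a₀| < r → |x - x₀| < r →
      ∀ ε : ℝ, |ε| < ε₀ → ∃ a', |a' - a| < η ∧ W (ε, (a', x)) = W (0, (a, x)) ∧
        |a' - a| ≤ M * |ε| ∧
        ∀ b, |b - a| < η → W (ε, (b, x)) = W (0, (a, x)) → b = a' := by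
  have hWd : Differentiable ℝ W := hW.differentiable (by norm_num)
  set D : ℝ × (ℝ × ℝ) → ℝ := fun v => fderiv ℝ W v (0, (1, 0)) with hD
  have hDc : Continuous D :=
    (hW.continuous_fderiv (by norm_num)).clm_apply continuous_const
  have hD0 : 0 < D (0, (a₀, x₀)) := by
    simpa only [grad, fderiv_section hWd] using hd
  set c := D (0, (a₀, x₀)) / 2 with hc
  have hc0 : 0 < c := by positivity
  obtain ⟨κ, N, hN, hκ⟩ := ((hW.of_le (by norm_num : (1 : WithTop ℕ∞) ≤ 2)).contDiffAt
    (x := (0, (a₀, x₀)))).exists_lipschitzOnWith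
  obtain ⟨ρ, hρ, Hρ⟩ := Metric.eventually_nhds_iff.1
    ((hDc.continuousAt.eventually (lt_mem_nhds (by linarith : c < D (0, (a₀, x₀))))).and hN)
  have Hρ' : ∀ ε a x, |ε| < ρ → |a - a₀| < ρ → |x - x₀| < ρ →
      c < D (ε, (a, x)) ∧ (ε, (a, x)) ∈ N := fun ε a x h1 h2 h3 => by
    apply Hρ
    simp [Prod.dist_eq, Real.dist_eq, *]
  have hκ0 : (0 : ℝ) ≤ κ := κ.2
  -- Switching on ε moves W at `a` by at most `κ * |ε| < c * η`, whereas moving the position by η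
  -- changes W by at least `c * η`. So the level is attained within η, at distance at most `κ / c *
  -- |ε|`; strict monotonicity makes it unique. The `+ 1` covers `κ = 0`.
  refine ⟨ρ / 2, by positivity, κ / c, fun η hη hηr => ⟨min ρ (c * η / (κ + 1)), by positivity,
    fun a x ha hx ε hε => ?_⟩⟩
  have hερ : |ε| < ρ := hε.trans_le (min_le_left _ _)
  have hεc := hε.trans_le (min_le_right _ _)
  rw [lt_div_iff₀ (by positivity)] at hεc
  set φ : ℝ → ℝ := fun b => W (ε, (b, x)) with hφ
  have hφd : ∀ b, HasDerivAt φ (D (ε, (b, x))) b := fun b => by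
    have h1 : HasDerivAt (fun b : ℝ => ((ε, (b, x)) : ℝ × (ℝ × ℝ))) (0, (1, 0)) b :=
      (hasDerivAt_const b ε).prodMk ((hasDerivAt_id b).prodMk (hasDerivAt_const b x))
    exact (hWd (ε, (b, x))).hasFDerivAt.comp_hasDerivAt b h1
  have hxρ : |x - x₀| < ρ := by linarith
  have hI : ∀ b ∈ Icc (a - η) (a + η), |b - a₀| < ρ := fun b hb => by
    have h1 := abs_lt.1 ha
    rw [abs_lt]; constructor <;> linarith [hb.1, hb.2]
  have hmono : ∀ b ∈ Icc (a - η) (a + η), ∀ b' ∈ Icc (a - η) (a + η), b ≤ b' →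
      c * (b' - b) ≤ φ b' - φ b := fun b hb b' hb' hle =>
    (convex_Icc (a - η) (a + η)).mul_sub_le_image_sub_of_le_deriv
      (fun z _ => (hφd z).continuousAt.continuousWithinAt)
      (fun z _ => (hφd z).differentiableAt.differentiableWithinAt)
      (fun z hz => by
        rw [(hφd z).deriv]
        exact (Hρ' ε z x hερ (hI z (interior_subset hz)) hxρ).1.le) b hb b' hb' hle
  have hdist : ∀ b ∈ Icc (a - η) (a + η), ∀ b' ∈ Icc (a - η) (a + η),
      c * |b' - b| ≤ |φ b' - φ b| := by
    intro b hb b' hb'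
    rcases le_total b b' with hle | hle
    · rw [abs_of_nonneg (sub_nonneg.2 hle)]
      exact (hmono b hb b' hb' hle).trans (le_abs_self _)
    · rw [abs_sub_comm, abs_sub_comm (φ b'), abs_of_nonneg (sub_nonneg.2 hle)]
      exact (hmono b' hb' b hb hle).trans (le_abs_self _)
  have hW₀ : |φ a - W (0, (a, x))| ≤ κ * |ε| := by
    have haρ : |a - a₀| < ρ := by linarith
    have := hκ.dist_le_mul _ (Hρ' ε a x hερ haρ hxρ).2 _
      (Hρ' 0 a x (by simpa using hρ) haρ hxρ).2
    simpa [Prod.dist_eq, Real.dist_eq] using this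
  have hm : a ∈ Icc (a - η) (a + η) := ⟨by linarith, by linarith⟩
  have hl : a - η ∈ Icc (a - η) (a + η) := ⟨le_rfl, by linarith⟩
  have hu : a + η ∈ Icc (a - η) (a + η) := ⟨by linarith, le_rfl⟩
  have h1 := hmono _ hl _ hm (by linarith)
  have h2 := hmono _ hm _ hu (by linarith)
  have h3 := abs_le.1 hW₀
  have h4 := abs_nonneg ε
  obtain ⟨a', ha', he⟩ : ∃ a' ∈ Ioo (a - η) (a + η), φ a' = W (0, (a, x)) :=
    intermediate_value_Ioo (by linarith)
      (fun z _ => (hφd z).continuousAt.continuousWithinAt) ⟨by nlinarith, by nlinarith⟩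
  refine ⟨a', by rw [abs_lt]; constructor <;> linarith [ha'.1, ha'.2], he, ?_, fun b hb hbe => ?_⟩
  · have h5 := hdist a hm a' (Ioo_subset_Icc_self ha')
    rw [he, abs_sub_comm (W (0, (a, x)))] at h5
    rw [div_mul_eq_mul_div, le_div_iff₀ hc0]
    linarith
  · have hb' := abs_lt.1 hb
    have h5 := hdist a' (Ioo_subset_Icc_self ha') b ⟨by linarith, by linarith⟩
    have h6 : φ b = φ a' := by rw [he]; exact hbe
    rw [h6, sub_self, abs_zero] at h5
    have h7 : |b - a'| ≤ 0 := by
      by_contra hlt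
      push Not at hlt
      nlinarith
    have := abs_eq_zero.1 (le_antisymm h7 (abs_nonneg _))
    linarith

end

end ImpactSystem

end

/-! ### The first-order formula, locally in the initial condition -/

noncomputable section

namespace ImpactSystem

open Set Filter Topology MeasureTheory

/-! ### The first-order formula near an unperturbed motion -/

/-- The first-order formula for the change of the second action for the family `W` of potentials
with a perpendicular wall, at a single initial condition. -/
def HasActionFormula (W K : ℝ × (ℝ × ℝ) → ℝ) (V₁ V₂ : ℝ → ℝ) (η ε₀ C a x y : ℝ) : Prop :=
  ∃ q p : ℝ → ℝ × ℝ,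
    IsFirstReturn (fun q => W (0, q)) (1, 0) (turningSection (fun q => W (0, q)))
      (impactPeriod V₁ a (V₁ a)) q p ∧ q 0 = (a, x) ∧ p 0 = (0, y) ∧
    ∀ ε : ℝ, |ε| < ε₀ → ∃ a' : ℝ, (|a' - a| < η ∧ W (ε, (a', x)) = W (0, (a, x))) ∧
      (∀ b : ℝ, |b - a| < η → W (ε, (b, x)) = W (0, (a, x)) → b = a') ∧
      ∃ z : (ℝ × ℝ) × (ℝ × ℝ), {z | ∃ (T : ℝ) (q p : ℝ → ℝ × ℝ),
          IsFirstReturn (fun q => W (ε, q)) (1, 0) (turningSection (fun q => W (ε, q))) T q p ∧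
          q 0 = (a', x) ∧ p 0 = (0, y) ∧ z = (q T, p T)} = {z} ∧
        ∃ f : ℝ, action V₂ z.1.2 (z.2.2 ^ 2 / 2 + V₂ z.1.2) =
            action V₂ x (y ^ 2 / 2 + V₂ x) + ε * f ∧
          |f - 1 / freq V₂ x (y ^ 2 / 2 + V₂ x) *
            ∫ t in (0 : ℝ)..impactPeriod V₁ a (V₁ a), K (0, q t) * (p t).2| ≤ C * |ε|

lemma HasActionFormula.mono {W K : ℝ × (ℝ × ℝ) → ℝ} {V₁ V₂ : ℝ → ℝ} {η ε₀ ε₁ C C' a x y : ℝ}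
    (h : HasActionFormula W K V₁ V₂ η ε₀ C a x y) (hε : ε₁ ≤ ε₀) (hC : C ≤ C') :
    HasActionFormula W K V₁ V₂ η ε₁ C' a x y := by
  obtain ⟨q, p, h1, h2, h3, h4⟩ := h
  refine ⟨q, p, h1, h2, h3, fun ε hlt => ?_⟩
  obtain ⟨a', h5, h6, z, h7, f, h8, h9⟩ := h4 ε (hlt.trans_le hε)
  exact ⟨a', h5, h6, z, h7, f, h8, h9.trans (mul_le_mul_of_nonneg_right hC (abs_nonneg _))⟩

/-- A first-order expansion in the energy together with a Lipschitz bound bounds the derivative. -/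
lemma abs_deriv_le_of_expansion {A : ℝ → ℝ} {A' v y e σ M : ℝ} (hy : |y ^ 2 / 2 + v - e| < σ)
    (hA : ∀ y', |y' ^ 2 / 2 + v - e| < σ →
      |A (y' ^ 2 / 2 + v) - A (y ^ 2 / 2 + v)| ≤ M * |y' ^ 2 / 2 + v - (y ^ 2 / 2 + v)|)
    (hA' : ∀ y', |y' ^ 2 / 2 + v - e| < σ →
      |A (y' ^ 2 / 2 + v) - A (y ^ 2 / 2 + v) - A' * (y' ^ 2 / 2 + v - (y ^ 2 / 2 + v))| ≤
        M * |y - y'| ^ 2) : |A'| ≤ 3 * M := by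
  set g := σ - |y ^ 2 / 2 + v - e| with hg
  have hg0 : 0 < g := by linarith
  -- The momentum is moved by `t` away from 0, which raises the energy by Δ = |y| t + t²/2 while
  -- staying in the allowed range. Since t² ≤ 2Δ, the quadratic error is at most 2MΔ, and with the
  -- Lipschitz term MΔ this gives the factor 3, also at y = 0.
  set t := min 1 (g / (|y| + 1)) with ht
  have hy0 := abs_nonneg y
  have ht0 : 0 < t := by positivity
  have ht1 : t ≤ 1 := min_le_left _ _
  have htg : t * (|y| + 1) ≤ g := by
    rw [← le_div_iff₀ (by positivity)]; exact min_le_right _ _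
  obtain ⟨y', hy', hΔ⟩ : ∃ y', |y - y'| = t ∧
      y' ^ 2 / 2 + v - (y ^ 2 / 2 + v) = |y| * t + t ^ 2 / 2 := by
    rcases le_total 0 y with h | h
    · exact ⟨y + t, by rw [sub_add_cancel_left, abs_neg, abs_of_pos ht0], by
        rw [abs_of_nonneg h]; ring⟩
    · exact ⟨y - t, by rw [sub_sub_cancel, abs_of_pos ht0], by
        rw [abs_of_nonpos h]; ring⟩
  set Δ := |y| * t + t ^ 2 / 2 with hΔd
  have hΔ0 : 0 < Δ := by positivity
  have hΔg : Δ < g := by nlinarith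
  have hlt : |y' ^ 2 / 2 + v - e| < σ := by
    have : y' ^ 2 / 2 + v - e = (y ^ 2 / 2 + v - e) + Δ := by linarith
    rw [this]
    refine (abs_add_le _ _).trans_lt ?_
    rw [abs_of_pos hΔ0]
    linarith
  have h1 := hA y' hlt
  have h2 := hA' y' hlt
  rw [hΔ] at h1 h2
  rw [abs_of_pos hΔ0] at h1
  rw [hy'] at h2
  have hM : 0 ≤ M := by
    by_contra hlt
    push Not at hlt
    have := (abs_nonneg _).trans h1
    nlinarith
  have h3 : |A' * Δ| ≤ M * Δ + M * t ^ 2 := by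
    have := abs_sub_abs_le_abs_sub (A' * Δ) (A (y' ^ 2 / 2 + v) - A (y ^ 2 / 2 + v))
    rw [abs_sub_comm (A' * Δ)] at this
    linarith
  rw [abs_mul, abs_of_pos hΔ0] at h3
  have h4 : t ^ 2 ≤ 2 * Δ := by nlinarith
  have h5 : |A'| * Δ ≤ 3 * M * Δ := by nlinarith
  exact le_of_mul_le_mul_right h5 hΔ0

/-- The first-order difference quotient, from a quadratic error bound. -/
lemma exists_quotient_bound {A₀ A₁ ε S₀ S₁ A' D M : ℝ} (h0 : ε = 0 → A₁ = A₀)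
    (h1 : |A₁ - A₀ - A' * (ε * S₁)| ≤ M * (2 * (D * |ε|)) ^ 2) (h2 : |S₁ - S₀| ≤ D * |ε|)
    (h3 : |A'| ≤ 3 * M) :
    ∃ f, A₁ = A₀ + ε * f ∧ |f - A' * S₀| ≤ (4 * M * D ^ 2 + 3 * M * D) * |ε| := by
  rcases eq_or_ne ε 0 with rfl | hε
  · exact ⟨A' * S₀, by rw [h0 rfl]; ring, by simp⟩
  · have hε' := abs_pos.2 hε
    refine ⟨(A₁ - A₀) / ε, by field_simp; ring, ?_⟩
    have e1 : (A₁ - A₀) / ε - A' * S₀ = (A₁ - A₀ - A' * (ε * S₁)) / ε + A' * (S₁ - S₀) := by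
      field_simp; ring
    have e2 : |(A₁ - A₀ - A' * (ε * S₁)) / ε| ≤ 4 * M * D ^ 2 * |ε| := by
      rw [abs_div, div_le_iff₀ hε']
      linarith
    have e3 : |A' * (S₁ - S₀)| ≤ 3 * M * D * |ε| := by
      rw [abs_mul]
      calc |A'| * |S₁ - S₀| ≤ 3 * M * (D * |ε|) :=
            mul_le_mul h3 h2 (abs_nonneg _) ((abs_nonneg _).trans h3)
        _ = _ := by ring
    rw [e1]
    refine (abs_add_le _ _).trans ?_
    linarith

/-- The perturbed and unperturbed end states are O(ε) apart, and so are the two integrals. The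
second energies at these ends differ by exactly ε times the perturbed integral. The expansion of the
action is applied between the two end states; at the unperturbed one the second energy is still the
initial one. -/
theorem IsRegularStart.exists_hasActionFormula {W K : ℝ × (ℝ × ℝ) → ℝ} {V₁ V₂ : ℝ → ℝ}
    {a₀ x₀ y₀ : ℝ} (h : IsRegularStart V₁ V₂ a₀ x₀ y₀)
    (hV₁ : ContDiff ℝ 3 V₁) (hV₂ : ContDiff ℝ 3 V₂) (hW : ContDiff ℝ 2 W)
    (hW0 : ∀ q, W (0, q) = V₁ q.1 + V₂ q.2) (hK : ContDiff ℝ 1 K)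
    (hKW : ∀ ε q, deriv V₂ q.2 - fderiv ℝ (fun q => W (ε, q)) q (0, 1) = ε * K (ε, q)) :
    ∃ r > 0, ∃ η₀ > 0, ∀ η > 0, η ≤ η₀ → ∃ ε₀ > 0, ∃ C, ∀ a x y,
      |a - a₀| < r → |x - x₀| < r → |y - y₀| < r → IsRegularStart V₁ V₂ a x y →
        HasActionFormula W K V₁ V₂ η ε₀ C a x y := by
  obtain ⟨ha, m, c, d, l₁, hma, hm, l₂, hx⟩ := id h
  obtain ⟨r₁, hr₁, L, hL, Z, hZ, HZ⟩ := h.exists_returnMap hV₁ hV₂ hW hW0 hK hKW l₂ hx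
  obtain ⟨r₂, hr₂, M, HM⟩ := exists_energy_eq hW (a₀ := a₀) (x₀ := x₀)
    (by rw [grad_fst_zero hV₁ hV₂ hW0]; exact (l₁.deriv_signs hma).2)
  obtain ⟨σ, hσ, s, hs, A, A', M₂, HA, HA'⟩ := l₂.exists_action_expansion hV₂
  set w₀ := initState 0 a₀ x₀ y₀ with hw₀
  set e := y₀ ^ 2 / 2 + V₂ x₀ with he
  have hw₀r : dist w₀ w₀ < r₁ := by rw [dist_self]; exact hr₁
  have hnear : ∀ v₀ : ExtState, v₀.2.1.2.2 ^ 2 / 2 + V₂ v₀.2.1.1.2 = e → v₀.2.1.1.2 ∈ Icc c d →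
      ∃ r > 0, ∀ v, dist v v₀ < r → |v.2.1.2.2 ^ 2 / 2 + V₂ v.2.1.1.2 - e| < σ ∧
        v.2.1.1.2 ∈ Icc (c - s) (d + s) := by
    intro v₀ h1 h2
    have c1 : Continuous fun v : ExtState => |v.2.1.2.2 ^ 2 / 2 + V₂ v.2.1.1.2 - e| := by
      have := hV₂.continuous
      fun_prop
    have c2 : Continuous fun v : ExtState => v.2.1.1.2 := by fun_prop
    exact Metric.eventually_nhds_iff.1 ((c1.continuousAt.eventually (gt_mem_nhds (by
      simp only [h1, sub_self, abs_zero]; exact hσ))).and (c2.continuousAt.eventually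
      (Icc_mem_nhds (by linarith [h2.1]) (by linarith [h2.2]))))
  obtain ⟨r₃, hr₃, H₃⟩ := hnear w₀ rfl hx
  obtain ⟨r₄, hr₄, H₄⟩ := hnear (Z w₀) (by
    obtain ⟨T, q, p, -, -, -, -, -, h1, -⟩ := (HZ 0 a₀ x₀ y₀ hw₀r).1
    rw [hw₀, h1]; simp [he]) hZ
  set r := min r₁ (min r₃ (r₄ / L)) with hr
  have hr0 : 0 < r := by positivity
  have hrr₁ : r ≤ r₁ := min_le_left _ _
  have hrr₃ : r ≤ r₃ := (min_le_right _ _).trans (min_le_left _ _)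
  have hrr₄ : r ≤ r₄ / L := (min_le_right _ _).trans (min_le_right _ _)
  have HZ₄ : ∀ ε a x y, dist (initState ε a x y) w₀ < r →
      dist (Z (initState ε a x y)) (Z w₀) < r₄ := by
    intro ε a x y hw
    refine ((HZ ε a x y (hw.trans_le hrr₁)).2 0 a₀ x₀ y₀ hw₀r).trans_lt ?_
    rw [mul_comm, ← lt_div_iff₀ hL]
    exact hw.trans_le hrr₄
  refine ⟨min r₂ (r / 2), by positivity, min r₂ (r / 2), by positivity, fun η hη hη₀ => ?_⟩
  obtain ⟨ε₁, hε₁, Hε⟩ := HM η hη (hη₀.trans (min_le_left _ _))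
  have hηr : η ≤ r / 2 := hη₀.trans (min_le_right _ _)
  -- The two initial states differ by `|ε|` in the parameter and by at most `M * |ε|` in the first
  -- position, the latter to stay on the energy surface.
  set D := L * (1 + M) with hD
  refine ⟨min ε₁ r, by positivity, 4 * M₂ * D ^ 2 + 3 * M₂ * D, fun a x y ha hx hy hreg => ?_⟩
  have har := ha.trans_le (min_le_right _ _)
  have hxr := hx.trans_le (min_le_right _ _)
  have hyr := hy.trans_le (min_le_right _ _)
  have hw0 : dist (initState 0 a x y) w₀ < r :=
    dist_initState_lt (by simpa using hr0) (by linarith) (by linarith) (by linarith)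
  obtain ⟨T₀, q, p, hqp, hq0, hp0, hend, htr, hen, hint⟩ := (HZ 0 a x y (hw0.trans_le hrr₁)).1
  obtain ⟨q', p', hqp', hq0', hp0'⟩ := hreg.exists_isFirstReturn hV₁ hV₂ hW0 hK.continuous hKW
  -- The return map supplies some return time; uniqueness of motions identifies it with the explicit
  -- one.
  have hT₀ : T₀ = impactPeriod V₁ a (V₁ a) :=
    hqp.time_eq (contDiff_section hW 0) hqp' (by rw [hq0, hq0']) (by rw [hp0, hp0']) htr
  rw [hT₀] at hqp hint
  refine ⟨q, p, hqp, hq0, hp0, fun ε hε => ?_⟩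
  obtain ⟨a', haη, hW', haM, huniq⟩ := Hε a x (ha.trans_le (min_le_left _ _))
    (hx.trans_le (min_le_left _ _)) ε (hε.trans_le (min_le_left _ _))
  refine ⟨a', ⟨haη, hW'⟩, huniq, ?_⟩
  have hw : dist (initState ε a' x y) w₀ < r := by
    refine dist_initState_lt ?_ ?_ (by linarith) (by linarith)
    · rw [sub_zero]; exact hε.trans_le (min_le_right _ _)
    · have := abs_sub_le a' a a₀
      linarith
  obtain ⟨⟨T, qε, pε, hret, hqε, hpε, hendε, htrε, henε, -⟩, hlip⟩ := HZ ε a' x y (hw.trans_le hrr₁)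
  have hdist := hlip 0 a x y (hw0.trans_le hrr₁)
  set Z₁ := Z (initState ε a' x y) with hZ₁
  set Z₀ := Z (initState 0 a x y) with hZ₀
  have hdist' : dist Z₁ Z₀ ≤ D * |ε| := by
    refine hdist.trans ?_
    have := dist_initState_le ε a' x y 0 a
    rw [sub_zero] at this
    calc L * dist (initState ε a' x y) (initState 0 a x y) ≤ L * (|ε| + M * |ε|) := by
          gcongr; linarith
      _ = D * |ε| := by rw [hD]; ring
  refine ⟨Z₁.2.1, ?_, ?_⟩
  · ext z
    constructor
    · rintro ⟨T', q₂, p₂, h₂, hq₂, hp₂, rfl⟩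
      have hT : T = T' := hret.time_eq (contDiff_section hW ε) h₂ (by rw [hqε, hq₂])
        (by rw [hpε, hp₂]) htrε
      subst hT
      have := hret.2.1.eqOn (contDiff_section hW ε) h₂.2.1 (by rw [hqε, hq₂])
        (by rw [hpε, hp₂]) htrε (t := T) ⟨hret.1.le, le_rfl⟩ ⟨hret.1.le, le_rfl⟩
      rw [mem_singleton_iff, ← hendε, this.1, this.2]
    · rintro rfl
      exact ⟨T, qε, pε, hret, hqε, hpε, hendε.symm⟩
  · obtain ⟨n₁, n₂⟩ := H₃ _ (hw0.trans_le hrr₃)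
    obtain ⟨n₃, n₄⟩ := H₄ _ (HZ₄ ε a' x y hw)
    obtain ⟨n₅, n₆⟩ := H₄ _ (HZ₄ 0 a x y hw0)
    rw [← hZ₁] at n₃ n₄
    rw [← hZ₀] at n₅ n₆
    simp only [initState] at n₁ n₂
    have hle : ∀ x y : ℝ, V₂ x ≤ y ^ 2 / 2 + V₂ x := fun x y => by
      have := sq_nonneg y
      linarith
    obtain ⟨k₁, k₂, k₃⟩ := HA _ n₁ x n₂ (hle x y)
    have k₄ := (HA _ n₃ _ n₄ (hle _ _)).1
    rw [zero_mul, add_zero] at hen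
    have k₅ := HA' _ n₆ _ n₄ _ _ n₅ n₃
    rw [hen] at k₅
    rw [k₁, k₂, k₄, hint]
    have hx' : |Z₀.2.1.1.2 - Z₁.2.1.1.2| ≤ D * |ε| := by
      refine le_trans ?_ hdist'
      rw [abs_sub_comm]
      simp [Prod.dist_eq, Real.dist_eq]
    have hy' : |Z₀.2.1.2.2 - Z₁.2.1.2.2| ≤ D * |ε| := by
      refine le_trans ?_ hdist'
      rw [abs_sub_comm]
      simp [Prod.dist_eq, Real.dist_eq]
    have hS : |Z₁.2.2 - Z₀.2.2| ≤ D * |ε| := by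
      refine le_trans ?_ hdist'
      simp [Prod.dist_eq, Real.dist_eq]
    have hA3 : |A' (y ^ 2 / 2 + V₂ x)| ≤ 3 * M₂ := by
      refine abs_deriv_le_of_expansion (A := A) n₁ (fun y' hy' => ?_) (fun y' hy' => ?_)
      · exact (k₃ _ hy' x n₂ (hle x y')).2
      · have := HA' x n₂ x n₂ y y' n₁ hy'
        simpa using this
    have hM₂ : 0 ≤ M₂ := by linarith [abs_nonneg (A' (y ^ 2 / 2 + V₂ x))]
    refine exists_quotient_bound (S₁ := Z₁.2.2) (fun h0 => ?_) ?_ hS hA3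
    · rw [henε, h0, zero_mul, add_zero]
    · have e1 : Z₁.2.1.2.2 ^ 2 / 2 + V₂ Z₁.2.1.1.2 - (y ^ 2 / 2 + V₂ x) = ε * Z₁.2.2 := by
        rw [henε]; ring
      rw [e1] at k₅
      refine k₅.trans (mul_le_mul_of_nonneg_left ?_ hM₂)
      refine pow_le_pow_left₀ (by positivity) (by linarith) 2

end ImpactSystem

end

/-! ### Compactness of the initial conditions and the resulting uniform formula -/

noncomputable section

namespace ImpactSystem

open Set Filter Topology MeasureTheory

/-! ### Uniformity on compact sets of initial conditions -/

/-- The window η enters both an existence and a uniqueness claim, so the formula is not monotone in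
it. The local statement therefore holds for all small η, with ε₀ and C depending on η: a common η is
fixed for the finitely many neighbourhoods before ε₀ and C are combined. -/
theorem exists_uniform_hasActionFormula {W K : ℝ × (ℝ × ℝ) → ℝ} {V₁ V₂ : ℝ → ℝ}
    (hV₁ : ContDiff ℝ 3 V₁) (hV₂ : ContDiff ℝ 3 V₂) (hW : ContDiff ℝ 2 W)
    (hW0 : ∀ q, W (0, q) = V₁ q.1 + V₂ q.2) (hK : ContDiff ℝ 1 K)
    (hKW : ∀ ε q, deriv V₂ q.2 - fderiv ℝ (fun q => W (ε, q)) q (0, 1) = ε * K (ε, q))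
    {S : Set (ℝ × (ℝ × ℝ))} (hS : IsCompact S)
    (hreg : ∀ v ∈ S, IsRegularStart V₁ V₂ v.1 v.2.1 v.2.2) :
    ∃ η > 0, ∃ ε₀ > 0, ∃ C, ∀ v ∈ S, HasActionFormula W K V₁ V₂ η ε₀ C v.1 v.2.1 v.2.2 := by
  obtain ⟨η₀, hη₀, h⟩ : ∃ η₀ > 0, ∀ η > 0, η ≤ η₀ → ∃ ε₀ > 0, ∃ C, ∀ v ∈ S,
      IsRegularStart V₁ V₂ v.1 v.2.1 v.2.2 →
        HasActionFormula W K V₁ V₂ η ε₀ C v.1 v.2.1 v.2.2 := by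
    refine hS.induction_on (p := fun S => ∃ η₀ > 0, ∀ η > 0, η ≤ η₀ → ∃ ε₀ > 0, ∃ C, ∀ v ∈ S,
      IsRegularStart V₁ V₂ v.1 v.2.1 v.2.2 →
        HasActionFormula W K V₁ V₂ η ε₀ C v.1 v.2.1 v.2.2) ?_ ?_ ?_ ?_
    · exact ⟨1, one_pos, fun η _ _ => ⟨1, one_pos, 0, fun v hv => absurd hv (notMem_empty v)⟩⟩
    · rintro s t hst ⟨η₀, hη₀, h⟩
      refine ⟨η₀, hη₀, fun η hη hle => ?_⟩
      obtain ⟨ε₀, hε₀, C, hC⟩ := h η hη hle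
      exact ⟨ε₀, hε₀, C, fun v hv => hC v (hst hv)⟩
    · rintro s t ⟨η₁, hη₁, h₁⟩ ⟨η₂, hη₂, h₂⟩
      refine ⟨min η₁ η₂, lt_min hη₁ hη₂, fun η hη hle => ?_⟩
      obtain ⟨ε₁, hε₁, C₁, hC₁⟩ := h₁ η hη (hle.trans (min_le_left _ _))
      obtain ⟨ε₂, hε₂, C₂, hC₂⟩ := h₂ η hη (hle.trans (min_le_right _ _))
      refine ⟨min ε₁ ε₂, lt_min hε₁ hε₂, max C₁ C₂, fun v hv hr => ?_⟩
      rcases hv with hv | hv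
      · exact (hC₁ v hv hr).mono (min_le_left _ _) (le_max_left _ _)
      · exact (hC₂ v hv hr).mono (min_le_right _ _) (le_max_right _ _)
    · intro v hv
      obtain ⟨r, hr, η₀, hη₀, h⟩ := (hreg v hv).exists_hasActionFormula hV₁ hV₂ hW hW0 hK hKW
      refine ⟨Metric.ball v r, mem_nhdsWithin_of_mem_nhds (Metric.ball_mem_nhds v hr), η₀, hη₀,
        fun η hη hle => ?_⟩
      obtain ⟨ε₀, hε₀, C, hC⟩ := h η hη hle
      refine ⟨ε₀, hε₀, C, fun u hu => ?_⟩
      simp only [Metric.mem_ball, Prod.dist_eq, Real.dist_eq, max_lt_iff] at hu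
      exact hC _ _ _ hu.1 hu.2.1 hu.2.2
  obtain ⟨ε₀, hε₀, C, hC⟩ := h η₀ hη₀ le_rfl
  exact ⟨η₀, hη₀, ε₀, hε₀, C, fun v hv => hC v hv (hreg v hv)⟩

/-! ### The admissible initial conditions -/

/-- The initial conditions `(a, x, y)` of the unperturbed system that are admitted. -/
def admissible (V₁ V₂ : ℝ → ℝ) (H δ ρ κ : ℝ) : Set (ℝ × (ℝ × ℝ)) :=
  {v | V₁ v.1 + (v.2.2 ^ 2 / 2 + V₂ v.2.1) = H ∧ 0 < v.1 ∧ 0 < deriv V₁ v.1 ∧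
    v.2.2 ^ 2 / 2 + V₂ v.2.1 ∈ regularEnergies V₂ V₁ H δ ∧
    (∀ I ∈ tangentActions V₁ V₂ H v.2.1 (v.2.2 ^ 2 / 2 + V₂ v.2.1),
      ρ ≤ |action V₂ v.2.1 (v.2.2 ^ 2 / 2 + V₂ v.2.1) - I|) ∧
    (0 ∈ well V₁ v.1 (V₁ v.1) ∨ κ ≤ action V₁ v.1 (V₁ v.1))}

lemma isCompact_sublevel {V : ℝ → ℝ} (hV : Continuous V)
    (hc : Tendsto V (cocompact ℝ) atTop) (h : ℝ) : IsCompact {x | V x ≤ h} := by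
  obtain ⟨S, hS, hS'⟩ := mem_cocompact.1 (hc.eventually (eventually_gt_atTop h))
  refine hS.of_isClosed_subset (isClosed_le hV continuous_const) fun x hx => ?_
  by_contra hn
  exact absurd (show V x ≤ h from hx) (not_le.2 (hS' hn))

lemma isCompact_closure_admissible {V₁ V₂ : ℝ → ℝ} (hV₁ : Continuous V₁) (hV₂ : Continuous V₂)
    (hc₁ : Tendsto V₁ (cocompact ℝ) atTop) (hc₂ : Tendsto V₂ (cocompact ℝ) atTop)
    (hb₁ : BddBelow (range V₁)) (hb₂ : BddBelow (range V₂)) (H δ ρ κ : ℝ) :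
    IsCompact (closure (admissible V₁ V₂ H δ ρ κ)) := by
  obtain ⟨B₁, hB₁⟩ := hb₁
  obtain ⟨B₂, hB₂⟩ := hb₂
  have hB₁' : ∀ x, B₁ ≤ V₁ x := fun x => hB₁ (mem_range_self x)
  have hB₂' : ∀ x, B₂ ≤ V₂ x := fun x => hB₂ (mem_range_self x)
  -- Energy conservation gives y² ≤ 2(H - B₁ - B₂), and |y| ≤ y² + 1.
  have hcy : IsCompact (Icc (-(2 * (H - B₁ - B₂) + 1)) (2 * (H - B₁ - B₂) + 1)) := isCompact_Icc
  refine ((isCompact_sublevel hV₁ hc₁ (H - B₂)).prod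
    ((isCompact_sublevel hV₂ hc₂ (H - B₁)).prod hcy)).closure_of_subset fun v hv => ?_
  have h1 := hv.1
  have h2 := hB₁' v.1
  have h3 := hB₂' v.2.1
  have h4 := sq_nonneg v.2.2
  refine ⟨?_, ?_, ?_, ?_⟩
  · change V₁ v.1 ≤ H - B₂
    linarith
  · change V₂ v.2.1 ≤ H - B₁
    linarith
  · nlinarith [sq_nonneg (v.2.2 + 1)]
  · nlinarith [sq_nonneg (v.2.2 - 1)]

section

variable {V₁ V₂ : ℝ → ℝ} {H δ ρ κ : ℝ} {v : ℝ × (ℝ × ℝ)}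

/-- Limits of admissible initial conditions are not tangent to the wall. -/
lemma ne_of_mem_closure_admissible (hV₂ : ContDiff ℝ 3 V₂) (hρ : 0 < ρ)
    (hv : v ∈ closure (admissible V₁ V₂ H δ ρ κ)) {c d : ℝ}
    (l₂ : IsLeaf V₂ c d (v.2.2 ^ 2 / 2 + V₂ v.2.1)) (hx : v.2.1 ∈ Icc c d) :
    v.2.2 ^ 2 / 2 + V₂ v.2.1 ≠ H - V₁ 0 := by
  intro heq
  obtain ⟨σ, hσ, s, hs, A, A', M, HA, -⟩ := l₂.exists_action_expansion hV₂
  set e := v.2.2 ^ 2 / 2 + V₂ v.2.1 with he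
  have hc : Continuous fun u : ℝ × (ℝ × ℝ) => u.2.2 ^ 2 / 2 + V₂ u.2.1 := by
    have := hV₂.continuous
    fun_prop
  have hc' : Continuous fun u : ℝ × (ℝ × ℝ) => |u.2.2 ^ 2 / 2 + V₂ u.2.1 - e| := by fun_prop
  have hc'' : Continuous fun u : ℝ × (ℝ × ℝ) => u.2.1 := by fun_prop
  have h0 : |v.2.2 ^ 2 / 2 + V₂ v.2.1 - e| = 0 := by simp [he]
  have e1 := hc'.continuousAt.eventually (gt_mem_nhds
    (show |v.2.2 ^ 2 / 2 + V₂ v.2.1 - e| < σ by rw [h0]; exact hσ))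
  -- So close in energy, the Lipschitz bound puts the action within less than ρ of the tangency
  -- value on the same branch, contradicting admissibility.
  have e2 := hc'.continuousAt.eventually (gt_mem_nhds
    (show |v.2.2 ^ 2 / 2 + V₂ v.2.1 - e| < ρ / (|M| + 1) by rw [h0]; positivity))
  have e3 := hc''.continuousAt.eventually
    (Icc_mem_nhds (a := c - s) (b := d + s) (x := v.2.1) (by linarith [hx.1]) (by linarith [hx.2]))
  obtain ⟨u, hu, ⟨h1, h2⟩, h3⟩ :=
    ((mem_closure_iff_frequently.1 hv).and_eventually ((e1.and e2).and e3)).exists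
  have hle : ∀ x y : ℝ, V₂ x ≤ y ^ 2 / 2 + V₂ x := fun x y => by
    have := sq_nonneg y
    linarith
  have hx' : v.2.1 ∈ Icc (c - s) (d + s) := ⟨by linarith [hx.1], by linarith [hx.2]⟩
  have hee : |e - e| < σ := by simpa using hσ
  obtain ⟨k1, -, k2⟩ := HA _ h1 _ h3 (hle _ _)
  obtain ⟨k3, k4⟩ := k2 e hee _ hx' (hle _ _)
  have k5 := (HA e hee _ hx' (hle _ _)).1
  have key := hu.2.2.2.2.1 (action V₂ v.2.1 e)
    ⟨v.2.1, by rw [← heq]; exact hle _ _, by rw [← heq]; exact k3, by rw [heq]⟩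
  rw [k1, k5, abs_sub_comm] at key
  rw [abs_sub_comm e] at k4
  rw [lt_div_iff₀ (by positivity)] at h2
  have h6 := abs_nonneg (u.2.2 ^ 2 / 2 + V₂ u.2.1 - e)
  have h7 := mul_le_mul_of_nonneg_right (le_abs_self M) h6
  linarith

/-- Limits of admissible initial conditions are not centers of the first degree of freedom. -/
lemma deriv_ne_zero_of_mem_closure_admissible (hV₁ : ContDiff ℝ 3 V₁) (hκ : 0 < κ)
    (hv : v ∈ closure (admissible V₁ V₂ H δ ρ κ)) (hpos : 0 < v.1)
    (l : IsLeaf V₁ v.1 v.1 (V₁ v.1)) : False := by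
  obtain ⟨hd0, hdd⟩ : deriv V₁ v.1 = 0 ∧ 0 < deriv (deriv V₁) v.1 := by
    rcases l.nondegenerate with h | h
    · exact absurd h.1 (lt_irrefl _)
    · exact h.2
  obtain ⟨σ, hσ, s, hs, A, A', M, HA, -⟩ := l.exists_action_expansion hV₁
  have hVc := hV₁.continuous
  have hc : Continuous fun u : ℝ × (ℝ × ℝ) => V₁ u.1 := by fun_prop
  have hc' : Continuous fun u : ℝ × (ℝ × ℝ) => |V₁ u.1 - V₁ v.1| := by fun_prop
  have hc'' : Continuous fun u : ℝ × (ℝ × ℝ) => u.1 := by fun_prop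
  have h0 : |V₁ v.1 - V₁ v.1| = 0 := by simp
  -- A barrier between the wall and the center: leaves close to the center cannot reach 0. For them
  -- admissibility demands action at least κ, although the action tends to 0 at the center.
  obtain ⟨w, hw0, hwv, hVw⟩ : ∃ w, 0 < w ∧ w < v.1 ∧ V₁ v.1 < V₁ w := by
    have h1 : DifferentiableAt ℝ (deriv V₁) v.1 := by
      by_contra hn
      rw [deriv_zero_of_not_differentiableAt hn] at hdd
      exact lt_irrefl _ hdd
    have hneg : ∀ᶠ x in 𝓝[<] v.1, deriv V₁ x < 0 := by
      have h2 := (hasDerivAt_iff_tendsto_slope.1 h1.hasDerivAt).eventually (lt_mem_nhds hdd)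
      have h3 : ∀ᶠ x in 𝓝[<] v.1, 0 < slope (deriv V₁) v.1 x :=
        h2.filter_mono (nhdsWithin_mono _ fun x hx => (mem_Iio.1 hx).ne)
      filter_upwards [h3, self_mem_nhdsWithin] with x hx hxv
      rw [slope_def_field, hd0, sub_zero] at hx
      rcases div_pos_iff.1 hx with h | h
      · exact absurd h.2 (not_lt.2 (sub_nonpos.2 (mem_Iio.1 hxv).le))
      · exact h.1
    obtain ⟨w, hw, Hw⟩ := (mem_nhdsLT_iff_exists_Ioo_subset).1 hneg
    have hw' : max w 0 < v.1 := max_lt (mem_Iio.1 hw) hpos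
    obtain ⟨w', h1', h2'⟩ := exists_between hw'
    refine ⟨w', (le_max_right _ _).trans_lt h1', h2', ?_⟩
    have hanti : StrictAntiOn V₁ (Icc w' v.1) := by
      refine strictAntiOn_of_deriv_neg (convex_Icc _ _) hVc.continuousOn fun x hx => ?_
      rw [interior_Icc] at hx
      exact Hw ⟨(le_max_left _ _).trans_lt (h1'.trans hx.1), hx.2⟩
    exact hanti ⟨le_rfl, h2'.le⟩ ⟨h2'.le, le_rfl⟩ h2'
  have e1 := hc'.continuousAt.eventually (gt_mem_nhds
    (show |V₁ v.1 - V₁ v.1| < σ by rw [h0]; exact hσ))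
  have e2 := hc'.continuousAt.eventually (gt_mem_nhds
    (show |V₁ v.1 - V₁ v.1| < κ / (|M| + 1) by rw [h0]; positivity))
  have e3 := hc''.continuousAt.eventually
    (Icc_mem_nhds (a := v.1 - s) (b := v.1 + s) (x := v.1) (by linarith) (by linarith))
  have e4 := hc''.continuousAt.eventually (lt_mem_nhds hwv)
  have e5 := hc.continuousAt.eventually (gt_mem_nhds hVw)
  obtain ⟨u, hu, ⟨h1, h2⟩, h3, h4, h5⟩ :=
    ((mem_closure_iff_frequently.1 hv).and_eventually ((e1.and e2).and (e3.and (e4.and e5)))).exists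
  rcases hu.2.2.2.2.2 with h | h
  · have hmem : u.1 ∈ well V₁ u.1 (V₁ u.1) := mem_connectedComponentIn (by simp)
    have hsub := isPreconnected_connectedComponentIn.ordConnected.out h hmem ⟨hw0.le, h4.le⟩
    have := connectedComponentIn_subset _ _ hsub
    exact absurd (show V₁ w ≤ V₁ u.1 from this) (not_le.2 h5)
  · obtain ⟨k1, -, k2⟩ := HA _ h1 _ h3 le_rfl
    have hee : |V₁ v.1 - V₁ v.1| < σ := by simpa using hσ
    have hv' : v.1 ∈ Icc (v.1 - s) (v.1 + s) := ⟨by linarith, by linarith⟩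
    obtain ⟨-, k4⟩ := k2 _ hee _ hv' le_rfl
    have k5 := (HA _ hee _ hv' le_rfl).1
    have k6 : action V₁ v.1 (V₁ v.1) = 0 := by
      rw [action, l.well_eq hV₁ ⟨le_rfl, le_rfl⟩]
      simp
    rw [k6] at k5
    rw [k1] at h
    rw [← k5, zero_sub, abs_neg, abs_sub_comm] at k4
    rw [lt_div_iff₀ (by positivity)] at h2
    have h6 := abs_nonneg (V₁ u.1 - V₁ v.1)
    have h7 := mul_le_mul_of_nonneg_right (le_abs_self M) h6
    have h8 := le_abs_self (A (V₁ u.1))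
    linarith

/-- The δ-conditions are closed and keep both leaves nonsingular in the limit. The strict conditions
are recovered otherwise: a limit with first turning point 0, or with the other end of the first leaf
at 0, has V₁(a) = V₁(0), which is tangency; a limit with a one-point first leaf is a center. Finally
V₁'(a) ≥ 0 singles out a as the right end of its leaf. -/
theorem isRegularStart_of_mem_closure_admissible (hV₁ : ContDiff ℝ 3 V₁) (hV₂ : ContDiff ℝ 3 V₂)
    (hm₁ : ∀ x, deriv V₁ x = 0 → deriv (deriv V₁) x ≠ 0)
    (hm₂ : ∀ x, deriv V₂ x = 0 → deriv (deriv V₂) x ≠ 0)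
    (hc₁ : Tendsto V₁ (cocompact ℝ) atTop) (hc₂ : Tendsto V₂ (cocompact ℝ) atTop)
    (hδ : 0 < δ) (hρ : 0 < ρ) (hκ : 0 < κ) (hv : v ∈ closure (admissible V₁ V₂ H δ ρ κ)) :
    IsRegularStart V₁ V₂ v.1 v.2.1 v.2.2 := by
  have cV₁ := hV₁.continuous
  have cV₂ := hV₂.continuous
  have cV₁' : Continuous (deriv V₁) := hV₁.continuous_deriv (by norm_num)
  have hH : V₁ v.1 + (v.2.2 ^ 2 / 2 + V₂ v.2.1) = H :=
    closure_minimal (t := {u : ℝ × (ℝ × ℝ) | V₁ u.1 + (u.2.2 ^ 2 / 2 + V₂ u.2.1) = H})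
      (fun u hu => hu.1) (isClosed_eq (by fun_prop) continuous_const) hv
  have ha : 0 ≤ v.1 := closure_minimal (t := {u : ℝ × (ℝ × ℝ) | 0 ≤ u.1})
    (fun u hu => hu.2.1.le) (isClosed_le continuous_const (by fun_prop)) hv
  have hd : 0 ≤ deriv V₁ v.1 := closure_minimal (t := {u : ℝ × (ℝ × ℝ) | 0 ≤ deriv V₁ u.1})
    (fun u hu => hu.2.2.1.le) (isClosed_le continuous_const (by fun_prop)) hv
  have hs₂ : ∀ s, IsSaddle V₂ s → V₂ s ≠ v.2.2 ^ 2 / 2 + V₂ v.2.1 := by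
    intro s hs heq
    have : δ ≤ |v.2.2 ^ 2 / 2 + V₂ v.2.1 - V₂ s| :=
      closure_minimal (t := {u : ℝ × (ℝ × ℝ) | δ ≤ |u.2.2 ^ 2 / 2 + V₂ u.2.1 - V₂ s|})
        (fun u hu => hu.2.2.2.1.2.2.1 s hs) (isClosed_le continuous_const (by fun_prop)) hv
    rw [heq, sub_self, abs_zero] at this
    linarith
  have hs₁ : ∀ s, IsSaddle V₁ s → V₁ s ≠ V₁ v.1 := by
    intro s hs heq
    have : δ ≤ |v.2.2 ^ 2 / 2 + V₂ v.2.1 - (H - V₁ s)| :=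
      closure_minimal (t := {u : ℝ × (ℝ × ℝ) | δ ≤ |u.2.2 ^ 2 / 2 + V₂ u.2.1 - (H - V₁ s)|})
        (fun u hu => hu.2.2.2.1.2.2.2 s hs) (isClosed_le continuous_const (by fun_prop)) hv
    rw [heq, ← hH, add_sub_cancel_left, sub_self, abs_zero] at this
    linarith
  obtain ⟨c, d, l₂, hx⟩ := exists_leaf hV₂ hm₂ hc₂ hs₂ (x₀ := v.2.1)
    (by linarith [sq_nonneg v.2.2])
  have hne : V₁ v.1 ≠ V₁ 0 := fun h =>
    ne_of_mem_closure_admissible hV₂ hρ hv l₂ hx (by linarith)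
  have ha0 : 0 < v.1 := ha.lt_of_ne fun h => hne (by rw [← h])
  obtain ⟨m, b, l₁, hab⟩ := exists_leaf hV₁ hm₁ hc₁ hs₁ (x₀ := v.1) le_rfl
  rcases l₁.le.eq_or_lt with rfl | hmb
  · have hmv : v.1 = m := le_antisymm hab.2 hab.1
    rw [← hmv] at l₁
    exact (deriv_ne_zero_of_mem_closure_admissible hV₁ hκ hv ha0 l₁).elim
  · obtain ⟨h1, h2⟩ := l₁.deriv_signs hmb
    have hb : v.1 = b := by
      rcases hab.1.eq_or_lt with h | h
      · rw [← h] at hd; linarith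
      · rcases hab.2.eq_or_lt with h' | h'
        · exact h'
        · exact absurd (l₁.lt v.1 ⟨h, h'⟩) (lt_irrefl _)
    rw [← hb] at hmb
    refine ⟨ha0, m, c, d, ?_, hmb, ?_, l₂, hx⟩
    · convert l₁ using 1
    · rintro rfl
      exact hne l₁.left.symm

end

/-! ### The family of perturbed potentials -/

section

variable {r : ℕ} {V₁ V₂ : ℝ → ℝ} {Vr : ℝ × ℝ → ℝ} {cw cr : ℝ}

/-- The potential in rotated coordinates with a wall of slope `cw ε` and a perturbation of size
`cr ε`. -/
def perturbedPotential (V₁ V₂ : ℝ → ℝ) (Vr : ℝ × ℝ → ℝ) (cw cr : ℝ) (v : ℝ × (ℝ × ℝ)) : ℝ :=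
  rotatedPotential (cw * v.1) (potential V₁ V₂ Vr (cr * v.1)) v.2

lemma contDiff_perturbedPotential {n : WithTop ℕ∞} (h₁ : ContDiff ℝ n V₁) (h₂ : ContDiff ℝ n V₂)
    (hr : ContDiff ℝ n Vr) : ContDiff ℝ n (perturbedPotential V₁ V₂ Vr cw cr) := by
  refine contDiff_rotatedPotential (U := fun x => potential V₁ V₂ Vr (cr * x.1) x.2) ?_
  unfold potential
  fun_prop

lemma perturbedPotential_zero (q : ℝ × ℝ) :
    perturbedPotential V₁ V₂ Vr cw cr (0, q) = V₁ q.1 + V₂ q.2 := by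
  simp [perturbedPotential, rotatedPotential_zero, potential]

lemma hasDerivAt_perturbedPotential (h₁ : Differentiable ℝ V₁) (h₂ : Differentiable ℝ V₂)
    (hr : ContDiff ℝ 1 Vr) (q : ℝ × ℝ) :
    HasDerivAt (fun ε => perturbedPotential V₁ V₂ Vr cw cr (ε, q))
      (cw * (q.2 * deriv V₁ q.1 - q.1 * deriv V₂ q.2) + cr * Vr q) 0 := by
  have e0 : HasDerivAt (fun ε : ℝ => cw * ε) cw 0 := by
    simpa using (hasDerivAt_id (0 : ℝ)).const_mul cw
  have e0' : HasDerivAt (fun ε : ℝ => cr * ε) cr 0 := by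
    simpa using (hasDerivAt_id (0 : ℝ)).const_mul cr
  have e1 := hasDerivAt_rotated_separable h₁ h₂ q
  rw [← mul_zero cw] at e1
  have e2 := e1.comp (0 : ℝ) e0
  have e3 : DifferentiableAt ℝ (fun ε => rotatedPotential (cw * ε) Vr q) 0 := by
    have h3 : ContDiff ℝ 1 fun x : ℝ × (ℝ × ℝ) => rotatedPotential (cw * x.1) (fun v => Vr v) x.2 :=
      contDiff_rotatedPotential (hr.comp contDiff_snd)
    exact ((h3.comp (contDiff_id.prodMk contDiff_const)).differentiable (by norm_num) 0 :)
  have e4 := e2.fun_add (e0'.fun_mul e3.hasDerivAt)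
  refine e4.congr_deriv ?_
  simp [rotatedPotential_zero]
  ring

/-- The rate of change of the second energy, divided by the perturbation parameter. -/
theorem exists_energyRate (hr : 4 < r) (h₁ : ContDiff ℝ (r + 1) V₁) (h₂ : ContDiff ℝ (r + 1) V₂)
    (h₃ : ContDiff ℝ (r + 1) Vr) :
    ∃ K : ℝ × (ℝ × ℝ) → ℝ, ContDiff ℝ 1 K ∧
      (∀ ε q, deriv V₂ q.2 -
        fderiv ℝ (fun q => perturbedPotential V₁ V₂ Vr cw cr (ε, q)) q (0, 1) = ε * K (ε, q)) ∧
      ∀ q, K (0, q) = cw * (-deriv V₁ q.1 + q.1 * deriv (deriv V₂) q.2) -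
        cr * fderiv ℝ Vr q (0, 1) := by
  set W := perturbedPotential V₁ V₂ Vr cw cr with hWd
  have hle : (3 : WithTop ℕ∞) ≤ (r : WithTop ℕ∞) + 1 := by
    exact_mod_cast (by omega : 3 ≤ r + 1)
  have hW : ContDiff ℝ (2 + 1) W :=
    (contDiff_perturbedPotential h₁ h₂ h₃).of_le (by norm_num; exact hle)
  have hD : ContDiff ℝ 2 (divided W) := contDiff_divided (n := 2) hW
  have hDd : Differentiable ℝ (divided W) := hD.differentiable (by norm_num)
  have hV₁ : ContDiff ℝ 3 V₁ := h₁.of_le hle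
  have hV₂ : ContDiff ℝ 3 V₂ := h₂.of_le hle
  have d₁ : Differentiable ℝ V₁ := hV₁.differentiable (by norm_num)
  have d₂ : Differentiable ℝ V₂ := hV₂.differentiable (by norm_num)
  have hWeq : ∀ ε q, W (ε, q) = V₁ q.1 + V₂ q.2 + ε * divided W (ε, q) := fun ε q => by
    rw [eq_add_mul_divided (hW.of_le (by norm_num)) ε q, hWd, perturbedPotential_zero]
  have hsep : ∀ q : ℝ × ℝ, DifferentiableAt ℝ (fun q : ℝ × ℝ => V₁ q.1 + V₂ q.2) q := fun q =>
    (contDiff_separable hV₁ hV₂).differentiable (by norm_num) q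
  -- K is minus the second position derivative of the Hadamard quotient in ε. At ε = 0 the quotient
  -- is the explicit ε-derivative of W, which yields the integrand of the formula.
  refine ⟨fun v => -fderiv ℝ (divided W) v (0, (0, 1)), ?_, fun ε q => ?_, fun q => ?_⟩
  · have h1 : ContDiff ℝ 1 (fderiv ℝ (divided W)) := hD.fderiv_right (by norm_num)
    exact (h1.clm_apply contDiff_const).neg
  · simp only [hWeq]
    have hDs : DifferentiableAt ℝ (fun q => divided W (ε, q)) q :=
      (contDiff_section hD ε).differentiable (by norm_num) q
    rw [fderiv_fun_add (hsep q) (hDs.const_mul ε), fderiv_const_mul hDs]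
    have hg := congrArg Prod.snd (grad_separable d₁ d₂ q)
    simp only [grad] at hg
    have hf := fderiv_section hDd ε q (0, 1)
    simp only [add_apply, smul_apply, smul_eq_mul, hg, hf]
    ring
  · simp only
    rw [← fderiv_section hDd]
    have hD0 : ∀ q, divided W (0, q) =
        cw * (q.2 * deriv V₁ q.1 - q.1 * deriv V₂ q.2) + cr * Vr q := by
      intro q
      rw [divided_zero]
      have h1 : HasDerivAt (fun ε : ℝ => ((ε, q) : ℝ × (ℝ × ℝ))) (1, 0) 0 :=
        (hasDerivAt_id (0 : ℝ)).prodMk (hasDerivAt_const 0 q)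
      have h2 := ((hW.differentiable (by norm_num)) (0, q)).hasFDerivAt.comp_hasDerivAt 0 h1
      exact h2.unique (hasDerivAt_perturbedPotential d₁ d₂
        (h₃.of_le (le_trans (by norm_num) hle)) q)
    simp only [hD0]
    have hVr : DifferentiableAt ℝ Vr q :=
      (h₃.of_le hle).differentiable (by norm_num) q
    have hdV₂ : DifferentiableAt ℝ (deriv V₂) q.2 :=
      (hV₂.of_le (by norm_num)).differentiable_deriv_two q.2
    -- Only the derivative in the direction (0, 1) is needed, so it is computed along a vertical
    -- line.
    have hline : HasDerivAt (fun t : ℝ => ((q.1, t) : ℝ × ℝ)) (0, 1) q.2 :=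
      (hasDerivAt_const q.2 q.1).prodMk (hasDerivAt_id q.2)
    have hdiff : DifferentiableAt ℝ (fun q : ℝ × ℝ =>
        cw * (q.2 * deriv V₁ q.1 - q.1 * deriv V₂ q.2) + cr * Vr q) q := by
      have h := (contDiff_section hD 0).differentiable (by norm_num) q
      simpa only [hD0] using h
    have h3 := hdiff.hasFDerivAt.comp_hasDerivAt (f := fun t : ℝ => ((q.1, t) : ℝ × ℝ)) q.2 hline
    have h4 := hVr.hasFDerivAt.comp_hasDerivAt (f := fun t : ℝ => ((q.1, t) : ℝ × ℝ)) q.2 hline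
    have h5 := ((((hasDerivAt_id q.2).mul_const (deriv V₁ q.1)).fun_sub
      (hdV₂.hasDerivAt.const_mul q.1)).const_mul cw).fun_add (h4.const_mul cr)
    have h6 := h3.unique h5
    rw [h6]
    ring

/-- The first-order formula for the change of the second action. -/
theorem actionChangeFormula (hr : 4 < r) (h₁ : IsS3B r V₁) (h₂ : IsS3B r V₂)
    (h₃ : ContDiff ℝ (r + 1) Vr) {H δ ρ : ℝ} (hδ : 0 < δ) (hρ : 0 < ρ) (cw cr : ℝ) :
    ActionChangeFormula V₁ V₂ H δ ρ (fun ε => cw * ε) (fun ε => potential V₁ V₂ Vr (cr * ε))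
      (fun q => cw * (-deriv V₁ q.1 + q.1 * deriv (deriv V₂) q.2) - cr * fderiv ℝ Vr q (0, 1)) := by
  intro κ hκ
  have hle : (3 : WithTop ℕ∞) ≤ (r : WithTop ℕ∞) + 1 := by
    exact_mod_cast (by omega : 3 ≤ r + 1)
  have hV₁ : ContDiff ℝ 3 V₁ := h₁.smooth.of_le hle
  have hV₂ : ContDiff ℝ 3 V₂ := h₂.smooth.of_le hle
  have hW : ContDiff ℝ 2 (perturbedPotential V₁ V₂ Vr cw cr) :=
    (contDiff_perturbedPotential h₁.smooth h₂.smooth h₃).of_le (le_trans (by norm_num) hle)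
  obtain ⟨K, hK, hKW, hK0⟩ := exists_energyRate (cw := cw) (cr := cr) hr h₁.smooth h₂.smooth h₃
  obtain ⟨η, hη, ε₀, hε₀, C, hC⟩ := exists_uniform_hasActionFormula hV₁ hV₂ hW
    perturbedPotential_zero hK hKW
    (isCompact_closure_admissible hV₁.continuous hV₂.continuous h₁.coercive h₂.coercive
      h₁.bddBelow h₂.bddBelow H δ ρ κ)
    (fun v hv => isRegularStart_of_mem_closure_admissible hV₁ hV₂ h₁.simple h₂.simple
      h₁.coercive h₂.coercive hδ hρ hκ hv)
  refine ⟨ε₀, hε₀, η, hη, C, fun a x y h hh hH ha hd hreg htan hκ' => ?_⟩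
  subst hh
  have hW0 : (fun q => perturbedPotential V₁ V₂ Vr cw cr (0, q)) =
      potential V₁ V₂ Vr (cr * 0) := by
    ext q; simp [perturbedPotential, rotatedPotential_zero]
  obtain ⟨q, p, h1, h2, h3, h4⟩ :=
    hC (a, (x, y)) (subset_closure ⟨hH, ha, hd, hreg, htan, hκ'⟩)
  rw [hW0] at h1
  refine ⟨q, p, h1, h2, h3, fun ε hε => ?_⟩
  -- On the section the kinetic energy is y²/2 for both systems, so being on the energy surface is
  -- an equation between potentials.
  have henergy : ∀ b, energy (rotatedPotential (cw * ε) (potential V₁ V₂ Vr (cr * ε))) (b, x) (0, y)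
      = H ↔ perturbedPotential V₁ V₂ Vr cw cr (ε, (b, x)) =
        perturbedPotential V₁ V₂ Vr cw cr (0, (a, x)) := by
    intro b
    rw [perturbedPotential_zero, energy, ← hH]
    simp only [dot, perturbedPotential]
    constructor <;> intro h <;> linarith
  obtain ⟨a', ⟨h5, h6⟩, h7, z, h8, f, h9, h10⟩ := h4 ε hε
  refine ⟨a', ⟨h5, (henergy a').2 h6⟩, fun b hb hbe => h7 b hb ((henergy b).1 hbe), z, ?_, f, h9, ?_⟩
  · rw [returnStates_eq]; exact h8
  · simpa only [hK0] using h10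

end

end ImpactSystem

end

theorem mainTheorem7 (r : ℕ) (hr : 4 < r) (V₁ V₂ : ℝ → ℝ) (Vr : ℝ × ℝ → ℝ)
    (hV₁ : ImpactSystem.IsS3B r V₁) (hV₂ : ImpactSystem.IsS3B r V₂)
    (hVr : ContDiff ℝ (r + 1) Vr) (hwall : ImpactSystem.RegularWall V₁) :
    -- the rotation is orthogonal, hence symplectic when applied to positions and momenta
    (∀ (εw : ℝ) (v w : ℝ × ℝ), ImpactSystem.dot (ImpactSystem.straighten εw v)
      (ImpactSystem.straighten εw w) = ImpactSystem.dot v w) ∧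
    -- it turns the impact system with the tilted wall into one with the perpendicular wall
    (∀ (εw εr T : ℝ) (q p : ℝ → ℝ × ℝ),
      ImpactSystem.IsImpactMotion (ImpactSystem.potential V₁ V₂ Vr εr)
          (ImpactSystem.wallNormal εw) T q p ↔
        ImpactSystem.IsImpactMotion
          (ImpactSystem.rotatedPotential εw (ImpactSystem.potential V₁ V₂ Vr εr)) (1, 0) T
          (fun t => ImpactSystem.straighten εw (q t))
          (fun t => ImpactSystem.straighten εw (p t))) ∧
    -- the potential in rotated coordinates is a small regular perturbation of the separable one
    (∃ Vrem : ℝ × (ℝ × ℝ) → ℝ, ContDiff ℝ r Vrem ∧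
      (∀ (εw εr : ℝ) (q : ℝ × ℝ),
        ImpactSystem.rotatedPotential εw (ImpactSystem.potential V₁ V₂ Vr εr) q =
          V₁ q.1 + V₂ q.2 + εw * Vrem (εw, q) + εr * ImpactSystem.rotatedPotential εw Vr q) ∧
      ∀ K : Set (ℝ × ℝ), IsCompact K → ∃ C : ℝ, ∀ q ∈ K, ∀ εw : ℝ, |εw| ≤ 1 →
        |Vrem (εw, q) - (q.2 * deriv V₁ q.1 - q.1 * deriv V₂ q.2)| ≤ C * |εw|) ∧
    ∀ H δ ρ : ℝ, 0 < δ → 0 < ρ → V₁ 0 ∈ ImpactSystem.regularEnergies V₁ V₂ H δ →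
      -- tilted wall only
      ImpactSystem.ActionChangeFormula V₁ V₂ H δ ρ (fun ε => ε)
        (fun _ => ImpactSystem.potential V₁ V₂ Vr 0)
        (fun q => -deriv V₁ q.1 + q.1 * deriv (deriv V₂) q.2) ∧
      -- tilted wall together with a regular perturbation of the same order
      ∀ cw cr : ℝ,
        ImpactSystem.ActionChangeFormula V₁ V₂ H δ ρ (fun ε => cw * ε)
          (fun ε => ImpactSystem.potential V₁ V₂ Vr (cr * ε))
          (fun q => cw * (-deriv V₁ q.1 + q.1 * deriv (deriv V₂) q.2)
            - cr * fderiv ℝ Vr q (0, 1)) := by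
  refine ⟨ImpactSystem.straighten_dot, fun εw εr T q p =>
    ImpactSystem.isImpactMotion_straighten _ εw T q p,
    ImpactSystem.exists_remainder hr Vr hV₁.smooth hV₂.smooth, fun H δ ρ hδ hρ _ => ⟨?_, fun cw cr =>
    ImpactSystem.actionChangeFormula hr hV₁ hV₂ hVr hδ hρ cw cr⟩⟩
  -- The tilted wall alone is the case cw = 1, cr = 0 of the combined perturbation.
  have h := ImpactSystem.actionChangeFormula (H := H) hr hV₁ hV₂ hVr hδ hρ 1 0
  simpa only [one_mul, zero_mul, sub_zero] using h
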